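/- **Theorem 3.2.** Let $\langle x_1,\dots,x_m\mid r_1,\dots,r_n\rangle$ be a finite presentation ($m,n\ge 0$, each $r_i$ a reduced word in the $x_j^{\pm1}$), let $a,b$ be two further letters, and let $J\ge 1$ be an integer with $9(n+4m)<10^J$. For $i\ge 1$ put $t_i=a^{10i-9}b\,a^{10i-8}b\cdots b\,a^{10i}b$. The *Rips relators* are the $n+4m$ words $$r_i\,t_i\ (1\le i\le n),\qquad x_j^{-1}ax_j\,t_{n+j},\quad x_jax_j^{-1}\,t_{m+n+j},\quad x_j^{-1}bx_j\,t_{2m+n+j},\quad x_jbx_j^{-1}\,t_{3m+n+j}\ (1\le j\le m).$$ Let $\Theta$ be a finite connected regular covering graph, with vertices $1,\dots,K$ ($K\ge1$), of the oriented bouquet of four cycles labelled $y_1,\dots,y_4$, such that all non-trivial cycles (closed paths of positive length without backtracking) of $\Theta$ have length at least $19$. Relabel each edge of $\Theta$ from a vertex $i$ to a vertex $k$ by the word $$ba^{-10^{J+10k-4}},\qquad a^{10^{J+10i}}ba^{-10^{J+10k-3}},\qquad a^{10^{J+10i-2}}ba^{-10^{J+10k}},\qquad a^{10^{J+10i-1}}b$$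 according to whether its label is $y_1$, $y_2$, $y_3$ or $y_4$. Add a new vertex $0$ and, for each $i\in\{1,\dots,K\}$, a path from $0$ to $i$ labelled $$c_i=b^i a^{10^{J+10i-9}}b\,a^{10^{J+10i-8}}b\,a^{10^{J+10i-7}}b\,a^{10^{J+10i-6}}b\,a^{10^{J+10i-5}}.$$ Subdivide all edges so that each edge bears one letter $a$ or $b$ (and an orientation), and perform all Stallings foldings; the resulting graph is the generalized Rips–Segev graph $\mathcal{RS}$. Let $\mathcal G$ be the disjoint union of $\mathcal{RS}$ and of $n+4m$ cycles labelled by the Rips relators, and let $$G=\langle x_1,\dots,x_m,a,b\mid \text{labels of the reduced cycles of }\mathcal G\rangle .$$ In the free group $\langle a\rangle*\langle b\rangle$ let $$A=\bigsqcup_{i=1}^K\left\{c_i,\ c_ia,\ c_ia^2,\ \dots,\ c_ia^{10^{J+10i}-1}\right\},\qquad B=\{1,a,b,ab\}.$$ Then $G$ does not have the unique product property, that is, it is not true that for all non-empty finite subsets $X,Y\subseteq G$ some element of $XY$ can be written in exactly one way as $xy$ with $x\in X$, $y\in Y$. More precisely, the canonical map to $G$ is injective on $A$ and on $B$, and no element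 of the product of their images $A'$ and $B'$ can be written in exactly one way as $xy$ with $x\in A'$ and $y\in B'$. -/

import Mathlib

/-- A directed graph (loops and multiple edges allowed) with edges labelled by elements of `α`.
Travelling along an edge in the positive direction reads its label, in the negative direction
the inverse of its label. -/
structure LabelledGraph (α : Type) where
  /-- vertices -/
  V : Type
  /-- directed edges -/
  E : Type
  /-- starting vertex of an edge -/
  src : E → V
  /-- terminal vertex of an edge -/
  tgt : E → V
  /-- label of an edge -/
  lab : E → α

namespace LabelledGraph

variable {α : Type}

/-- Starting vertex of an oriented edge: `(e, true)` is `e` travelled in the positive direction,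
`(e, false)` is `e` travelled in the negative direction. -/
def dartSrc (Γ : LabelledGraph α) (d : Γ.E × Bool) : Γ.V := if d.2 then Γ.src d.1 else Γ.tgt d.1

/-- Terminal vertex of an oriented edge. -/
def dartTgt (Γ : LabelledGraph α) (d : Γ.E × Bool) : Γ.V := if d.2 then Γ.tgt d.1 else Γ.src d.1

/-- `Γ.IsPath u p v`: the list `p` of oriented edges is an edge path from `u` to `v`. -/
def IsPath (Γ : LabelledGraph α) : Γ.V → List (Γ.E × Bool) → Γ.V → Prop
  | u, [], v => u = v
  | u, d :: p, v => Γ.dartSrc d = u ∧ Γ.IsPath (Γ.dartTgt d) p v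

/-- The element of the free group read along a list of oriented edges. -/
def pathLabel (Γ : LabelledGraph α) (p : List (Γ.E × Bool)) : FreeGroup α :=
  FreeGroup.mk (p.map fun d => (Γ.lab d.1, d.2))

/-- `Γ.IsReducedCycle v p`: `p` is a non-trivial closed path at `v` without backtracking, i.e.
no edge is immediately followed by the same edge travelled in the opposite direction. -/
def IsReducedCycle (Γ : LabelledGraph α) (v : Γ.V) (p : List (Γ.E × Bool)) : Prop :=
  p ≠ [] ∧ Γ.IsPath v p v ∧ FreeGroup.IsReduced p

/-- The labels of the reduced cycles of `Γ`. -/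
def cycleLabels (Γ : LabelledGraph α) : Set (FreeGroup α) :=
  {w | ∃ v p, Γ.IsReducedCycle v p ∧ w = Γ.pathLabel p}

/-- Any two vertices are joined by a path. -/
def Connected (Γ : LabelledGraph α) : Prop := ∀ u v, ∃ p, Γ.IsPath u p v

/-- The disjoint union of two labelled graphs. -/
def disjUnion (Γ Δ : LabelledGraph α) : LabelledGraph α where
  V := Γ.V ⊕ Δ.V
  E := Γ.E ⊕ Δ.E
  src := Sum.map Γ.src Δ.src
  tgt := Sum.map Γ.tgt Δ.tgt
  lab := Sum.elim Γ.lab Δ.lab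

/-- For a graph whose edges are labelled by words: the `k`-th vertex on the edge `e` once `e` is
subdivided into as many edges as its word has letters. -/
def subPos (Γ : LabelledGraph (List (α × Bool))) (e : Γ.E) (k : ℕ) :
    Γ.V ⊕ (Σ e : Γ.E, Fin ((Γ.lab e).length - 1)) :=
  if k = 0 then Sum.inl (Γ.src e)
  else if h : k - 1 < (Γ.lab e).length - 1 then Sum.inr ⟨e, ⟨k - 1, h⟩⟩
  else Sum.inl (Γ.tgt e)

/-- The subdivision of a graph whose edges are labelled by non-empty words over `α`: the edge `e`
becomes a path from `Γ.src e` to `Γ.tgt e` along which one reads the word of `e`. A letter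
`(x, true)` gives an edge labelled `x` directed along this path, a letter `(x, false)` one directed
against it. -/
def subdivide (Γ : LabelledGraph (List (α × Bool))) : LabelledGraph α where
  V := Γ.V ⊕ (Σ e : Γ.E, Fin ((Γ.lab e).length - 1))
  E := Σ e : Γ.E, Fin (Γ.lab e).length
  src f := Γ.subPos f.1 (if ((Γ.lab f.1).get f.2).2 then f.2 else f.2 + 1)
  tgt f := Γ.subPos f.1 (if ((Γ.lab f.1).get f.2).2 then f.2 + 1 else f.2)
  lab f := ((Γ.lab f.1).get f.2).1

/-- The disjoint union of cycles, one for every index `i`, the `i`-th labelled by the word `w i`. -/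
def cycles {ι : Type} (w : ι → List (α × Bool)) : LabelledGraph α :=
  subdivide { V := ι, E := ι, src := id, tgt := id, lab := w }

/-- Two vertices are identified by the Stallings foldings of `Γ`: the least equivalence relation
such that two equally labelled edges whose starting vertices (terminal vertices) are identified
have their terminal vertices (starting vertices) identified as well. -/
inductive FoldRel (Γ : LabelledGraph α) : Γ.V → Γ.V → Prop
  | refl (v : Γ.V) : FoldRel Γ v v
  | symm {u v : Γ.V} : FoldRel Γ u v → FoldRel Γ v u
  | trans {u v w : Γ.V} : FoldRel Γ u v → FoldRel Γ v w → FoldRel Γ u w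
  | out {e f : Γ.E} : Γ.lab e = Γ.lab f → FoldRel Γ (Γ.src e) (Γ.src f) →
      FoldRel Γ (Γ.tgt e) (Γ.tgt f)
  | into {e f : Γ.E} : Γ.lab e = Γ.lab f → FoldRel Γ (Γ.tgt e) (Γ.tgt f) →
      FoldRel Γ (Γ.src e) (Γ.src f)

/-- `FoldRel` as a setoid on vertices. -/
def foldV (Γ : LabelledGraph α) : Setoid Γ.V where
  r := Γ.FoldRel
  iseqv := ⟨.refl, .symm, .trans⟩

/-- Two edges are identified by the foldings of `Γ` if they have the same label and their
endpoints are identified. -/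
def foldE (Γ : LabelledGraph α) : Setoid Γ.E where
  r e f := Γ.lab e = Γ.lab f ∧ Γ.FoldRel (Γ.src e) (Γ.src f) ∧ Γ.FoldRel (Γ.tgt e) (Γ.tgt f)
  iseqv := ⟨fun _ => ⟨rfl, .refl _, .refl _⟩, fun h => ⟨h.1.symm, h.2.1.symm, h.2.2.symm⟩,
    fun h k => ⟨h.1.trans k.1, h.2.1.trans k.2.1, h.2.2.trans k.2.2⟩⟩

/-- The reduced labelled graph obtained from `Γ` by making all possible Stallings foldings. -/
def fold (Γ : LabelledGraph α) : LabelledGraph α where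
  V := Quotient Γ.foldV
  E := Quotient Γ.foldE
  src := Quotient.map' Γ.src fun _ _ h => h.2.1
  tgt := Quotient.map' Γ.tgt fun _ _ h => h.2.2
  lab := Quotient.lift Γ.lab fun _ _ h => h.1

end LabelledGraph

namespace RipsSegev

/-- The generators `x₁, …, x_m, a, b`. -/
inductive Gen (m : ℕ) : Type
  | x (j : Fin m) : Gen m
  | a : Gen m
  | b : Gen m

/-- Words in the generators and their inverses; `(y, true)` is `y`, `(y, false)` is `y⁻¹`. -/
abbrev Word (m : ℕ) : Type := List (Gen m × Bool)

/-- The word `a^k`. -/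
def apow {m : ℕ} (k : ℕ) : Word m := List.replicate k (Gen.a, true)

/-- The word `a^(-k)`. -/
def ainv {m : ℕ} (k : ℕ) : Word m := List.replicate k (Gen.a, false)

/-- The word `b^k`. -/
def bpow {m : ℕ} (k : ℕ) : Word m := List.replicate k (Gen.b, true)

/-- The word `a^(10i-9) b a^(10i-8) b ⋯ b a^(10i) b`, for `i ≥ 1`. -/
def ripsTail {m : ℕ} (i : ℕ) : Word m :=
  (List.range 10).flatMap fun s => apow (10 * i - 9 + s) ++ bpow 1

/-- The Rips relators of the presentation `⟨x₁, …, x_m ∣ r₁, …, r_n⟩`. An element `i : Fin k`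
stands for the index `i + 1` in `{1, …, k}`. -/
def ripsRelator {m n : ℕ} (r : Fin n → FreeGroup (Fin m)) : Fin n ⊕ (Fin 4 × Fin m) → Word m
  | .inl i => (r i).toWord.map (fun l => (Gen.x l.1, l.2)) ++ ripsTail (i + 1)
  | .inr (0, j) => [(Gen.x j, false), (Gen.a, true), (Gen.x j, true)] ++ ripsTail (n + (j + 1))
  | .inr (1, j) => [(Gen.x j, true), (Gen.a, true), (Gen.x j, false)] ++ ripsTail (m + n + (j + 1))
  | .inr (2, j) =>
      [(Gen.x j, false), (Gen.b, true), (Gen.x j, true)] ++ ripsTail (2 * m + n + (j + 1))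
  | .inr (3, j) =>
      [(Gen.x j, true), (Gen.b, true), (Gen.x j, false)] ++ ripsTail (3 * m + n + (j + 1))

/-- The covering graph `Θ`, with vertices `1, …, K` (the vertex `i + 1` is `i : Fin K`), of the
oriented bouquet of 4 cycles labelled `y₁, …, y₄`, given by its monodromy: the edge `(i, s)` is
labelled by `s` and goes from the vertex `i` to the vertex `σ s i`. So every vertex has exactly one
outgoing and one incoming edge with each label. -/
abbrev cover {K : ℕ} (σ : Fin 4 → Equiv.Perm (Fin K)) : LabelledGraph (Fin 4) where
  V := Fin K
  E := Fin K × Fin 4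
  src e := e.1
  tgt e := σ e.2 e.1
  lab e := e.2

/-- The covering `Θ` is regular: its deck transformations (the permutations of the vertices that
respect the labelled edges) act transitively. -/
def IsRegularCover {K : ℕ} (σ : Fin 4 → Equiv.Perm (Fin K)) : Prop :=
  ∀ u v, ∃ τ : Equiv.Perm (Fin K), (∀ s i, τ (σ s i) = σ s (τ i)) ∧ τ u = v

/-- The new label `L` of the edge of `Θ` with label `y_s` from the vertex `i` to the vertex `k`,
where `i, k ∈ {1, …, K}`. -/
def edgeWord {m : ℕ} (J : ℕ) (s : Fin 4) (i k : ℕ) : Word m :=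
  match s with
  | 0 => bpow 1 ++ ainv (10 ^ (J + 10 * k - 4))
  | 1 => apow (10 ^ (J + 10 * i)) ++ bpow 1 ++ ainv (10 ^ (J + 10 * k - 3))
  | 2 => apow (10 ^ (J + 10 * i - 2)) ++ bpow 1 ++ ainv (10 ^ (J + 10 * k))
  | 3 => apow (10 ^ (J + 10 * i - 1)) ++ bpow 1

/-- The word `c_i = b^i a^(10^(J+10i-9)) b a^(10^(J+10i-8)) b ⋯ b a^(10^(J+10i-5))`, for
`i ∈ {1, …, K}`. -/
def cWord {m : ℕ} (J i : ℕ) : Word m :=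
  bpow i ++ apow (10 ^ (J + 10 * i - 9)) ++ bpow 1 ++ apow (10 ^ (J + 10 * i - 8)) ++ bpow 1 ++
    apow (10 ^ (J + 10 * i - 7)) ++ bpow 1 ++ apow (10 ^ (J + 10 * i - 6)) ++ bpow 1 ++
    apow (10 ^ (J + 10 * i - 5))

/-- The graph `Θ` with the labels `L`, together with a new vertex `0` (here `none`) joined to
every vertex `i` by an edge labelled by the word `c_i`. -/
abbrev ripsSegevPattern (m : ℕ) {K : ℕ} (J : ℕ) (σ : Fin 4 → Equiv.Perm (Fin K)) :
    LabelledGraph (Word m) where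
  V := Option (Fin K)
  E := (Fin K × Fin 4) ⊕ Fin K
  src := Sum.elim (fun e => some e.1) (fun _ => none)
  tgt := Sum.elim (fun e => some (σ e.2 e.1)) (fun i => some i)
  lab := Sum.elim (fun e => edgeWord J e.2 (e.1 + 1) (σ e.2 e.1 + 1)) (fun i => cWord J (i + 1))

/-- The generalized Rips–Segev graph: subdivide the edges so that every edge bears one letter, and
make all foldings. (Folding `Θ` before attaching the paths `c_i`, and then folding again, gives the
same graph.) -/
def ripsSegevGraph (m : ℕ) {K : ℕ} (J : ℕ) (σ : Fin 4 → Equiv.Perm (Fin K)) :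
    LabelledGraph (Gen m) :=
  (ripsSegevPattern m J σ).subdivide.fold

/-- The disjoint union of the Rips–Segev graph and of the `n + 4m` cycles labelled by the Rips
relators. -/
def relatorGraph {m n K : ℕ} (r : Fin n → FreeGroup (Fin m)) (J : ℕ)
    (σ : Fin 4 → Equiv.Perm (Fin K)) : LabelledGraph (Gen m) :=
  (ripsSegevGraph m J σ).disjUnion (LabelledGraph.cycles (ripsRelator r))

/-- The group `G = ⟨x₁, …, x_m, a, b ∣ labels of the reduced cycles of the relator graph⟩`. -/
abbrev RipsSegevGroup {m n K : ℕ} (r : Fin n → FreeGroup (Fin m)) (J : ℕ)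
    (σ : Fin 4 → Equiv.Perm (Fin K)) : Type :=
  PresentedGroup (relatorGraph r J σ).cycleLabels

/-- The canonical map to `G` from the free group on `x₁, …, x_m, a, b`. -/
def toG {m n K : ℕ} (r : Fin n → FreeGroup (Fin m)) (J : ℕ) (σ : Fin 4 → Equiv.Perm (Fin K)) :
    FreeGroup (Gen m) →* RipsSegevGroup r J σ :=
  PresentedGroup.mk _

/-- The set `A = ⊔ᵢ {c_i, c_i a, …, c_i a^(10^(J+10i) - 1)}`, `1 ≤ i ≤ K`, of elements of
`⟨a⟩ * ⟨b⟩`, viewed as the subgroup generated by `a` and `b` of the free group on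
`x₁, …, x_m, a, b`. -/
def setA (m K J : ℕ) : Set (FreeGroup (Gen m)) :=
  {g | ∃ (i : Fin K) (t : ℕ), t < 10 ^ (J + 10 * ((i : ℕ) + 1)) ∧
    g = FreeGroup.mk (cWord J (i + 1)) * FreeGroup.of Gen.a ^ t}

/-- The set `B = {1, a, b, ab}`. -/
def setB (m : ℕ) : Set (FreeGroup (Gen m)) :=
  {1, FreeGroup.of Gen.a, FreeGroup.of Gen.b, FreeGroup.of Gen.a * FreeGroup.of Gen.b}

end RipsSegev

open RipsSegev

set_option linter.unusedSectionVars false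

/-!
The theorem has two halves.

*Products.* The edge of `Θ` labelled `y_s` from `i` to `σ s i`, together with the paths `c_i` and
`c_(σ s i)`, is a closed path of the relator graph, and removing backtracks from a closed path does
not change its label (`LabelledGraph.mk_mem_normalClosure`). So `c_i L = c_(σ s i)` in `G`, where
`L` is the word on the edge. The words `L` are chosen so that these equalities give every product
`c_i a^t h`, `h ∈ B`, a second factorization whenever one cannot just move a letter `a` from one
factor to the other (`RipsSegev.exists_factorization`).

*Injectivity.* This is small cancellation theory over a graph. Call a path rigid if its label can
be read in the graph from its own starting vertex only. If every reduced closed path of a folded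
graph contains seven disjoint rigid subpaths, then a path of the graph whose label is trivial modulo
the labels of all closed paths is itself closed (`VanKampen.eq_of_mem_normalClosure`). Indeed, a van
Kampen diagram for this label, whose outside is filled with the path in question, is a map on the
sphere whose faces all lift to the graph, except that one face jumps once from the end of the path
to its beginning. Edges whose two sides lift to the same edge are deleted, and spurs are folded
until there are none; the jump persists. In the resulting map every rigid subpath of the boundary
of a face meets a vertex of degree at least three, or the exceptional one, so every face but one has
at least six corners at vertices of degree at least three, which Euler's inequality forbids
(`VanKampen.BrokenMap.false_of_irreducible`). Planarity enters in a cohomological form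
(`VanKampen.SimplyConn`), which is easily seen to be preserved when edges are added, deleted or
folded and when faces are cut.

To apply this to the relator graph, the latter is mapped to an explicit folded graph
(`RipsSegev.model`), in which the powers of `a` are read along infinite lines. The differences
between the exponents `10^(J + 10 i - e)` and those of the Rips relators determine the places where
they occur (`RipsSegev.sidon`), so a subpath `b^(±1) a^k b^(±1)` with `k ≠ 0` is rigid. A reduced
closed path that uses a Rips relator contains nine of these, one through the paths `c_i` contains
seven, and any other one follows a reduced cycle of `Θ`, of length at least 19, where at least every
second passage from an edge to the next one is of this kind (`RipsSegev.smallCancellation`). The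
elements of `A` and `B` are then told apart by the endpoints of the paths that they label.
-/

namespace VanKampen

open Equiv

/-! ### Planar maps -/

/-- The map on an oriented surface with darts `D`, in which `α` reverses a dart and `φ` sends a dart
to the next one on its face, is simply connected: a function on darts that is antisymmetric under
`α` and sums to zero around every face is the coboundary of a function `g` on vertices. The
function on darts is given by `h (φ d) - h d`, which encodes the sums over faces, and `g d` is the
value at the starting vertex of `d`, whence `g (α d) = g (φ d)`. -/
def SimplyConn {D : Type} (α φ : Perm D) : Prop :=
  ∀ h : D → ℚ, (∀ d, h (φ (α d)) - h (α d) = -(h (φ d) - h d)) →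
    ∃ g : D → ℚ, (∀ d, g (φ d) - g d = h (φ d) - h d) ∧ ∀ d, g (α d) = g (φ d)

section Reglue

variable {D : Type} [DecidableEq D] (α : Perm D) (d e : D)

/-- The edges `{d, α d}` and `{e, α e}` are cut open, and `d` is glued to `e` and `α d` to `α e`.
For `e = φ d` this folds two consecutive edges of a face. -/
def reglue : Perm D := swap (α d) e * α * swap (α d) e

variable {α d e} (hinv : ∀ x, α (α x) = x) (hne : ∀ x, α x ≠ x) (h1 : e ≠ α d) (h2 : e ≠ d)
include hinv hne h1 h2

theorem reglue_self : reglue α d e d = e := by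
  simp [reglue, swap_apply_of_ne_of_ne (hne d).symm h2.symm]

theorem reglue_right : reglue α d e e = d := by
  simp [reglue, hinv, swap_apply_of_ne_of_ne (hne d).symm h2.symm]

theorem reglue_inv_left : reglue α d e (α d) = α e := by
  have : α e ≠ α d := fun h => h2 (α.injective h)
  simp [reglue, swap_apply_of_ne_of_ne this (hne e)]

theorem reglue_inv_right : reglue α d e (α e) = α d := by
  have : α e ≠ α d := fun h => h2 (α.injective h)
  simp [reglue, hinv, swap_apply_of_ne_of_ne this (hne e)]

theorem reglue_other {x : D} (a1 : x ≠ d) (a2 : x ≠ e) (a3 : x ≠ α d) (a4 : x ≠ α e) :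
    reglue α d e x = α x := by
  have b1 : α x ≠ α d := fun h => a1 (α.injective h)
  have b2 : α x ≠ e := fun h => a4 (by rw [← h, hinv])
  simp [reglue, swap_apply_of_ne_of_ne a3 a2, swap_apply_of_ne_of_ne b1 b2]

omit h1 h2 in
theorem reglue_reglue (x : D) : reglue α d e (reglue α d e x) = x := by
  simp [reglue, hinv]

omit h1 h2 hinv in
theorem reglue_ne (x : D) : reglue α d e x ≠ x := by
  intro h
  apply hne (swap (α d) e x)
  have := congrArg (swap (α d) e) h
  simpa [reglue] using this

end Reglue

/-- Folding two consecutive edges of a face keeps the map simply connected. -/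
theorem SimplyConn.reglue {D : Type} [DecidableEq D] {α φ : Perm D} (hs : SimplyConn α φ)
    (hinv : ∀ x, α (α x) = x) (hne : ∀ x, α x ≠ x) {d : D} (h1 : φ d ≠ α d) (h2 : φ d ≠ d) :
    SimplyConn (VanKampen.reglue α d (φ d)) φ := by
  intro h H
  set e := φ d with he
  have r1 := reglue_self hinv hne h1 h2
  have r2 := reglue_right hinv hne h1 h2
  have r3 := reglue_inv_left hinv hne h1 h2
  have r4 := reglue_inv_right hinv hne h1 h2
  have H1 := H d
  have H3 := H (α d)
  rw [r1] at H1
  rw [r3] at H3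
  have fe : φ e ≠ e := fun h => h2 (φ.injective h)
  have fx : ∀ x, x ≠ d → φ x ≠ e := fun x hx h => hx (φ.injective h)
  have de : d ≠ e := h2.symm
  have ade : α d ≠ e := h1.symm
  have aed : α e ≠ d := fun h => h1 (by rw [← h, hinv])
  -- the edges at `d` and at `e` are separated in `α`, so the value at their common vertex changes
  set h' : D → ℚ := Function.update h e (h d - (h (φ (α d)) - h (α d))) with hh'
  have v : ∀ x, x ≠ e → h' x = h x := fun x hx => by simp [hh', hx]
  have ve : h' e = h d - (h (φ (α d)) - h (α d)) := by simp [hh']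
  have F : ∀ x, x ≠ d → x ≠ e → h' (φ x) - h' x = h (φ x) - h x := fun x hx hx' => by
    rw [v _ (fx x hx), v x hx']
  have Fd : h' (φ d) - h' d = -(h (φ (α d)) - h (α d)) := by
    rw [v d de, ← he, ve]; ring
  have Fe : h' (φ e) - h' e = h (φ (α d)) - h (α d) := by
    rw [v _ fe, ve]; linarith
  have Fad := F (α d) (hne d) ade
  have Fae := F (α e) aed (hne e)
  obtain ⟨g, hg1, hg2⟩ := hs h' (by
    intro x
    by_cases x1 : x = d
    · subst x1; rw [Fad, Fd]; ring
    by_cases x2 : x = e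
    · rw [x2, Fae, Fe]; linarith
    by_cases x3 : x = α d
    · rw [x3, hinv, Fad, Fd]
    by_cases x4 : x = α e
    · rw [x4, hinv, Fae, Fe]; linarith
    have := H x
    rw [reglue_other hinv hne h1 h2 x1 x2 x3 x4] at this
    rw [F x x1 x2, F (α x) (fun h => x3 (by rw [← h, hinv])) (fun h => x4 (by rw [← h, hinv])),
      this])
  have gd := hg1 d
  have ge := hg1 e
  have gd2 := hg2 d
  have gad := hg2 (α d)
  have ge2 := hg2 e
  have gae := hg2 (α e)
  rw [hinv] at gad gae
  refine ⟨Function.update g e (g d + (h (φ d) - h d)), fun x => ?_, fun x => ?_⟩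
  · by_cases x1 : x = d
    · subst x1; simp [de, ← he]
    by_cases x2 : x = e
    · rw [x2, Function.update_of_ne fe, Function.update_self]
      rw [Fe] at ge; rw [Fd] at gd; rw [← he] at *; linarith
    rw [Function.update_of_ne (fx x x1), Function.update_of_ne x2, hg1, F x x1 x2]
  · by_cases x1 : x = d
    · subst x1; rw [r1]
    by_cases x2 : x = e
    · rw [x2, r2, Function.update_of_ne fe, Function.update_of_ne de]
      rw [Fe] at ge; rw [Fd] at gd; rw [← he] at *; linarith
    by_cases x3 : x = α d
    · rw [x3, r3, Function.update_of_ne (fx _ (hne d)), Function.update_of_ne (hne e)]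
      rw [Fe] at ge; rw [Fd] at gd; rw [← he] at *; linarith
    by_cases x4 : x = α e
    · rw [x4, r4, Function.update_of_ne (fx _ aed), Function.update_of_ne ade]
      rw [← he] at *; linarith
    rw [reglue_other hinv hne h1 h2 x1 x2 x3 x4, Function.update_of_ne (fx x x1),
      Function.update_of_ne (fun h => x4 (by rw [← h, hinv])), hg2]

/-! ### Removing a dart from a vertex -/

section Remove

variable {D : Type} [DecidableEq D] (σ : Perm D) (x : D)

/-- The permutation `σ` with `x` taken out of its cycle and made a fixed point. -/
def remove : Perm D := swap x (σ x) * σ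

theorem remove_self : remove σ x x = x := by simp [remove]

variable {σ x}

theorem remove_of_eq {y : D} (h : σ y = x) : remove σ x y = σ x := by simp [remove, h]

theorem remove_of_ne {y : D} (h : y ≠ x) (h' : σ y ≠ x) : remove σ x y = σ y := by
  simp [remove, swap_apply_of_ne_of_ne h' (fun e => h (σ.injective e))]

/-- A function on the points other than `x` extends to `x` without changing its increments along
`remove σ x`, and in such a way that its increment along `σ` at `x` is zero. -/
theorem extend_remove (h : D → ℚ) :
    ∃ k : D → ℚ, (∀ y, y ≠ x → k y = h y) ∧ (∀ y, y ≠ x → k (σ y) = h (remove σ x y)) ∧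
      k (σ x) = k x := by
  refine ⟨Function.update h x (h (σ x)), fun y hy => by simp [hy], fun y hy => ?_, ?_⟩
  · by_cases h1 : σ y = x
    · simp [remove_of_eq h1, h1]
    · simp [remove_of_ne hy h1, h1]
  · by_cases h1 : σ x = x
    · rw [h1]
    · simp [h1]

/-- Taking `x` out of its cycle preserves the data of a function that continues along `σ` except at
one point `b`, where it jumps from `u` to `v`. The jump moves to another point if `x = b`. -/
theorem lift_remove {V : Type} {p p' : D → V} {b : D} {u v : V} (huv : u ≠ v)
    (hc : ∀ y, y ≠ b → p' y = p (σ y)) (hu : p' b = u) (hv : p (σ b) = v) (hx : p' x = p x) :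
    ∃ b', b' ≠ x ∧ (∀ y, y ≠ b' → p' y = p (remove σ x y)) ∧ p' b' = u ∧
      p (remove σ x b') = v := by
  have key : ∀ y, y ≠ b → y ≠ x → σ y ≠ x → p' y = p (remove σ x y) := fun y h1 h2 h3 => by
    rw [remove_of_ne h2 h3, hc y h1]
  by_cases hb : b = x
  · subst hb
    have hne : σ.symm b ≠ b := by
      intro h
      have h : σ b = b := by conv_lhs => rw [← h, Equiv.apply_symm_apply]
      rw [h] at hv; exact huv (by rw [← hu, hx, hv])
    refine ⟨σ.symm b, hne, fun y hy => ?_, ?_, ?_⟩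
    · by_cases hyx : y = b
      · rw [hyx, remove_self, hx]
      · exact key y hyx hyx (fun h => hy (by simp [← h]))
    · rw [hc _ hne, Equiv.apply_symm_apply, ← hx, hu]
    · rw [remove_of_eq (by simp), hv]
  · refine ⟨b, hb, fun y hy => ?_, hu, ?_⟩
    · by_cases hyx : y = x
      · rw [hyx, remove_self, hx]
      · by_cases hs : σ y = x
        · rw [remove_of_eq hs, ← hc x (Ne.symm hb), hx, ← hs, hc y hy]
        · exact key y hy hyx hs
    · by_cases hs : σ b = x
      · rw [remove_of_eq hs, ← hc x (Ne.symm hb), hx, ← hs, hv]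
      · rw [remove_of_ne hb hs, hv]

end Remove

/-- The inverse letter. -/
def flipLetter {X : Type} (l : X × Bool) : X × Bool := (l.1, !l.2)

@[simp] theorem flipLetter_flipLetter {X : Type} (l : X × Bool) :
    flipLetter (flipLetter l) = l := by
  simp [flipLetter]

theorem flipLetter_ne {X : Type} (l : X × Bool) : flipLetter l ≠ l := by
  rcases l with ⟨x, _ | _⟩ <;> simp [flipLetter]

/-- A simply connected labelled map whose faces lift to the graph with edges `Step`, except that
at one place of one face the lift jumps from `u` to `v`. Every dart is lifted separately, as a side
of its face; the two sides of an edge may be lifted to different edges. -/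
structure BrokenMap {X V : Type} (Step : V → X × Bool → V → Prop) (u v : V) (D : Type) where
  /-- reversing a dart -/
  α : Perm D
  /-- the next dart on a face -/
  φ : Perm D
  inv : ∀ d, α (α d) = d
  ne : ∀ d, α d ≠ d
  simplyConn : SimplyConn α φ
  /-- the letter on a dart -/
  lab : D → X × Bool
  /-- the starting vertex of the lift of a dart -/
  p : D → V
  /-- the terminal vertex of the lift of a dart -/
  q : D → V
  lab_inv : ∀ d, lab (α d) = flipLetter (lab d)
  step : ∀ d, Step (p d) (lab d) (q d)
  /-- the dart after which the lift jumps -/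
  b : D
  cont : ∀ d, d ≠ b → q d = p (φ d)
  hu : q b = u
  hv : p (φ b) = v

namespace BrokenMap

variable {X V : Type} {Step : V → X × Bool → V → Prop} {u v : V} {D : Type}

/-- Both sides of the edge `d` lift to the same edge. -/
def Bad (M : BrokenMap Step u v D) (d : D) : Prop := M.p (M.α d) = M.q d

/-- A backtrack in the label of a face, away from the jump. -/
def Spur (M : BrokenMap Step u v D) (d : D) : Prop :=
  d ≠ M.b ∧ M.lab (M.φ d) = flipLetter (M.lab d)

variable (hsymm : ∀ u l v, Step u l v → Step v (flipLetter l) u)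
  (hdet : ∀ u l v v', Step u l v → Step u l v' → v = v')
include hsymm hdet

theorem Bad.symm {M : BrokenMap Step u v D} {d : D} (h : M.Bad d) : M.Bad (M.α d) := by
  have h1 := M.step (M.α d)
  rw [h, M.lab_inv] at h1
  have := hdet _ _ _ _ h1 (hsymm _ _ _ (M.step d))
  rw [Bad, M.inv, this]

/-- An edge whose two sides have the same lift can be deleted. If two faces meet there, they are
merged; otherwise the edge is a bridge, and its removal cuts the face in two. The jump persists. -/
theorem delete (huv : u ≠ v) (M : BrokenMap Step u v D) {d : D} (h : M.Bad d) :
    Nonempty (BrokenMap Step u v {x : D // x ≠ d ∧ x ≠ M.α d}) := by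
  classical
  have h' := h.symm hsymm hdet
  -- `φ * α` rotates the darts around their starting vertices; the two darts of the edge are taken
  -- out of this rotation
  set σ : Perm D := M.φ * M.α with hσ
  set σ₁ := remove σ d with hσ₁
  set σ₂ := remove σ₁ (M.α d) with hσ₂
  have hd : M.α d ≠ d := M.ne d
  have e1 : σ₁ d = d := remove_self _ _
  have e2 : σ₂ (M.α d) = M.α d := remove_self _ _
  have e3 : σ₂ d = d := by
    rw [hσ₂, remove_of_ne hd.symm (by rw [e1]; exact hd.symm), e1]
  obtain ⟨b₁, -, c1, u1, v1⟩ := lift_remove (p := M.p) (p' := fun y => M.q (M.α y)) (σ := σ)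
    (x := d) (b := M.α M.b) huv
    (fun y hy => M.cont _ (fun e => hy (by rw [← e, M.inv])))
    (by simp [M.inv, M.hu]) (by simp [hσ, M.inv, M.hv])
    (by have := h'; simp only [Bad, M.inv] at this; exact this.symm)
  obtain ⟨b₂, hb2, c2, u2, v2⟩ := lift_remove (x := M.α d) huv c1 u1 v1
    (by simp only [M.inv]; exact Eq.symm h)
  have hb3 : b₂ ≠ d := by
    intro hb
    subst hb
    rw [← hσ₁, ← hσ₂, e3] at v2
    have := h'
    simp only [Bad, M.inv] at this
    exact huv (u2.symm.trans (this.symm.trans v2))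
  have hP : ∀ x, (σ₂ x ≠ d ∧ σ₂ x ≠ M.α d) ↔ (x ≠ d ∧ x ≠ M.α d) := fun x => by
    have i1 : σ₂ x ≠ d ↔ x ≠ d := by conv_lhs => rw [← e3, σ₂.injective.ne_iff]
    have i2 : σ₂ x ≠ M.α d ↔ x ≠ M.α d := by conv_lhs => rw [← e2, σ₂.injective.ne_iff]
    rw [i1, i2]
  have hA : ∀ x, (M.α x ≠ d ∧ M.α x ≠ M.α d) ↔ (x ≠ d ∧ x ≠ M.α d) := fun x => by
    rw [M.α.injective.ne_iff, and_comm]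
    have : M.α x ≠ d ↔ x ≠ M.α d := by
      rw [← M.α.injective.ne_iff, M.inv]
    rw [this]
  set s : Perm {x : D // x ≠ d ∧ x ≠ M.α d} := σ₂.subtypePerm hP with hs
  set a : Perm {x : D // x ≠ d ∧ x ≠ M.α d} := M.α.subtypePerm hA with ha
  have aa : ∀ x, a (a x) = x := fun x => Subtype.ext (M.inv _)
  have sv : ∀ x, (s x).1 = σ₂ x.1 := fun _ => rfl
  have av : ∀ x, (a x).1 = M.α x.1 := fun _ => rfl
  refine ⟨{ α := a, φ := s * a, inv := aa, ne := fun x e => M.ne x.1 (congrArg Subtype.val e)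
            simplyConn := ?_, lab := fun x => M.lab x.1, p := fun x => M.p x.1
            q := fun x => M.q x.1, lab_inv := fun x => M.lab_inv _, step := fun x => M.step _
            b := a ⟨b₂, hb3, hb2⟩, cont := ?_, hu := ?_, hv := ?_ }⟩
  · intro h0 H
    simp only [Perm.mul_apply, aa] at H
    obtain ⟨h1, k1, k2, k3⟩ := extend_remove (σ := σ₁) (x := M.α d)
      (fun y => if hy : y ≠ d ∧ y ≠ M.α d then h0 ⟨y, hy⟩ else 0)
    obtain ⟨h2, l1, l2, l3⟩ := extend_remove (σ := σ) (x := d) h1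
    have w : ∀ y : {x : D // x ≠ d ∧ x ≠ M.α d}, h2 y.1 = h0 y := fun y => by
      rw [l1 _ y.2.1, k1 _ y.2.2, dif_pos y.2]
    have w1 : ∀ y : {x : D // x ≠ d ∧ x ≠ M.α d}, h2 (σ y.1) = h0 (s y) := fun y => by
      rw [l2 _ y.2.1, k2 _ y.2.2, dif_pos ((hP _).2 y.2)]; rfl
    have w2 : h2 (σ (M.α d)) = h2 (M.α d) := by
      rw [l2 _ hd, ← hσ₁, k3, l1 _ hd]
    have eφ : ∀ x, M.φ x = σ (M.α x) := fun x => by simp [hσ, M.inv]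
    have f1 : ∀ y : {x : D // x ≠ d ∧ x ≠ M.α d}, h2 (M.φ y.1) - h2 y.1 = h0 (s (a y)) - h0 y :=
      fun y => by rw [eφ, ← av, w1, w]
    obtain ⟨g, g1, g2⟩ := M.simplyConn h2 (by
      intro x
      by_cases x1 : x = d
      · rw [x1, eφ, eφ, M.inv, l3, w2]; ring
      by_cases x2 : x = M.α d
      · rw [x2, eφ, eφ, M.inv, M.inv, l3, w2]; ring
      have q1 := f1 ⟨x, x1, x2⟩
      have q2 := f1 (a ⟨x, x1, x2⟩)
      have q3 := H ⟨x, x1, x2⟩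
      simp only [aa, av] at q1 q2
      rw [q1, q2, q3])
    have gσ : ∀ x, g (σ x) = g x := fun x => by
      have := g2 (M.α x)
      rw [M.inv] at this; rw [this]; rfl
    have gs1 : ∀ x, g (σ₁ x) = g x := fun x => by
      by_cases h1 : x = d
      · rw [h1, e1]
      by_cases h2 : σ x = d
      · rw [hσ₁, remove_of_eq h2, gσ, ← h2, gσ]
      · rw [hσ₁, remove_of_ne h1 h2, gσ]
    have gs2 : ∀ x, g (σ₂ x) = g x := fun x => by
      by_cases h1 : x = M.α d
      · rw [h1, e2]
      by_cases h2 : σ₁ x = M.α d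
      · rw [hσ₂, remove_of_eq h2, gs1, ← h2, gs1]
      · rw [hσ₂, remove_of_ne h1 h2, gs1]
    refine ⟨fun x => g x.1, fun x => ?_, fun x => ?_⟩
    · simp only [Perm.mul_apply, sv, gs2]
      rw [← f1 x, ← g1, av, g2]
    · simp only [Perm.mul_apply, sv, gs2]
  · intro x hx
    have := c2 (a x).1 (fun e => hx (by rw [← aa x]; congr 1; exact Subtype.ext e))
    simp only [av, M.inv] at this
    exact this
  · simpa [av] using u2
  · simp only [Perm.mul_apply, aa]
    exact v2

omit hsymm hdet in
/-- Folding a spur gives an edge whose two sides have the same lift. -/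
theorem fold_spur (M : BrokenMap Step u v D) {d : D} (h : M.Spur d)
    (hb : ¬ M.Bad d) : ∃ M' : BrokenMap Step u v D, M'.Bad d := by
  classical
  obtain ⟨h1, h2⟩ := h
  have hq := M.cont d h1
  have n1 : M.φ d ≠ M.α d := fun e => hb (by rw [Bad, ← e, hq])
  have n2 : M.φ d ≠ d := fun e => flipLetter_ne (M.lab d) (by rw [← h2, e])
  have r1 := reglue_self M.inv M.ne n1 n2
  refine ⟨{ M with
    α := reglue M.α d (M.φ d)
    inv := reglue_reglue M.inv M.ne
    ne := reglue_ne M.ne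
    simplyConn := M.simplyConn.reglue M.inv M.ne n1 n2
    lab_inv := ?_ }, ?_⟩
  · intro x
    by_cases x1 : x = d
    · rw [x1, r1, h2]
    by_cases x2 : x = M.φ d
    · rw [x2, reglue_right M.inv M.ne n1 n2, h2, flipLetter_flipLetter]
    by_cases x3 : x = M.α d
    · rw [x3, reglue_inv_left M.inv M.ne n1 n2, M.lab_inv, M.lab_inv, h2]
    by_cases x4 : x = M.α (M.φ d)
    · rw [x4, reglue_inv_right M.inv M.ne n1 n2, M.lab_inv, M.lab_inv, h2, flipLetter_flipLetter]
    rw [reglue_other M.inv M.ne n1 n2 x1 x2 x3 x4, M.lab_inv]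
  · simp only [Bad, r1, hq]

/-- Folding and deleting leads to a map without spurs in which the two sides of every edge have
different lifts. -/
theorem exists_irreducible (huv : u ≠ v) (n : ℕ) : ∀ (D : Type) [Finite D], Nat.card D = n →
    BrokenMap Step u v D → ∃ (D' : Type) (_ : Finite D') (M : BrokenMap Step u v D'),
      (∀ d, ¬ M.Bad d) ∧ ∀ d, ¬ M.Spur d := by
  induction n using Nat.strong_induction_on with
  | _ n ih =>
    intro D _ hD M
    have main : ∀ (M : BrokenMap Step u v D) (d : D), M.Bad d →
        ∃ (D' : Type) (_ : Finite D') (M : BrokenMap Step u v D'),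
          (∀ d, ¬ M.Bad d) ∧ ∀ d, ¬ M.Spur d := by
      intro M d hd
      obtain ⟨M'⟩ := M.delete hsymm hdet huv hd
      refine ih (Nat.card {x : D // x ≠ d ∧ x ≠ M.α d}) ?_ _ rfl M'
      rw [← hD]
      exact Finite.card_subtype_lt (x := d) (by simp)
    by_cases h1 : ∃ d, M.Bad d
    · obtain ⟨d, hd⟩ := h1; exact main M d hd
    by_cases h2 : ∃ d, M.Spur d
    · obtain ⟨d, hd⟩ := h2
      obtain ⟨M', hM'⟩ := M.fold_spur hd (fun h => h1 ⟨d, h⟩)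
      exact main M' d hM'
    · exact ⟨D, inferInstance, M, fun d h => h1 ⟨d, h⟩, fun d h => h2 ⟨d, h⟩⟩

end BrokenMap

/-! ### Euler's inequality -/

section Euler

variable {D : Type} [Fintype D]

/-- The functions constant on the cycles of `π`. -/
def invariants (π : Perm D) : Submodule ℚ (D → ℚ) where
  carrier := {w | ∀ d, w (π d) = w d}
  add_mem' := fun ha hb d => by simp [ha d, hb d]
  zero_mem' := fun d => rfl
  smul_mem' := fun c w hw d => by simp [hw d]

/-- The cycles of `π`, including the fixed points. -/
abbrev Orbits (π : Perm D) : Type := Quotient (Perm.SameCycle.setoid π)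

theorem invariants_sameCycle {π : Perm D} {w : D → ℚ} (hw : w ∈ invariants π) {x y : D}
    (h : π.SameCycle x y) : w x = w y := by
  obtain ⟨n, rfl⟩ := h.exists_nat_pow_eq
  clear h
  induction n with
  | zero => simp
  | succ n ih => rw [pow_succ', Perm.mul_apply, hw]; exact ih

theorem finrank_invariants (π : Perm D) :
    Module.finrank ℚ (invariants π) = Nat.card (Orbits π) := by
  classical
  have : invariants π =
      LinearMap.range (LinearMap.funLeft ℚ ℚ (Quotient.mk (Perm.SameCycle.setoid π))) := by
    ext w
    constructor
    · intro hw
      refine ⟨Quotient.lift w fun x y h => invariants_sameCycle hw h, ?_⟩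
      ext d; rfl
    · rintro ⟨f, rfl⟩ d
      simp only [LinearMap.funLeft_apply]
      congr 1
      exact Quotient.sound (Perm.sameCycle_apply_left.2 (Perm.SameCycle.refl _ _))
  rw [this, LinearMap.finrank_range_of_inj
    (LinearMap.funLeft_injective_of_surjective _ _ _ Quotient.mk_surjective)]
  have : Fintype (Orbits π) := Fintype.ofFinite _
  simp [Nat.card_eq_fintype_card]

/-- Euler's inequality `2 E + 2 ≤ E + V + F`. There are `2 E` darts, and the cycles of `α`, `φ * α`
and `φ` are the edges, vertices and faces. The kernel of the map `T` that symmetrizes the increments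
of a function along faces is contained, by simple connectivity, in the sum of the spaces of
functions constant on vertices and on faces, which intersect non-trivially; the range of `T` is a
proper subspace of the functions constant on edges. -/
theorem euler [Nonempty D] {α φ : Perm D} (hinv : ∀ x, α (α x) = x) (hs : SimplyConn α φ) :
    Fintype.card D + 2 ≤
      Nat.card (Orbits α) + Nat.card (Orbits (φ * α)) + Nat.card (Orbits φ) := by
  classical
  simp only [← finrank_invariants]
  let T : (D → ℚ) →ₗ[ℚ] (D → ℚ) :=
    LinearMap.funLeft ℚ ℚ φ - LinearMap.id +
      (LinearMap.funLeft ℚ ℚ (φ ∘ α) - LinearMap.funLeft ℚ ℚ α)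
  have hT : ∀ h d, T h d = (h (φ d) - h d) + (h (φ (α d)) - h (α d)) := fun h d => rfl
  have h1 := LinearMap.finrank_range_add_finrank_ker T
  rw [Module.finrank_fintype_fun_eq_card] at h1
  have sumT : ∀ h, ∑ d, T h d = 0 := fun h => by
    simp only [hT, Finset.sum_add_distrib, Finset.sum_sub_distrib]
    have e1 := Equiv.sum_comp φ h
    have e2 := Equiv.sum_comp (φ * α) h
    have e3 := Equiv.sum_comp α h
    simp only [Perm.mul_apply] at e2
    rw [e1, e2, e3]; ring
  have h2 : Module.finrank ℚ (LinearMap.range T) < Module.finrank ℚ (invariants α) := by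
    apply Submodule.finrank_lt_finrank_of_lt
    refine lt_of_le_of_ne ?_ ?_
    · rintro _ ⟨h, rfl⟩ d
      simp only [hT, hinv]; ring
    · intro he
      have : (fun _ => 1 : D → ℚ) ∈ LinearMap.range T := by rw [he]; intro d; rfl
      obtain ⟨h, hh⟩ := this
      have := sumT h
      rw [hh] at this
      simp at this
  have h3 : LinearMap.ker T ≤ invariants (φ * α) ⊔ invariants φ := by
    intro h hh
    have hh : ∀ d, T h d = 0 := fun d => congrFun (LinearMap.mem_ker.1 hh) d
    obtain ⟨g, g1, g2⟩ := hs h (fun d => by have := hh d; rw [hT] at this; linarith)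
    rw [show h = g + (h - g) by simp]
    refine Submodule.add_mem_sup (fun d => ?_) (fun d => ?_)
    · have := g2 (α d)
      rw [hinv] at this
      exact this.symm
    · have := g1 d
      simp only [Pi.sub_apply]; linarith
  have h4 := Submodule.finrank_mono h3
  have h5 := Submodule.finrank_sup_add_finrank_inf_eq (invariants (φ * α)) (invariants φ)
  have h6 : 0 < Module.finrank ℚ (invariants (φ * α) ⊓ invariants φ : Submodule ℚ (D → ℚ)) := by
    rw [Module.finrank_pos_iff_exists_ne_zero]
    refine ⟨⟨fun _ => 1, fun _ => rfl, fun _ => rfl⟩, fun h => ?_⟩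
    have := congrFun (congrArg Subtype.val h) (Classical.arbitrary D)
    simp at this
  omega

/-- If every point carries a weight at least the inverse of the size of its class, the number of
classes is at most the total weight. -/
theorem card_quotient_le (s : Setoid D) (wt : D → ℚ)
    (hw : ∀ d, ∃ t : Finset D, (∀ x ∈ t, s x d) ∧ 1 ≤ t.card * wt d) :
    (Nat.card (Quotient s) : ℚ) ≤ ∑ d, wt d := by
  classical
  have : Fintype (Quotient s) := Fintype.ofFinite _
  rw [Nat.card_eq_fintype_card, ← Finset.sum_fiberwise Finset.univ (Quotient.mk s) wt]
  have : (Fintype.card (Quotient s) : ℚ) = ∑ c : Quotient s, 1 := by simp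
  rw [this]
  refine Finset.sum_le_sum fun c _ => ?_
  induction c using Quotient.inductionOn with
  | h a =>
  set S := Finset.univ.filter (fun d => Quotient.mk s d = Quotient.mk s a) with hS
  have pos : (0 : ℚ) < S.card := by
    exact_mod_cast Finset.card_pos.2 ⟨a, by simp [hS]⟩
  have : ∀ d ∈ S, (1 : ℚ) / S.card ≤ wt d := by
    intro d hd
    obtain ⟨t, ht, h1⟩ := hw d
    have hd' : Quotient.mk s d = Quotient.mk s a := by simpa [hS] using hd
    have : t ⊆ S := fun x hx => by
      simp only [hS, Finset.mem_filter, Finset.mem_univ, true_and]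
      rw [← hd']; exact Quotient.sound (ht x hx)
    have hc : (t.card : ℚ) ≤ S.card := by exact_mod_cast Finset.card_le_card this
    have hwt : 0 ≤ wt d := by
      by_contra hneg
      have : (t.card : ℚ) * wt d ≤ 0 := mul_nonpos_of_nonneg_of_nonpos (by positivity) (by linarith)
      linarith
    rw [div_le_iff₀ pos]
    nlinarith
  calc (1 : ℚ) = ∑ d ∈ S, (1 : ℚ) / S.card := by
        rw [Finset.sum_const, nsmul_eq_mul]; field_simp
    _ ≤ ∑ d ∈ S, wt d := Finset.sum_le_sum this

end Euler

/-! ### Small cancellation -/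

variable {X V : Type}

/-- The part `l s, …, l t` of the label of a path `v` can be read in the graph from the vertex `v s`
only. -/
def Rigid (Step : V → X × Bool → V → Prop) (v : ℤ → V) (l : ℤ → X × Bool) (s t : ℤ) : Prop :=
  ∀ v' : ℤ → V, (∀ i, s ≤ i → i ≤ t → Step (v' i) (l i) (v' (i + 1))) → v' s = v s

/-- A reduced closed path of length `N`, as an `N`-periodic bi-infinite path with vertices `v` and
letters `l`. -/
structure IsPeriodicPath (Step : V → X × Bool → V → Prop) (v : ℤ → V) (l : ℤ → X × Bool) (N : ℤ) :
    Prop where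
  pos : 0 < N
  step : ∀ i, Step (v i) (l i) (v (i + 1))
  vper : ∀ i, v (i + N) = v i
  lper : ∀ i, l (i + N) = l i
  red : ∀ i, l (i + 1) ≠ flipLetter (l i)

/-- Seven rigid subpaths of one period of a closed path, the `k`-th from the letter `s k` to the
letter `t k`. The last letter of one may be the first letter of the next one. -/
structure IsRigidFamily (Step : V → X × Bool → V → Prop) (v : ℤ → V) (l : ℤ → X × Bool) (N : ℤ)
    (s t : ℕ → ℤ) : Prop where
  lt : ∀ k < 7, s k < t k
  le : ∀ k < 6, t k ≤ s (k + 1)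
  last : t 6 ≤ s 0 + N
  rigid : ∀ k < 7, Rigid Step v l (s k) (t k)

/-- Every reduced closed path contains seven rigid subpaths, disjoint up to their end letters. -/
def SmallCancellation (Step : V → X × Bool → V → Prop) : Prop :=
  ∀ v l N, IsPeriodicPath Step v l N → ∃ s t, IsRigidFamily Step v l N s t

theorem IsRigidFamily.t_le_s {Step : V → X × Bool → V → Prop} {v : ℤ → V} {l : ℤ → X × Bool} {N : ℤ}
    {s t : ℕ → ℤ} (h : IsRigidFamily Step v l N s t) {i j : ℕ} (hij : i < j) (hj : j < 7) :
    t i ≤ s j := by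
  induction j with
  | zero => omega
  | succ j ih =>
    rcases Nat.lt_succ_iff_lt_or_eq.1 hij with h1 | rfl
    · exact ((ih h1 (by omega)).trans (h.lt j (by omega)).le).trans (h.le j (by omega))
    · exact h.le _ (by omega)

namespace BrokenMap

variable {Step : V → X × Bool → V → Prop} {u v : V} {D : Type}

section
variable {M : BrokenMap Step u v D} (hb : ∀ d, ¬ M.Bad d)
include hb

theorem vertex_ne {x : D} (hx : M.α x ≠ M.b) : M.φ (M.α x) ≠ x := by
  intro h
  apply hb (M.α x)
  rw [Bad, M.inv, M.cont _ hx, h]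

/-- A rigid subpath of the boundary of a face contains, at an inner vertex, a corner at a vertex of
degree at least three, or the corner opposite to the jump: otherwise the faces on the other side of
its edges would be the same one, whose lift could replace that of the subpath. -/
theorem exists_corner (hsymm : ∀ u l v, Step u l v → Step v (flipLetter l) u) {x : ℤ → D}
    (hx : ∀ i, M.φ (x i) = x (i + 1)) {s t : ℤ} (hst : s < t)
    (hr : Rigid Step (fun i => M.p (x i)) (fun i => M.lab (x i)) s t) :
    ∃ m, s < m ∧ m ≤ t ∧ (M.α (x m) = M.b ∨ (M.φ (M.α (x m)) ≠ x m ∧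
      M.φ (M.α (M.φ (M.α (x m)))) ≠ x m)) := by
  by_contra hcon
  push Not at hcon
  have key : ∀ m, s < m → m ≤ t → M.q (M.α (x m)) = M.p (M.α (x (m - 1))) := by
    intro m h1 h2
    obtain ⟨c1, c2⟩ := hcon m h1 h2
    have c3 := c2 (vertex_ne hb c1)
    have c4 : M.φ (x (m - 1)) = x m := by rw [hx]; congr 1; ring
    have c5 := M.φ.injective (c3.trans c4.symm)
    rw [M.cont _ c1, ← c5, M.inv]
  apply hb (M.α (x s))
  have := hr (fun i => if i ≤ t then M.q (M.α (x i)) else M.p (M.α (x t))) ?_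
  · rw [if_pos hst.le] at this
    rw [Bad, M.inv, this]
  · intro i h1 h2
    have st : Step (M.q (M.α (x i))) (M.lab (x i)) (M.p (M.α (x i))) := by
      have := hsymm _ _ _ (M.step (M.α (x i)))
      rwa [M.lab_inv, flipLetter_flipLetter] at this
    simp only [if_pos h2]
    split_ifs with h3
    · rw [key (i + 1) (by omega) h3]; simpa using st
    · have : i = t := by omega
      rwa [this] at st ⊢

end

/-- Under the small cancellation condition there is no irreducible broken map. The corners at a
vertex of degree `1`, `2` or at least `3` get the weights `1`, `1 / 2` and `1 / 3`, and a dart gets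
the weight of its corner minus `1 / 2`. In a face other than the broken one the jump affects at most
one corner, and six more are at vertices of degree at least three, so that the weights sum to at
most `-1`. In the broken face the sum is at most `1 / 2`. This contradicts Euler's inequality. -/
theorem false_of_irreducible [Finite D] (hsymm : ∀ u l v, Step u l v → Step v (flipLetter l) u)
    (hSC : SmallCancellation Step) (M : BrokenMap Step u v D) (hb : ∀ d, ¬ M.Bad d)
    (hs : ∀ d, ¬ M.Spur d) : False := by
  classical
  have : Fintype D := Fintype.ofFinite D
  have : Nonempty D := ⟨M.b⟩
  set σ := M.φ * M.α with hσ
  let wt : D → ℚ := fun d => if σ d = d then 1 else if σ (σ d) = d then 1 / 2 else 1 / 3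
  have wt_le : ∀ d, wt d ≤ 1 := fun d => by
    simp only [wt]; split_ifs <;> norm_num
  have wt_half : ∀ d, M.α d ≠ M.b → wt d ≤ 1 / 2 := fun d hd => by
    have : σ d ≠ d := vertex_ne hb hd
    simp only [wt, this, if_false]; split_ifs <;> norm_num
  have E := euler M.inv M.simplyConn
  have Eα : (Nat.card (Orbits M.α) : ℚ) ≤ ∑ d : D, (1 / 2 : ℚ) := by
    refine card_quotient_le _ _ fun d => ⟨{d, M.α d}, ?_, ?_⟩
    · intro x hx
      simp only [Finset.mem_insert, Finset.mem_singleton] at hx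
      rcases hx with rfl | rfl
      · exact Perm.SameCycle.refl _ _
      · exact Perm.sameCycle_apply_left.2 (Perm.SameCycle.refl _ _)
    · rw [Finset.card_pair (M.ne d).symm]; norm_num
  have Eσ : (Nat.card (Orbits σ) : ℚ) ≤ ∑ d : D, wt d := by
    refine card_quotient_le _ _ fun d => ?_
    have s1 : σ.SameCycle (σ d) d := Perm.sameCycle_apply_left.2 (Perm.SameCycle.refl _ _)
    have s2 : σ.SameCycle (σ (σ d)) d := Perm.sameCycle_apply_left.2 s1
    by_cases h1 : σ d = d
    · refine ⟨{d}, fun x hx => ?_, by simp [wt, h1]⟩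
      rw [Finset.mem_singleton.1 hx]
    by_cases h2 : σ (σ d) = d
    · refine ⟨{d, σ d}, fun x hx => ?_, ?_⟩
      · simp only [Finset.mem_insert, Finset.mem_singleton] at hx
        rcases hx with rfl | rfl
        exacts [Perm.SameCycle.refl _ _, s1]
      · rw [Finset.card_pair (Ne.symm h1)]; simp [wt, h1, h2]
    · refine ⟨{d, σ d, σ (σ d)}, fun x hx => ?_, ?_⟩
      · simp only [Finset.mem_insert, Finset.mem_singleton] at hx
        rcases hx with rfl | rfl | rfl
        exacts [Perm.SameCycle.refl _ _, s1, s2]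
      · rw [Finset.card_eq_three.2 ⟨d, σ d, σ (σ d), Ne.symm h1, Ne.symm h2,
          fun e => h1 (σ.injective e).symm, rfl⟩]
        simp [wt, h1, h2]
  have : Fintype (Orbits M.φ) := Fintype.ofFinite _
  have Eφ : (Nat.card (Orbits M.φ) : ℚ) + ∑ d : D, (wt d - 1 / 2) =
      ∑ c : Orbits M.φ,
        (1 + ∑ d with Quotient.mk (Perm.SameCycle.setoid M.φ) d = c, (wt d - 1 / 2)) := by
    rw [Finset.sum_add_distrib, Finset.sum_fiberwise, Nat.card_eq_fintype_card]
    simp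
  -- Euler's inequality, with all contributions distributed to the faces
  have total : (2 : ℚ) ≤ ∑ c : Orbits M.φ,
      (1 + ∑ d with Quotient.mk (Perm.SameCycle.setoid M.φ) d = c, (wt d - 1 / 2)) := by
    rw [← Eφ, Finset.sum_sub_distrib]
    have E' : (Fintype.card D : ℚ) + 2 ≤ Nat.card (Orbits M.α) + Nat.card (Orbits σ) +
      Nat.card (Orbits M.φ) := by exact_mod_cast E
    simp only [Finset.sum_const, Finset.card_univ, nsmul_eq_mul] at *
    linarith
  have face : ∀ c : Orbits M.φ, c ≠ Quotient.mk _ M.b →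
      1 + ∑ d with Quotient.mk (Perm.SameCycle.setoid M.φ) d = c, (wt d - 1 / 2) ≤ 0 := by
    intro c hc
    induction c using Quotient.inductionOn with
    | h a =>
    set x : ℤ → D := fun i => (M.φ ^ i) a with hx
    have hsame : ∀ i, M.φ.SameCycle (x i) a := fun i =>
      (Perm.SameCycle.symm ⟨i, rfl⟩)
    have hxb : ∀ i, x i ≠ M.b := fun i h => hc (Quotient.sound ((h ▸ hsame i).symm))
    have hx1 : ∀ i, M.φ (x i) = x (i + 1) := fun i => by
      simp only [hx]; rw [add_comm, zpow_add, zpow_one, Perm.mul_apply]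
    set N : ℕ := MulAction.period M.φ a with hN
    have hNpos : 0 < N := MulAction.period_pos_of_orderOf_pos (orderOf_pos _) a
    have hxN : ∀ i j, x i = x j → (N : ℤ) ∣ i - j := fun i j hij => by
      rw [hN, ← MulAction.zpow_smul_eq_iff_period_dvd, Perm.smul_def, sub_eq_neg_add, zpow_add,
        Perm.mul_apply]
      have : (M.φ ^ i) a = (M.φ ^ j) a := hij
      rw [this, ← Perm.mul_apply, ← zpow_add]; simp
    have hper : ∀ i, x (i + N) = x i := fun i => by
      simp only [hx]
      rw [zpow_add, Perm.mul_apply]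
      congr 1
      exact (MulAction.zpow_smul_eq_iff_period_dvd (a := a) (g := M.φ)).2 (dvd_refl _)
    obtain ⟨s, t, hst⟩ := hSC (fun i => M.p (x i)) (fun i => M.lab (x i)) N
      { pos := by exact_mod_cast hNpos
        step := fun i => by
          have := M.step (x i)
          rwa [M.cont _ (hxb i), hx1] at this
        vper := fun i => by simp only [hper]
        lper := fun i => by simp only [hper]
        red := fun i h => hs (x i) ⟨hxb i, by rw [hx1]; exact h⟩ }
    choose! m m1 m2 m3 using fun k (hk : k < 7) =>
      M.exists_corner hb hsymm hx1 (hst.lt k hk) (hst.rigid k hk)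
    have mlt : ∀ i j, i < j → j < 7 → m i < m j := fun i j hij hj =>
      (m2 i (by omega)).trans_lt ((hst.t_le_s hij hj).trans_lt (m1 j hj))
    have mlt' : ∀ i < 7, ∀ j < 7, m j < m i + N := fun i hi j hj => by
      have a1 : m j ≤ t 6 := by
        rcases eq_or_ne j 6 with rfl | h
        · exact m2 _ hj
        · exact (m2 j hj).trans ((hst.t_le_s (by omega : j < 6) (by omega)).trans
            (hst.lt 6 (by omega)).le)
      have a2 : s 0 < m i := by
        rcases eq_or_ne i 0 with rfl | h
        · exact m1 _ hi
        · exact ((hst.lt 0 (by omega)).trans_le (hst.t_le_s (by omega : 0 < i) hi)).trans (m1 i hi)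
      have := hst.last
      omega
    have hinj : Set.InjOn (fun k => x (m k)) (Finset.range 7 : Set ℕ) := by
      intro i hi j hj hij
      simp only [Finset.coe_range, Set.mem_Iio] at hi hj
      by_contra hne
      have h0 := hxN _ _ hij
      have h1 := mlt' i hi j hj
      have h2 := mlt' j hj i hi
      have h3 : m i - m j = 0 := Int.eq_zero_of_abs_lt_dvd h0
        (by rw [abs_lt]; constructor <;> omega)
      rcases lt_or_gt_of_ne hne with h | h
      · have := mlt i j h hj; omega
      · have := mlt j i h hi; omega
    set S := (Finset.range 7).image (fun k => x (m k)) with hS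
    have hScard : S.card = 7 := by rw [hS, Finset.card_image_of_injOn hinj]; simp
    set S' := S.erase (M.α M.b) with hS'
    have hS'card : 6 ≤ S'.card := by
      have := Finset.pred_card_le_card_erase (s := S) (a := M.α M.b)
      rw [hScard] at this
      exact this
    have hsub : S' ⊆ Finset.univ.filter
        (fun d => Quotient.mk (Perm.SameCycle.setoid M.φ) d = Quotient.mk _ a) := by
      intro d hd
      obtain ⟨k, -, rfl⟩ := Finset.mem_image.1 (Finset.mem_of_mem_erase hd)
      simp only [Finset.mem_filter, Finset.mem_univ, true_and]
      exact Quotient.sound (hsame _)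
    have hwS : ∀ d ∈ S', wt d - 1 / 2 ≤ -1 / 6 := by
      intro d hd
      obtain ⟨h1, h2⟩ := Finset.mem_erase.1 hd
      obtain ⟨k, hk, rfl⟩ := Finset.mem_image.1 h2
      rcases m3 k (Finset.mem_range.1 hk) with h | ⟨h3, h4⟩
      · exact absurd (by rw [← h, M.inv]) h1
      · have h3' : σ (x (m k)) ≠ x (m k) := h3
        have h4' : σ (σ (x (m k))) ≠ x (m k) := h4
        simp only [wt, h3', h4', if_false]; norm_num
    have hnonpos : ∀ d ∈ Finset.univ.filter
        (fun d => Quotient.mk (Perm.SameCycle.setoid M.φ) d = Quotient.mk _ a),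
        d ∉ S' → wt d - 1 / 2 ≤ 0 := by
      intro d hd _
      by_cases h : M.α d = M.b
      · have h1 : σ d ≠ d := by
          intro h1
          apply hc
          rw [← (Finset.mem_filter.1 hd).2]
          have : M.φ M.b = d := by rw [← h]; exact h1
          rw [← this]
          exact Quotient.sound (Perm.sameCycle_apply_left.2 (Perm.SameCycle.refl _ _))
        simp only [wt, h1, if_false]; split_ifs <;> norm_num
      · linarith [wt_half d h]
    rw [← Finset.sum_sdiff hsub]
    have b1 := Finset.sum_nonpos (s := (Finset.univ.filter
        (fun d => Quotient.mk (Perm.SameCycle.setoid M.φ) d = Quotient.mk _ a)) \ S')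
        (f := fun d => wt d - 1 / 2)
        (fun d hd => hnonpos d (Finset.mem_sdiff.1 hd).1 (Finset.mem_sdiff.1 hd).2)
    have b2 := Finset.sum_le_card_nsmul S' (fun d => wt d - 1 / 2) (-1 / 6) hwS
    rw [nsmul_eq_mul] at b2
    have b3 : (6 : ℚ) ≤ S'.card := by exact_mod_cast hS'card
    linarith
  have outer : ∀ T : Finset D, ∑ d ∈ T, (wt d - 1 / 2) ≤ 1 / 2 := by
    intro T
    have h1 : ∑ d ∈ T.erase (M.α M.b), (wt d - 1 / 2) ≤ 0 := by
      refine Finset.sum_nonpos fun d hd => ?_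
      linarith [wt_half d fun h => (Finset.mem_erase.1 hd).1 (by rw [← h, M.inv])]
    by_cases h : M.α M.b ∈ T
    · rw [← Finset.add_sum_erase _ _ h]; linarith [wt_le (M.α M.b)]
    · rw [Finset.erase_eq_of_notMem h] at h1; linarith
  rw [← Finset.add_sum_erase _ _ (Finset.mem_univ (Quotient.mk _ M.b))] at total
  have := Finset.sum_nonpos (s := Finset.univ.erase (Quotient.mk (Perm.SameCycle.setoid M.φ) M.b))
    (fun c hc => face c (Finset.mem_erase.1 hc).1)
  have := outer (Finset.univ.filter (fun d =>
    Quotient.mk (Perm.SameCycle.setoid M.φ) d = Quotient.mk _ M.b))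
  linarith

end BrokenMap

/-! ### Faces as lists of darts -/

section Face

variable {D : Type}

/-- `L` lists the darts of a face of `φ` in order. -/
def IsFace (φ : Perm D) (L : List D) : Prop :=
  L.IsChain (fun x y => φ x = y) ∧ ∀ x ∈ L.getLast?, ∀ y ∈ L.head?, φ x = y

theorem getLast?_append_concat (A B : List D) (b : D) : (A ++ (B ++ [b])).getLast? = some b := by
  rw [← List.append_assoc, List.getLast?_concat]

theorem IsFace.rotate {φ : Perm D} {A B : List D} (h : IsFace φ (A ++ B)) : IsFace φ (B ++ A) := by
  rcases A.eq_nil_or_concat' with rfl | ⟨A', a, rfl⟩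
  · simpa using h
  rcases B.eq_nil_or_concat' with rfl | ⟨B', b, rfl⟩
  · simpa using h
  obtain ⟨h1, h2⟩ := h
  rw [List.isChain_append] at h1
  obtain ⟨h3, h4, h5⟩ := h1
  refine ⟨List.isChain_append.2 ⟨h4, h3, fun x hx y hy => h2 x ?_ y ?_⟩,
    fun x hx y hy => h5 x ?_ y ?_⟩
  · rw [getLast?_append_concat]; simpa using hx
  · cases A' <;> simpa using hy
  · rw [getLast?_append_concat] at hx; simpa using hx
  · cases B' <;> simpa using hy

/-- A dart of a chain is the last one, or its successor also belongs to the chain. -/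
theorem next_of_isChain {φ : Perm D} {L : List D} (h : L.IsChain (fun x y => φ x = y)) {x : D}
    (hx : x ∈ L) : x ∈ L.getLast? ∨ φ x ∈ L := by
  obtain ⟨s, t, rfl⟩ := List.append_of_mem hx
  cases t with
  | nil => simp
  | cons y t =>
    right
    rw [List.isChain_append_cons_cons] at h
    rw [h.2.1]; simp

theorem IsFace.apply_mem {φ : Perm D} {L : List D} (h : IsFace φ L) {x : D} (hx : x ∈ L) :
    φ x ∈ L := by
  rcases next_of_isChain h.1 hx with h1 | h1
  · cases L with
    | nil => simp at hx
    | cons a L => rw [h.2 x h1 a rfl]; simp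
  · exact h1

theorem IsFace.apply_mem_iff [DecidableEq D] {φ : Perm D} {L : List D} (h : IsFace φ L) (x : D) :
    φ x ∈ L ↔ x ∈ L := by
  refine ⟨fun hx => ?_, h.apply_mem⟩
  have h1 : L.toFinset.image φ = L.toFinset := by
    refine Finset.eq_of_subset_of_card_le (fun y hy => ?_) ?_
    · obtain ⟨z, hz, rfl⟩ := Finset.mem_image.1 hy
      exact List.mem_toFinset.2 (h.apply_mem (List.mem_toFinset.1 hz))
    · rw [Finset.card_image_of_injective _ φ.injective]
  have : φ x ∈ L.toFinset.image φ := by rw [h1]; exact List.mem_toFinset.2 hx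
  obtain ⟨z, hz, hzx⟩ := Finset.mem_image.1 this
  rw [← φ.injective hzx]; exact List.mem_toFinset.1 hz

theorem IsFace.const {φ : Perm D} {L : List D} (h : IsFace φ L) {β : Type} (k : D → β)
    (hk : ∀ d, k (φ d) = k d) {x y : D} (hx : x ∈ L) (hy : y ∈ L) : k x = k y := by
  have h1 : L.IsChain (fun x y => k x = k y) := h.1.imp (fun a b hab => by rw [← hab, hk])
  have : L.Pairwise (fun x y => k x = k y) := by
    have : IsTrans D (fun x y => k x = k y) := ⟨fun a b c hab hbc => hab.trans hbc⟩
    exact List.isChain_iff_pairwise.1 h1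
  by_cases hxy : x = y
  · rw [hxy]
  · exact List.Pairwise.forall_of_forall (R := fun x y => k x = k y) (fun _ _ => rfl) this hx hy

/-- Cutting a face along two of its corners keeps the map simply connected. -/
theorem SimplyConn.split [DecidableEq D] {α φ : Perm D} (hs : SimplyConn α φ) {A B : List D}
    {a b : D} (hf : IsFace φ ((A ++ [a]) ++ (B ++ [b]))) (hn : ((A ++ [a]) ++ (B ++ [b])).Nodup) :
    SimplyConn α (φ * swap a b) := by
  intro h H
  have hf' := hf.rotate
  set a₀ := (A ++ [a]).head (by simp) with ha₀
  set b₀ := (B ++ [b]).head (by simp) with hb₀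
  have hbA : φ b = a₀ := hf.2 b (getLast?_append_concat _ _ _) _ (by
    rw [ha₀, List.head?_append_of_ne_nil _ (by simp)]; exact List.head_mem_head? _)
  have haB : φ a = b₀ := hf'.2 a (getLast?_append_concat _ _ _) _ (by
    rw [hb₀, List.head?_append_of_ne_nil _ (by simp)]; exact List.head_mem_head? _)
  have hb₀m : b₀ ∈ B ++ [b] := List.head_mem _
  have ha₀m : a₀ ∈ A ++ [a] := List.head_mem _
  have hdisj := List.disjoint_of_nodup_append hn
  have hab : a ≠ b := fun e => hdisj (by simp : a ∈ A ++ [a]) (by simp [e])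
  have haB' : a ∉ B ++ [b] := hdisj (by simp)
  have ca := (List.isChain_append.1 hf.1).1
  have cb := (List.isChain_append.1 hf.1).2.1
  set c : ℚ := h a₀ - h b₀ with hc
  set h' : D → ℚ := fun d => h d + if d ∈ B ++ [b] then c else 0 with hh'
  have key : ∀ d, h' (φ d) - h' d = h ((φ * swap a b) d) - h d := by
    intro d
    by_cases da : d = a
    · rw [da, Perm.mul_apply, swap_apply_left, hbA, haB]
      simp only [hh', hb₀m, haB', if_true, if_false, hc]; ring
    by_cases db : d = b
    · have : a₀ ∉ B ++ [b] := hdisj ha₀m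
      rw [db, Perm.mul_apply, swap_apply_right, hbA, haB]
      simp only [hh', this, if_false, hc]; simp; ring
    rw [Perm.mul_apply, swap_apply_of_ne_of_ne da db]
    have : φ d ∈ B ++ [b] ↔ d ∈ B ++ [b] := by
      constructor
      · intro h1
        have h2 : d ∈ (A ++ [a]) ++ (B ++ [b]) := (hf.apply_mem_iff d).1 (by
          rw [List.mem_append]; exact Or.inr h1)
        rcases List.mem_append.1 h2 with h3 | h3
        · rcases next_of_isChain ca h3 with h4 | h4
          · simp at h4; exact absurd h4.symm da
          · exact absurd h1 (hdisj h4)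
        · exact h3
      · intro h1
        rcases next_of_isChain cb h1 with h4 | h4
        · simp at h4; exact absurd h4.symm db
        · exact h4
    simp only [hh', this]; ring
  obtain ⟨g, g1, g2⟩ := hs h' (fun d => by rw [key, key, H])
  have gk : g a₀ = g b₀ := by
    have := hf.const (fun d => g d - h' d) (fun d => by linarith [g1 d])
      (List.mem_append.2 (Or.inl ha₀m)) (List.mem_append.2 (Or.inr hb₀m))
    have n1 : a₀ ∉ B ++ [b] := hdisj ha₀m
    simp only [hh', n1, hb₀m, if_true, if_false, hc] at this
    linarith
  have gφ : ∀ d, g ((φ * swap a b) d) = g (φ d) := by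
    intro d
    by_cases da : d = a
    · rw [da, Perm.mul_apply, swap_apply_left, hbA, haB, gk]
    by_cases db : d = b
    · rw [db, Perm.mul_apply, swap_apply_right, hbA, haB, gk]
    rw [Perm.mul_apply, swap_apply_of_ne_of_ne da db]
  exact ⟨g, fun d => by rw [gφ, g1, key], fun d => by rw [gφ, g2]⟩

/-- Swapping the successors of `a` and `b` cuts the face `A a B b` into `A a` and `B b`. -/
theorem IsFace.split [DecidableEq D] {φ : Perm D} {A B : List D} {a b : D}
    (hf : IsFace φ ((A ++ [a]) ++ (B ++ [b]))) (hn : ((A ++ [a]) ++ (B ++ [b])).Nodup) :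
    IsFace (φ * swap a b) (A ++ [a]) ∧ IsFace (φ * swap a b) (B ++ [b]) := by
  have main : ∀ {A B : List D} {a b : D} (_ : IsFace φ ((A ++ [a]) ++ (B ++ [b])))
      (_ : ((A ++ [a]) ++ (B ++ [b])).Nodup), IsFace (φ * swap a b) (A ++ [a]) := by
    intro A B a b hf hn
    have hdisj := List.disjoint_of_nodup_append hn
    have hnA := (List.nodup_append.1 hn).1
    refine ⟨?_, fun x hx y hy => ?_⟩
    · have h1 := (List.isChain_append.1 hf.1).1
      rw [List.isChain_append] at h1 ⊢
      have hm : ∀ x ∈ A, (φ * swap a b) x = φ x := fun x hx => by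
        rw [Perm.mul_apply, swap_apply_of_ne_of_ne]
        · rintro rfl; exact (List.disjoint_of_nodup_append hnA) hx (by simp)
        · rintro rfl; exact hdisj (List.mem_append.2 (Or.inl hx)) (by simp)
      refine ⟨?_, by simp, fun x hx y hy => ?_⟩
      · have := h1.1
        rw [List.isChain_iff_getElem] at this ⊢
        intro i hi
        rw [hm _ (List.getElem_mem _)]; exact this i hi
      · rw [hm _ (List.mem_of_mem_getLast? hx)]; exact h1.2.2 x hx y hy
    · simp only [List.getLast?_append, List.getLast?_singleton, Option.some_or,
        Option.mem_some_iff] at hx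
      subst hx
      rw [Perm.mul_apply, swap_apply_left]
      refine hf.2 b (getLast?_append_concat _ _ _) y ?_
      rw [List.head?_append_of_ne_nil _ (by simp)]; exact hy
  refine ⟨main hf hn, ?_⟩
  rw [swap_comm]
  exact main hf.rotate (List.nodup_append_comm.1 hn)

end Face

/-! ### Inserting an edge -/

section Insert

variable {D : Type} [DecidableEq D] (α φ : Perm D) (y : D)

/-- Reversal of darts after a new edge `{inr false, inr true}` is added. -/
def insertα : Perm (D ⊕ Bool) := sumCongr α (swap false true)

/-- The faces after a new edge with one free end is attached at the end of the dart `y`: `y` is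
followed by the dart `inr false` out to the free end, the way back `inr true` and then `φ y`. -/
def insertφ : Perm (D ⊕ Bool) :=
  sumCongr φ 1 * swap (Sum.inl y) (Sum.inr true) * swap (Sum.inl y) (Sum.inr false)

theorem insertφ_self : insertφ φ y (Sum.inl y) = Sum.inr false := by
  simp [insertφ, swap_apply_of_ne_of_ne]

theorem insertφ_false : insertφ φ y (Sum.inr false) = Sum.inr true := by
  simp [insertφ]

theorem insertφ_true : insertφ φ y (Sum.inr true) = Sum.inl (φ y) := by
  simp [insertφ, swap_apply_of_ne_of_ne]

theorem insertφ_of_ne {x : D} (h : x ≠ y) : insertφ φ y (Sum.inl x) = Sum.inl (φ x) := by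
  simp [insertφ, swap_apply_of_ne_of_ne, h]

variable {α φ}

/-- Attaching a new edge with one free end keeps the map simply connected. -/
theorem SimplyConn.insert (hs : SimplyConn α φ) : SimplyConn (insertα α) (insertφ φ y) := by
  intro h H
  have e1 := H (Sum.inr false)
  have a1 : ∀ x, insertα α (Sum.inl x) = Sum.inl (α x) := fun _ => rfl
  have a2 : insertα α (Sum.inr false) = Sum.inr true := rfl
  have a3 : insertα α (Sum.inr true) = Sum.inr false := rfl
  rw [a2, insertφ_false, insertφ_true] at e1
  have k : ∀ x, h (insertφ φ y (Sum.inl x)) = h (Sum.inl (φ x)) := fun x => by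
    by_cases hx : x = y
    · rw [hx, insertφ_self]; linarith
    · rw [insertφ_of_ne _ _ hx]
  obtain ⟨g, g1, g2⟩ := hs (fun x => h (Sum.inl x)) (fun d => by
    have := H (Sum.inl d)
    rwa [a1, k, k] at this)
  set g' : D ⊕ Bool → ℚ := Sum.elim g (fun b =>
    if b then g (φ y) + (h (Sum.inr true) - h (Sum.inr false)) else g (φ y)) with hg'
  have k' : ∀ x, g' (insertφ φ y (Sum.inl x)) = g (φ x) := fun x => by
    by_cases hx : x = y
    · rw [hx, insertφ_self]; simp [hg']
    · rw [insertφ_of_ne _ _ hx]; simp [hg']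
  refine ⟨g', ?_, ?_⟩
  · rintro (x | _ | _)
    · rw [k', k]; exact g1 x
    · rw [insertφ_false]; simp [hg']
    · rw [insertφ_true]; simp [hg']; linarith
  · rintro (x | _ | _)
    · rw [a1, k']; exact g2 x
    · rw [a2, insertφ_false]
    · rw [a3, insertφ_true]; simp [hg']

theorem IsFace.insert {L : List D} (hf : IsFace φ (L ++ [y])) (hn : (L ++ [y]).Nodup) :
    IsFace (insertφ φ y) (Sum.inr false :: Sum.inr true :: (L ++ [y]).map Sum.inl) := by
  refine ⟨?_, fun x hx z hz => ?_⟩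
  · rw [List.isChain_cons_cons]
    refine ⟨insertφ_false _ _, ?_⟩
    rw [List.isChain_cons]
    refine ⟨fun z hz => ?_, ?_⟩
    · rw [insertφ_true]
      simp only [List.head?_map, Option.mem_def, Option.map_eq_some_iff] at hz
      obtain ⟨w, hw, rfl⟩ := hz
      rw [hf.2 y (by simp) w hw]
    · have h1 := hf.1
      rw [List.isChain_iff_getElem] at h1 ⊢
      intro i hi
      have hi' : i + 1 < (L ++ [y]).length := by simpa using hi
      rw [List.getElem_map, List.getElem_map, insertφ_of_ne, h1 i hi']
      intro h
      have hl : i < L.length := by simpa using hi'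
      rw [List.getElem_append_left hl] at h
      exact (List.disjoint_of_nodup_append hn) (List.getElem_mem hl) (by simp [h])
  · have e : (Sum.inr false :: Sum.inr true :: (L ++ [y]).map Sum.inl : List (D ⊕ Bool)).getLast? =
        some (Sum.inl y) := by
      rw [List.map_append, List.map_singleton]
      exact getLast?_append_concat [Sum.inr false, Sum.inr true] _ _
    rw [e, Option.mem_some_iff] at hx
    simp only [List.head?_cons, Option.mem_some_iff] at hz
    rw [← hx, ← hz, insertφ_self]

end Insert

/-! ### Reading words -/

variable {X V : Type}

/-- The word `w` can be read along a path from `u` to `v`. -/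
def Reads (Step : V → X × Bool → V → Prop) : V → List (X × Bool) → V → Prop
  | u, [], v => u = v
  | u, l :: w, v => ∃ u', Step u l u' ∧ Reads Step u' w v

theorem Reads.append {Step : V → X × Bool → V → Prop} {u v z : V} {w w' : List (X × Bool)}
    (h : Reads Step u w v) (h' : Reads Step v w' z) : Reads Step u (w ++ w') z := by
  induction w generalizing u with
  | nil => rw [show u = v from h]; exact h'
  | cons l w ih => obtain ⟨u', h1, h2⟩ := h; exact ⟨u', h1, ih h2⟩

theorem Reads.exists_pos {Step : V → X × Bool → V → Prop} {u v : V} {w : List (X × Bool)}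
    (h : Reads Step u w v) : ∃ pos : ℕ → V, pos 0 = u ∧ pos w.length = v ∧
      ∀ i (hi : i < w.length), Step (pos i) w[i] (pos (i + 1)) := by
  induction w generalizing u with
  | nil => exact ⟨fun _ => u, rfl, h, fun i hi => by simp at hi⟩
  | cons l w ih =>
    obtain ⟨u', h1, h2⟩ := h
    obtain ⟨pos, p1, p2, p3⟩ := ih h2
    refine ⟨fun i => match i with | 0 => u | i + 1 => pos i, rfl, p2, fun i hi => ?_⟩
    cases i with
    | zero => simpa [p1] using h1
    | succ i => exact p3 i (by simpa using hi)

theorem Reads.invRev {Step : V → X × Bool → V → Prop}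
    (hsymm : ∀ u l v, Step u l v → Step v (flipLetter l) u) {u v : V} {w : List (X × Bool)}
    (h : Reads Step u w v) : Reads Step v (FreeGroup.invRev w) u := by
  induction w generalizing u with
  | nil => exact (show u = v from h).symm
  | cons l w ih =>
    obtain ⟨u', h1, h2⟩ := h
    rw [FreeGroup.invRev_cons]
    exact (ih h2).append ⟨u, hsymm _ _ _ h1, rfl⟩

/-- If the label of a face can be read from `u` to `v`, the face lifts with a jump from `v` to
`u`. -/
theorem exists_lift {D : Type} [DecidableEq D] {φ : Perm D} {A : List D}
    (hf : IsFace φ A) (hn : A.Nodup) (hA : A ≠ []) {lab : D → X × Bool}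
    {Step : V → X × Bool → V → Prop} {u v : V} (h : Reads Step u (A.map lab) v) :
    ∃ p q : D → V, (∀ d ∈ A, Step (p d) (lab d) (q d)) ∧
      ∃ b ∈ A, q b = v ∧ p (φ b) = u ∧ ∀ d ∈ A, d ≠ b → q d = p (φ d) := by
  obtain ⟨pos, p1, p2, p3⟩ := h.exists_pos
  have hidx : ∀ i (hi : i < A.length), A.idxOf A[i] = i := fun i hi => hn.idxOf_getElem i hi
  refine ⟨fun d => pos (A.idxOf d), fun d => pos (A.idxOf d + 1), fun d hd => ?_,
    A.getLast hA, List.getLast_mem _, ?_, ?_, fun d hd hne => ?_⟩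
  · have := p3 (A.idxOf d) (by simpa using List.idxOf_lt_length_of_mem hd)
    simpa using this
  · have hpos := List.length_pos_of_ne_nil hA
    simp only [List.getLast_eq_getElem, hidx]
    rw [← p2, List.length_map]; congr 1; omega
  · have := hf.2 (A.getLast hA) (List.getLast_mem_getLast? _) (A.head hA) (List.head_mem_head? _)
    rw [this]
    simp only [List.head_eq_getElem, hidx, p1]
  · obtain ⟨i, hi, rfl⟩ := List.getElem_of_mem hd
    have hi' : i + 1 < A.length := by
      by_contra hcon
      apply hne
      rw [List.getLast_eq_getElem]; congr 1; omega
    have := List.isChain_iff_getElem.1 hf.1 i hi'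
    simp only [this, hidx]

/-! ### Diagrams with a free boundary -/

/-- A van Kampen diagram with boundary word `w`: a simply connected labelled map with a
distinguished face, the outer one, labelled `w`, all of whose other faces lift to the graph with
edges `Step`. -/
structure Diagram (Step : V → X × Bool → V → Prop) (w : List (X × Bool)) (D : Type) where
  /-- reversing a dart -/
  α : Perm D
  /-- the next dart on a face -/
  φ : Perm D
  inv : ∀ d, α (α d) = d
  ne : ∀ d, α d ≠ d
  simplyConn : SimplyConn α φ
  /-- the letter on a dart -/
  lab : D → X × Bool
  /-- the starting vertex of the lift of a dart; irrelevant on the outer face -/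
  p : D → V
  /-- the terminal vertex of the lift of a dart; irrelevant on the outer face -/
  q : D → V
  lab_inv : ∀ d, lab (α d) = flipLetter (lab d)
  /-- the darts of the outer face -/
  L : List D
  nodup : L.Nodup
  face : IsFace φ L
  map_lab : L.map lab = w
  step : ∀ d, d ∉ L → Step (p d) (lab d) (q d)
  cont : ∀ d, d ∉ L → q d = p (φ d)

/-- The non-empty word `w` is the boundary word of a finite van Kampen diagram. -/
def Bounds (Step : V → X × Bool → V → Prop) (w : List (X × Bool)) : Prop :=
  w ≠ [] ∧ ∃ (D : Type) (_ : Finite D), Nonempty (Diagram Step w D)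

section

variable {Step : V → X × Bool → V → Prop}

theorem Bounds.rotate {w w' : List (X × Bool)} (h : Bounds Step (w ++ w')) :
    Bounds Step (w' ++ w) := by
  obtain ⟨h0, D, hD, ⟨M⟩⟩ := h
  refine ⟨fun e => h0 (by simp at e ⊢; exact e.symm), D, hD, ?_⟩
  obtain ⟨A, B, hL, hA, hB⟩ := List.map_eq_append_iff.1 M.map_lab
  exact ⟨{ M with
    L := B ++ A
    nodup := List.nodup_append_comm.1 (hL ▸ M.nodup)
    face := IsFace.rotate (hL ▸ M.face)
    map_lab := by rw [List.map_append, hA, hB]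
    step := fun d hd => M.step d (by rw [hL]; simp at hd ⊢; tauto)
    cont := fun d hd => M.cont d (by rw [hL]; simp at hd ⊢; tauto) }⟩

theorem Bounds.pair [Nonempty V] (l : X × Bool) : Bounds Step [l, flipLetter l] := by
  obtain ⟨v⟩ := ‹Nonempty V›
  refine ⟨by simp, Bool, inferInstance, ⟨{
    α := swap false true
    φ := swap false true
    inv := by simp
    ne := by simp
    simplyConn := fun h _ => ⟨h, fun _ => rfl, fun _ => rfl⟩
    lab := fun b => if b then flipLetter l else l
    p := fun _ => v
    q := fun _ => v
    lab_inv := by simp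
    L := [false, true]
    nodup := by simp
    face := by simp [IsFace]
    map_lab := by simp
    step := by simp
    cont := by simp }⟩⟩

/-- A new edge with a free end is attached at the base point of the outer face. -/
theorem Bounds.insert {w : List (X × Bool)} (h : Bounds Step w) (l : X × Bool) :
    Bounds Step (l :: flipLetter l :: w) := by
  classical
  obtain ⟨h0, D, hD, ⟨M⟩⟩ := h
  have hL : M.L ≠ [] := fun e => h0 (by rw [← M.map_lab, e]; rfl)
  obtain ⟨L, y, hy⟩ := (M.L.eq_nil_or_concat').resolve_left hL
  have hmem : ∀ d, d ∈ M.L ↔ d ∈ L ∨ d = y := by simp [hy]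
  refine ⟨by simp, D ⊕ Bool, inferInstance, ⟨{
    α := insertα M.α
    φ := insertφ M.φ y
    inv := by rintro (x | _ | _) <;> simp [insertα, M.inv]
    ne := by rintro (x | _ | _) <;> simp [insertα, M.ne]
    simplyConn := M.simplyConn.insert y
    lab := Sum.elim M.lab (fun b => if b then flipLetter l else l)
    p := Sum.elim M.p (fun _ => M.p y)
    q := Sum.elim M.q (fun _ => M.q y)
    lab_inv := by rintro (x | _ | _) <;> simp [insertα, M.lab_inv]
    L := Sum.inr false :: Sum.inr true :: (L ++ [y]).map Sum.inl
    nodup := ?_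
    face := IsFace.insert y (hy ▸ M.face) (hy ▸ M.nodup)
    map_lab := ?_
    step := ?_
    cont := ?_ }⟩⟩
  · have : ((L ++ [y]).map (Sum.inl : D → D ⊕ Bool)).Nodup :=
      List.Nodup.map Sum.inl_injective (hy ▸ M.nodup)
    simp only [List.nodup_cons, this, and_true]
    simp
  · have := M.map_lab
    rw [hy] at this
    simpa [List.map_map, Function.comp_def] using this
  · rintro (x | _ | _) hx
    · exact M.step x (by rw [hmem]; simpa using hx)
    · simp at hx
    · simp at hx
  · rintro (x | _ | _) hx
    · have hx' : x ∉ M.L := by rw [hmem]; simpa using hx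
      rw [insertφ_of_ne _ _ (by rintro rfl; simp [hmem] at hx')]
      exact M.cont x hx'
    · simp at hx
    · simp at hx

theorem Bounds.insert_word {w : List (X × Bool)} (h : Bounds Step w) (c : List (X × Bool)) :
    Bounds Step (c ++ (FreeGroup.invRev c ++ w)) := by
  induction c generalizing w with
  | nil => simpa using h
  | cons l c ih =>
    have h1 : Bounds Step ([l] ++ (flipLetter l :: w)) := h.insert l
    have h2 : Bounds Step ((c ++ (FreeGroup.invRev c ++ (flipLetter l :: w))) ++ [l]) := by
      simpa using ih h1.rotate
    have := h2.rotate
    rw [FreeGroup.invRev_cons]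
    simpa [FreeGroup.invRev, flipLetter] using this

theorem Bounds.conj {w : List (X × Bool)} (h : Bounds Step w) (c : List (X × Bool)) :
    Bounds Step (c ++ (w ++ FreeGroup.invRev c)) := by
  have := h.insert_word (FreeGroup.invRev c)
  rw [FreeGroup.invRev_invRev] at this
  simpa using this.rotate

/-- The outer face is cut into two faces, labelled by two complementary parts of its label. -/
theorem Diagram.split {c w : List (X × Bool)} {D : Type} (M : Diagram Step (c ++ w) D)
    (hc : c ≠ []) (hw : w ≠ []) : ∃ (φ : Perm D) (A B : List D), SimplyConn M.α φ ∧
      IsFace φ A ∧ IsFace φ B ∧ A.Nodup ∧ B.Nodup ∧ List.Disjoint A B ∧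
      A.map M.lab = c ∧ B.map M.lab = w ∧
      (∀ d, d ∉ A → d ∉ B → Step (M.p d) (M.lab d) (M.q d) ∧ M.q d = M.p (φ d) ∧
        φ d ∉ A ∧ φ d ∉ B) := by
  classical
  obtain ⟨A, B, hL, hA, hB⟩ := List.map_eq_append_iff.1 M.map_lab
  obtain ⟨A', a, rfl⟩ := (A.eq_nil_or_concat').resolve_left
    (by rintro rfl; exact hc (by simpa using hA.symm))
  obtain ⟨B', b, rfl⟩ := (B.eq_nil_or_concat').resolve_left
    (by rintro rfl; exact hw (by simpa using hB.symm))
  have hn := hL ▸ M.nodup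
  have hf := hL ▸ M.face
  refine ⟨M.φ * swap a b, A' ++ [a], B' ++ [b], M.simplyConn.split hf hn, (hf.split hn).1,
    (hf.split hn).2, (List.nodup_append.1 hn).1, (List.nodup_append.1 hn).2.1,
    List.disjoint_of_nodup_append hn, hA, hB, fun d dA dB => ?_⟩
  have hd : d ∉ M.L := by rw [hL, List.mem_append]; tauto
  have hφ : (M.φ * swap a b) d = M.φ d := by
    rw [Perm.mul_apply, swap_apply_of_ne_of_ne]
    · rintro rfl; simp at dA
    · rintro rfl; simp at dB
  have h1 : M.φ d ∉ M.L := by rw [M.face.apply_mem_iff]; exact hd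
  rw [hL, List.mem_append] at h1
  rw [hφ]
  exact ⟨M.step d hd, M.cont d hd, fun h => h1 (Or.inl h), fun h => h1 (Or.inr h)⟩

/-- A part of the boundary word that labels a closed path of the graph is cut off as a new inner
face. -/
theorem Bounds.cut {c w : List (X × Bool)} (h : Bounds Step (c ++ w)) (hw : w ≠ [])
    {u : V} (hc : Reads Step u c u) : Bounds Step w := by
  classical
  by_cases hc0 : c = []
  · subst hc0; exact h
  obtain ⟨-, D, hD, ⟨M⟩⟩ := h
  obtain ⟨φ, A, B, hs, fA, fB, nA, nB, dAB, hA, hB, hM⟩ := M.split hc0 hw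
  obtain ⟨p, q, h1, b, hb, h2, h3, h4⟩ := exists_lift fA nA (by rintro rfl; exact hc0 hA.symm)
    (lab := M.lab) (by rw [hA]; exact hc)
  refine ⟨hw, D, hD, ⟨{
    α := M.α, φ := φ, inv := M.inv, ne := M.ne, simplyConn := hs, lab := M.lab
    p := fun d => if d ∈ A then p d else M.p d
    q := fun d => if d ∈ A then q d else M.q d
    lab_inv := M.lab_inv, L := B, nodup := nB, face := fB, map_lab := hB
    step := fun d hd => ?_
    cont := fun d hd => ?_ }⟩⟩
  · split_ifs with hA
    · exact h1 d hA
    · exact (hM d hA hd).1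
  · simp only [fA.apply_mem_iff]
    split_ifs with hA
    · by_cases hdb : d = b
      · rw [hdb, h2, h3]
      · exact h4 d hA hdb
    · exact (hM d hA hd).2.1

/-! ### Paths with trivial labels -/

/-- The disjoint union of a graph with the Cayley tree of the free group. The tree has no reduced
closed paths, but words that are trivial in the free group label closed paths of it. -/
def withTree (Step : V → X × Bool → V → Prop) :
    V ⊕ FreeGroup X → X × Bool → V ⊕ FreeGroup X → Prop
  | .inl u, l, .inl v => Step u l v
  | .inr g, l, .inr h => h = g * FreeGroup.mk [l]
  | _, _, _ => False

theorem mk_flip (l : X × Bool) : FreeGroup.mk [flipLetter l] = (FreeGroup.mk [l])⁻¹ := by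
  rw [FreeGroup.inv_mk]; rfl

theorem mk_cons (l : X × Bool) (w : List (X × Bool)) :
    FreeGroup.mk (l :: w) = FreeGroup.mk [l] * FreeGroup.mk w := by
  rw [FreeGroup.mul_mk]; rfl

theorem withTree_symm (hsymm : ∀ u l v, Step u l v → Step v (flipLetter l) u) :
    ∀ u l v, withTree Step u l v → withTree Step v (flipLetter l) u := by
  rintro (u | g) l (v | h) H
  · exact hsymm _ _ _ H
  · exact H
  · exact H
  · have H : h = g * FreeGroup.mk [l] := H
    show g = h * FreeGroup.mk [flipLetter l]
    rw [H, mk_flip]; group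

theorem withTree_det (hdet : ∀ u l v v', Step u l v → Step u l v' → v = v') :
    ∀ u l v v', withTree Step u l v → withTree Step u l v' → v = v' := by
  rintro (u | g) l (v | h) (v' | h') H H'
  all_goals first | exact H.elim | exact H'.elim | skip
  · exact congrArg _ (hdet _ _ _ _ H H')
  · exact congrArg _ (Eq.trans H (Eq.symm H'))

theorem reads_tree (g : FreeGroup X) (w : List (X × Bool)) :
    Reads (withTree Step) (.inr g) w (.inr (g * FreeGroup.mk w)) := by
  induction w generalizing g with
  | nil => show Sum.inr g = Sum.inr _; rw [← FreeGroup.one_eq_mk, mul_one]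
  | cons l w ih =>
    refine ⟨.inr (g * FreeGroup.mk [l]), rfl, ?_⟩
    rw [mk_cons l w, ← mul_assoc]
    exact ih _

theorem Reads.inl {u v : V} {w : List (X × Bool)} (h : Reads Step u w v) :
    Reads (withTree Step) (.inl u) w (.inl v) := by
  induction w generalizing u with
  | nil => exact congrArg _ h
  | cons l w ih => obtain ⟨u', h1, h2⟩ := h; exact ⟨.inl u', h1, ih h2⟩

/-- The labels of the closed paths, reduced or not. -/
def closedLabels (Step : V → X × Bool → V → Prop) : Set (FreeGroup X) :=
  {g | ∃ u w, Reads Step u w u ∧ g = FreeGroup.mk w}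

/-- Van Kampen's lemma: a consequence of the labels of the closed paths is represented by the
boundary word of a diagram. -/
theorem exists_bounds (hsymm : ∀ u l v, Step u l v → Step v (flipLetter l) u) [Nonempty V] (x : X)
    {g : FreeGroup X} (hg : g ∈ Subgroup.normalClosure (closedLabels Step)) :
    ∃ w, Bounds Step w ∧ FreeGroup.mk w = g := by
  have key : ∀ (c : FreeGroup X) (u : V) (r : List (X × Bool)), Reads Step u r u →
      ∀ g, (∃ w, Bounds Step w ∧ FreeGroup.mk w = g) →
      ∃ w, Bounds Step w ∧ FreeGroup.mk w = c * FreeGroup.mk r * c⁻¹ * g := by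
    rintro c u r hr _ ⟨w, hw, rfl⟩
    obtain ⟨C, rfl⟩ := Quot.exists_rep c
    rw [FreeGroup.quot_mk_eq_mk]
    have h1 := hw.conj (FreeGroup.invRev C)
    rw [FreeGroup.invRev_invRev] at h1
    have h2 := h1.insert_word (FreeGroup.invRev r)
    rw [FreeGroup.invRev_invRev] at h2
    have h3 := (h2.cut (by intro e; apply h1.1; simp only [List.append_eq_nil_iff] at e ⊢; tauto)
      (hr.invRev hsymm)).conj C
    refine ⟨_, h3, ?_⟩
    simp only [← FreeGroup.mul_mk, ← FreeGroup.inv_mk]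
    group
  induction hg using Subgroup.closure_induction_left with
  | one =>
    refine ⟨_, Bounds.pair (x, true), ?_⟩
    rw [mk_cons, mk_flip]; group
  | mul_left y hy g hg ih =>
    obtain ⟨c, ⟨u, r, hr, rfl⟩, hc⟩ := Group.mem_conjugatesOfSet_iff.1 hy
    obtain ⟨d, rfl⟩ := isConj_iff.1 hc
    exact key d u r hr g ih
  | inv_mul_cancel y hy g hg ih =>
    obtain ⟨c, ⟨u, r, hr, rfl⟩, hc⟩ := Group.mem_conjugatesOfSet_iff.1 hy
    obtain ⟨d, rfl⟩ := isConj_iff.1 hc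
    have := key d u _ (hr.invRev hsymm) g ih
    rw [← FreeGroup.inv_mk] at this
    convert this using 3
    group

/-- If the boundary word of a diagram consists of the label `c` of a path from `u` to `v` and of a
freely trivial word, the outer face can be cut into two faces, the first of which lifts to the graph
with a jump and the second of which lifts to the tree. -/
theorem exists_brokenMap {u v : V} {c w : List (X × Bool)} (hc : c ≠ []) (hw : w ≠ [])
    (hcw : FreeGroup.mk w = 1) (hr : Reads Step u c v) (hb : Bounds Step (c ++ w)) :
    ∃ (D : Type) (_ : Finite D),
      Nonempty (BrokenMap (withTree Step) (.inl v : V ⊕ FreeGroup X) (.inl u) D) := by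
  classical
  obtain ⟨-, D, hD, ⟨M⟩⟩ := hb
  obtain ⟨φ, A, B, hs, fA, fB, nA, nB, dAB, hA, hB, hM⟩ := M.split hc hw
  obtain ⟨p, q, h1, b, hb, h2, h3, h4⟩ := exists_lift fA nA (by rintro rfl; exact hc hA.symm)
    (lab := M.lab) (by rw [hA]; exact hr.inl)
  obtain ⟨p', q', k1, b', hb', k2, k3, k4⟩ := exists_lift fB nB (by rintro rfl; exact hw hB.symm)
    (lab := M.lab) (by rw [hB]; exact reads_tree (Step := Step) 1 w)
  rw [hcw, mul_one] at k2
  refine ⟨D, hD, ⟨{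
    α := M.α, φ := φ, inv := M.inv, ne := M.ne, simplyConn := hs, lab := M.lab
    p := fun d => if d ∈ A then p d else if d ∈ B then p' d else .inl (M.p d)
    q := fun d => if d ∈ A then q d else if d ∈ B then q' d else .inl (M.q d)
    lab_inv := M.lab_inv
    step := fun d => ?_
    b := b
    cont := fun d hd => ?_
    hu := by simp [hb, h2]
    hv := by simp [fA.apply_mem_iff, hb, h3] }⟩⟩
  · split_ifs with dA dB
    · exact h1 d dA
    · exact k1 d dB
    · exact (hM d dA dB).1
  · simp only [fA.apply_mem_iff, fB.apply_mem_iff]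
    split_ifs with dA dB
    · exact h4 d dA hd
    · by_cases hdb : d = b'
      · rw [hdb, k2, k3]
      · exact k4 d dB hdb
    · rw [(hM d dA dB).2.1]

theorem mk_ne_one_of_reduced {N : ℕ} (hN : 0 < N) (l : ℕ → X × Bool)
    (hl : ∀ i, l (i + 1) ≠ flipLetter (l i)) : FreeGroup.mk ((List.range N).map l) ≠ 1 := by
  classical
  intro h
  have hred : FreeGroup.IsReduced ((List.range N).map l) := by
    rw [FreeGroup.IsReduced, List.isChain_iff_getElem]
    intro i hi
    simp only [List.getElem_map, List.getElem_range]
    intro h1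
    by_contra h2
    apply hl i
    refine Prod.ext h1.symm ?_
    simp only [flipLetter]
    cases h3 : (l i).2 <;> cases h4 : (l (i + 1)).2 <;> simp_all
  have := hred.reduce_eq
  rw [← FreeGroup.toWord_mk, h, FreeGroup.toWord_one] at this
  have := congrArg List.length this
  simp at this
  omega

/-- Without spurs no face lifts to the tree, because along it a reduced word would be read around a
closed path. -/
theorem BrokenMap.p_isLeft {u v : V} {D : Type} [Finite D]
    (M : BrokenMap (withTree Step) (.inl u : V ⊕ FreeGroup X) (.inl v) D)
    (hs : ∀ d, ¬ M.Spur d) (d : D) :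
    ∃ a b, M.p d = .inl a ∧ M.q d = .inl b := by
  classical
  have side : ∀ d a, M.p d = .inl a → ∃ b, M.q d = .inl b := fun d a h => by
    have := M.step d
    rw [h] at this
    rcases hq : M.q d with b | b
    · exact ⟨b, rfl⟩
    · rw [hq] at this; exact this.elim
  suffices ∃ a, M.p d = .inl a by
    obtain ⟨a, h⟩ := this
    obtain ⟨b, h'⟩ := side d a h
    exact ⟨a, b, h, h'⟩
  by_cases hd : M.φ.SameCycle (M.φ M.b) d
  · obtain ⟨n, rfl⟩ := hd.exists_nat_pow_eq
    clear hd
    induction n with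
    | zero => exact ⟨_, M.hv⟩
    | succ n ih =>
      rw [pow_succ', Perm.mul_apply]
      obtain ⟨a, ha⟩ := ih
      by_cases hb : (M.φ ^ n) (M.φ M.b) = M.b
      · exact ⟨v, by rw [hb, M.hv]⟩
      · obtain ⟨b, hb'⟩ := side _ a ha
        exact ⟨b, by rw [← M.cont _ hb, hb']⟩
  · by_contra hcon
    set x : ℕ → D := fun i => (M.φ ^ i) d with hx
    have hxb : ∀ i, x i ≠ M.b := fun i h => hd (by
      rw [Perm.sameCycle_apply_left, ← h]
      exact Perm.SameCycle.symm ⟨i, by simp [hx]⟩)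
    have hx1 : ∀ i, M.φ (x i) = x (i + 1) := fun i => by
      simp only [hx, pow_succ', Perm.mul_apply]
    have tree : ∀ i, ∃ g : FreeGroup X, M.p (x 0) = .inr g ∧
        M.p (x i) = .inr (g * FreeGroup.mk ((List.range i).map fun j => M.lab (x j))) := by
      intro i
      induction i with
      | zero =>
        rcases h : M.p d with a | g
        · exact absurd ⟨a, h⟩ hcon
        · exact ⟨g, by simpa [hx] using h, by simpa [hx, ← FreeGroup.one_eq_mk] using h⟩
      | succ i ih =>
        obtain ⟨g, h0, h⟩ := ih
        refine ⟨g, h0, ?_⟩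
        have := M.step (x i)
        rw [h, M.cont _ (hxb i), hx1] at this
        rcases hq : M.p (x (i + 1)) with b | b
        · rw [hq] at this; exact this.elim
        · rw [hq] at this
          have this : b = _ * _ := this
          rw [this, List.range_succ, List.map_append, ← FreeGroup.mul_mk, mul_assoc]; rfl
    have hpos : 0 < orderOf M.φ := orderOf_pos _
    obtain ⟨g, h0, h⟩ := tree (orderOf M.φ)
    have : x (orderOf M.φ) = x 0 := by simp [hx, pow_orderOf_eq_one]
    rw [this, h0, Sum.inr.injEq, left_eq_mul] at h
    refine mk_ne_one_of_reduced hpos (fun j => M.lab (x j)) (fun i hi => ?_) h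
    exact hs (x i) ⟨hxb i, by rw [hx1]; exact hi⟩

/-- In a folded graph with small cancellation, a path is closed if its label is trivial modulo the
labels of the closed paths. -/
theorem eq_of_mem_normalClosure (hsymm : ∀ u l v, Step u l v → Step v (flipLetter l) u)
    (hdet : ∀ u l v v', Step u l v → Step u l v' → v = v') (hSC : SmallCancellation Step)
    {u v : V} {w : List (X × Bool)} (hr : Reads Step u w v)
    (hw : FreeGroup.mk w ∈ Subgroup.normalClosure (closedLabels Step)) : u = v := by
  by_contra huv
  have hw0 : w ≠ [] := by rintro rfl; exact huv hr
  have : Nonempty V := ⟨u⟩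
  obtain ⟨l, -⟩ := List.exists_mem_of_ne_nil w hw0
  obtain ⟨w', hw', he⟩ := exists_bounds hsymm l.1 hw
  obtain ⟨D, hD, ⟨M⟩⟩ := exists_brokenMap (w := FreeGroup.invRev w ++ w') hw0
    (by intro e; exact hw'.1 (List.append_eq_nil_iff.1 e).2)
    (by rw [← FreeGroup.mul_mk, ← FreeGroup.inv_mk, he]; group) hr (hw'.insert_word w)
  have huv' : (.inl v : V ⊕ FreeGroup X) ≠ .inl u := fun h => huv (Sum.inl.inj h).symm
  obtain ⟨D', hD', M', hb, hs⟩ := BrokenMap.exists_irreducible (withTree_symm hsymm)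
    (withTree_det hdet) huv' _ D rfl M
  choose p q hp hq using M'.p_isLeft hs
  have hstep : ∀ d, Step (p d) (M'.lab d) (q d) := fun d => by
    have := M'.step d
    rwa [hp, hq] at this
  exact BrokenMap.false_of_irreducible (Step := Step) (u := v) (v := u) hsymm hSC
    { α := M'.α, φ := M'.φ, inv := M'.inv, ne := M'.ne, simplyConn := M'.simplyConn, lab := M'.lab
      p := p, q := q, lab_inv := M'.lab_inv, step := hstep, b := M'.b
      cont := fun d hd => by
        have := M'.cont d hd
        rwa [hp, hq, Sum.inl.injEq] at this
      hu := by have := M'.hu; rwa [hq, Sum.inl.injEq] at this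
      hv := by have := M'.hv; rwa [hp, Sum.inl.injEq] at this }
    (fun d h => hb d (by rw [BrokenMap.Bad, hp, hq]; exact congrArg _ h))
    (fun d h => hs d h)

end

/-! ### Graphs made of lines -/

/-- The inverse of a reduced closed path. -/
theorem IsPeriodicPath.reverse {X V : Type} {Step : V → X × Bool → V → Prop}
    (hsymm : ∀ u l v, Step u l v → Step v (flipLetter l) u) {v : ℤ → V} {l : ℤ → X × Bool} {N : ℤ}
    (h : IsPeriodicPath Step v l N) :
    IsPeriodicPath Step (fun i => v (-i)) (fun i => flipLetter (l (-i - 1))) N where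
  pos := h.pos
  step i := by
    have := hsymm _ _ _ (h.step (-i - 1))
    rw [show -i - 1 + 1 = -i by ring] at this
    rwa [show -(i + 1) = -i - 1 by ring]
  vper i := by
    have := h.vper (-(i + N))
    rw [show -(i + N) + N = -i by ring] at this
    exact this.symm
  lper i := by
    have := h.lper (-(i + N) - 1)
    rw [show -(i + N) - 1 + N = -i - 1 by ring] at this
    rw [this]
  red i hi := by
    have := h.red (-(i + 1) - 1)
    rw [show -(i + 1) - 1 + 1 = -i - 1 by ring] at this
    rw [flipLetter_flipLetter] at hi
    exact this hi.symm

theorem IsRigidFamily.of_reverse {X V : Type} {Step : V → X × Bool → V → Prop}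
    (hsymm : ∀ u l v, Step u l v → Step v (flipLetter l) u)
    (hdet : ∀ u l v v', Step u l v → Step u l v' → v = v')
    {v : ℤ → V} {l : ℤ → X × Bool} {N : ℤ}
    (hp : IsPeriodicPath Step v l N) {s t : ℕ → ℤ}
    (h : IsRigidFamily Step (fun i => v (-i)) (fun i => flipLetter (l (-i - 1))) N s t) :
    IsRigidFamily Step v l N (fun k => -t (6 - k) - 1) (fun k => -s (6 - k) - 1) where
  lt k hk := by have := h.lt (6 - k) (by omega); omega
  le k hk := by
    have := h.le (6 - (k + 1)) (by omega)
    rw [show 6 - (k + 1) + 1 = 6 - k by omega] at this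
    omega
  last := by have := h.last; simp; omega
  rigid k hk w hw := by
    have h1 := h.rigid (6 - k) (by omega) (fun i => w (-i)) (fun i h1 h2 => by
      have := hsymm _ _ _ (hw (-i - 1) (by omega) (by omega))
      rw [show -i - 1 + 1 = -i by ring] at this
      rwa [show -(i + 1) = -i - 1 by ring])
    have h2 := h.lt (6 - k) (by omega)
    have back : ∀ n : ℕ, ∀ i, i = -s (6 - k) - n → -t (6 - k) - 1 ≤ i → w i = v i := by
      intro n
      induction n with
      | zero => intro i hi _; rw [hi]; simpa using h1
      | succ n ih =>
        intro i hi hi'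
        have h3 := ih (i + 1) (by rw [hi]; push_cast; ring) (by omega)
        have h4 := hsymm _ _ _ (hw i hi' (by rw [hi]; push_cast; omega))
        have h5 := hsymm _ _ _ (hp.step i)
        rw [h3] at h4
        exact hdet _ _ _ _ h4 h5
    exact back (t (6 - k) + 1 - s (6 - k)).toNat _ (by omega) le_rfl

/-- A labelled graph with vertices `Λ × ℤ`, consisting of the lines `{L} × ℤ`, whose edges are
labelled by the letter `a`, and of further edges `Ed` with other labels. -/
structure LineGraph (X Λ Ed : Type) where
  /-- the letter on the lines -/
  a : X
  /-- starting vertices of the other edges -/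
  src : Ed → Λ × ℤ
  /-- terminal vertices of the other edges -/
  tgt : Ed → Λ × ℤ
  /-- letters on the other edges -/
  letter : Ed → X × Bool
  letter_ne : ∀ e, (letter e).1 ≠ a

namespace LineGraph

variable {X Λ Ed : Type} (G : LineGraph X Λ Ed)

/-- Starting vertex of an oriented edge; `(e, false)` is `e` travelled backwards. -/
def dsrc (δ : Ed × Bool) : Λ × ℤ := if δ.2 then G.src δ.1 else G.tgt δ.1

/-- Terminal vertex of an oriented edge. -/
def dtgt (δ : Ed × Bool) : Λ × ℤ := if δ.2 then G.tgt δ.1 else G.src δ.1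

/-- Letter of an oriented edge. -/
def dlet (δ : Ed × Bool) : X × Bool := if δ.2 then G.letter δ.1 else flipLetter (G.letter δ.1)

@[simp] theorem dsrc_flip (δ : Ed × Bool) : G.dsrc (flipLetter δ) = G.dtgt δ := by
  rcases δ with ⟨e, _ | _⟩ <;> rfl

@[simp] theorem dtgt_flip (δ : Ed × Bool) : G.dtgt (flipLetter δ) = G.dsrc δ := by
  rcases δ with ⟨e, _ | _⟩ <;> rfl

@[simp] theorem dlet_flip (δ : Ed × Bool) : G.dlet (flipLetter δ) = flipLetter (G.dlet δ) := by
  rcases δ with ⟨e, _ | _⟩ <;> simp [dlet, flipLetter]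

theorem dlet_ne (δ : Ed × Bool) : (G.dlet δ).1 ≠ G.a := by
  rcases δ with ⟨e, _ | _⟩ <;> simp [dlet, flipLetter, G.letter_ne]

/-- The exponent of a letter. -/
def sgn (l : X × Bool) : ℤ := if l.2 then 1 else -1

theorem sgn_flip (l : X × Bool) : sgn (flipLetter l) = -sgn l := by
  rcases l with ⟨x, _ | _⟩ <;> simp [sgn, flipLetter]

/-- The edges of the graph, those on the lines included. -/
def Step (u : Λ × ℤ) (l : X × Bool) (v : Λ × ℤ) : Prop :=
  (l.1 = G.a ∧ v = (u.1, u.2 + sgn l)) ∨ ∃ δ, G.dlet δ = l ∧ G.dsrc δ = u ∧ G.dtgt δ = v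

/-- No two edges other than those on the lines can be folded; for the lines this is automatic. -/
def Folded : Prop := ∀ δ ε, G.dlet δ = G.dlet ε → G.dsrc δ = G.dsrc ε → δ = ε

theorem step_symm (u : Λ × ℤ) (l : X × Bool) (v : Λ × ℤ) (h : G.Step u l v) :
    G.Step v (flipLetter l) u := by
  rcases h with ⟨h1, rfl⟩ | ⟨δ, rfl, rfl, rfl⟩
  · exact Or.inl ⟨h1, by rw [sgn_flip]; ext <;> simp⟩
  · exact Or.inr ⟨flipLetter δ, by simp, by simp, by simp⟩

variable {G}

theorem step_a {u v : Λ × ℤ} {l : X × Bool} (hl : l.1 = G.a) (h : G.Step u l v) :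
    v = (u.1, u.2 + sgn l) := by
  rcases h with ⟨-, h⟩ | ⟨δ, rfl, -⟩
  · exact h
  · exact absurd hl (G.dlet_ne δ)

theorem step_ne {u v : Λ × ℤ} {l : X × Bool} (hl : l.1 ≠ G.a) (h : G.Step u l v) :
    ∃ δ, G.dlet δ = l ∧ G.dsrc δ = u ∧ G.dtgt δ = v := by
  rcases h with ⟨h, -⟩ | h
  · exact absurd h hl
  · exact h

theorem step_det (hG : G.Folded) (u : Λ × ℤ) (l : X × Bool) (v v' : Λ × ℤ) (h : G.Step u l v)
    (h' : G.Step u l v') : v = v' := by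
  by_cases hl : l.1 = G.a
  · rw [step_a hl h, step_a hl h']
  · obtain ⟨δ, h1, h2, rfl⟩ := step_ne hl h
    obtain ⟨ε, h3, h4, rfl⟩ := step_ne hl h'
    rw [hG δ ε (h1.trans h3.symm) (h2.trans h4.symm)]

variable (G) in
/-- Distinct pairs of ends of edges labelled `b` on the lines are at distinct distances: the
(oriented) distance from the end of `δ` to the start of `δ'`, if non-zero, determines its initial
point. -/
def Sidon (b : X) : Prop := ∀ δ δ' ε ε', (G.dlet δ).1 = b → (G.dlet δ').1 = b →
  (G.dlet ε).1 = b → (G.dlet ε').1 = b →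
  (G.dtgt δ).1 = (G.dsrc δ').1 → (G.dtgt ε).1 = (G.dsrc ε').1 →
  (G.dtgt δ).2 ≠ (G.dsrc δ').2 →
  (G.dsrc δ').2 - (G.dtgt δ).2 = (G.dsrc ε').2 - (G.dtgt ε).2 → G.dtgt δ = G.dtgt ε

variable (G) in
/-- The path takes the edge `δ` at time `z`. -/
def At (v : ℤ → Λ × ℤ) (l : ℤ → X × Bool) (z : ℤ) (δ : Ed × Bool) : Prop :=
  G.dsrc δ = v z ∧ G.dlet δ = l z ∧ G.dtgt δ = v (z + 1)

variable {v : ℤ → Λ × ℤ} {l : ℤ → X × Bool} {N : ℤ}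

/-- Between two edges outside the lines a reduced path repeats one letter `a` or `a⁻¹`. -/
theorem run_eq {l : ℤ → X × Bool} {z z' : ℤ} (hl : ∀ x, z < x → x < z' → (l x).1 = G.a)
    (hred : ∀ i, l (i + 1) ≠ flipLetter (l i)) (x : ℕ) (h : z + 1 + x < z') :
    l (z + 1 + x) = l (z + 1) := by
  induction x with
  | zero => simp
  | succ x ih =>
    have h1 := ih (by push_cast at h; omega)
    have h2 := hred (z + 1 + x)
    have h3 := hl (z + 1 + x) (by omega) (by push_cast at h; omega)
    have h4 := hl (z + 1 + (x + 1 : ℕ)) (by omega) h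
    rw [show z + 1 + ((x + 1 : ℕ) : ℤ) = z + 1 + x + 1 by push_cast; ring] at h4 ⊢
    rw [← h1]
    refine Prod.ext (h4.trans h3.symm) ?_
    by_contra h5
    exact h2 (Prod.ext (h4.trans h3.symm) (by
      simp only [flipLetter]; cases h6 : (l (z + 1 + x)).2 <;> simp_all))

theorem run_pos {v : ℤ → Λ × ℤ} {l : ℤ → X × Bool} {z z' : ℤ}
    (hl : ∀ x, z < x → x < z' → (l x).1 = G.a) (hred : ∀ i, l (i + 1) ≠ flipLetter (l i))
    (hstep : ∀ i, z < i → i < z' → G.Step (v i) (l i) (v (i + 1)))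
    (x : ℕ) (h : z + 1 + x ≤ z') :
    v (z + 1 + x) = ((v (z + 1)).1, (v (z + 1)).2 + x * sgn (l (z + 1))) := by
  induction x with
  | zero => simp
  | succ x ih =>
    have h1 := ih (by push_cast at h; omega)
    have h2 := hstep (z + 1 + x) (by omega) (by push_cast at h; omega)
    have h3 := step_a (hl _ (by omega) (by push_cast at h; omega)) h2
    rw [show z + 1 + ((x + 1 : ℕ) : ℤ) = z + 1 + x + 1 by push_cast; ring, h3, h1,
      run_eq hl hred x (by push_cast at h; omega)]
    ext
    · rfl
    · push_cast; ring

theorem exists_at (hp : IsPeriodicPath G.Step v l N) : ∃ z δ, G.At v l z δ := by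
  by_contra hcon
  have hl : ∀ z, (l z).1 = G.a := by
    intro z
    by_contra h
    obtain ⟨δ, h1, h2, h3⟩ := step_ne h (hp.step z)
    exact hcon ⟨z, δ, h2, h1, h3⟩
  have h1 := run_pos (G := G) (z := -1) (z' := N) (fun x _ _ => hl x) hp.red
    (fun i _ _ => hp.step i)
    N.toNat (by have := hp.pos; omega)
  have h2 := hp.vper 0
  have h3 : ((N.toNat : ℕ) : ℤ) = N := Int.toNat_of_nonneg hp.pos.le
  rw [h3] at h1
  simp only [neg_add_cancel, zero_add] at h1 h2
  rw [h2] at h1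
  have h4 := congrArg Prod.snd h1
  have := hp.pos
  simp only [sgn] at h4
  split_ifs at h4 <;> omega

variable (G) in
/-- `δ'`, taken at time `z'`, is the next edge outside the lines that a reduced path takes after the
edge `δ` at time `z`. If both are labelled `b` and a non-trivial power of `a` is read between them,
this part of the path is rigid. -/
def Follows (b : X) (v : ℤ → Λ × ℤ) (l : ℤ → X × Bool) (z : ℤ) (δ : Ed × Bool) (z' : ℤ)
    (δ' : Ed × Bool) : Prop :=
  z < z' ∧ (∀ x, z < x → x < z' → (l x).1 = G.a) ∧ (G.dtgt δ).1 = (G.dsrc δ').1 ∧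
    δ' ≠ flipLetter δ ∧
    ((G.dlet δ).1 = b → (G.dlet δ').1 = b → (G.dtgt δ).2 ≠ (G.dsrc δ').2 → Rigid G.Step v l z z')

theorem exists_follows {b : X} (hG : G.Folded) (hS : G.Sidon b) (hp : IsPeriodicPath G.Step v l N)
    {z : ℤ} {δ : Ed × Bool} (h : G.At v l z δ) :
    ∃ z' δ', G.At v l z' δ' ∧ G.Follows b v l z δ z' δ' := by
  obtain ⟨h1, h2, h3⟩ := h
  have hex : ∃ n : ℕ, (l (z + 1 + n)).1 ≠ G.a := ⟨(N - 1).toNat, by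
    have := hp.pos
    rw [Int.toNat_of_nonneg (by omega), show z + 1 + (N - 1) = z + N by ring, hp.lper, ← h2]
    exact G.dlet_ne δ⟩
  classical
  obtain ⟨n, hn, hmin⟩ : ∃ n : ℕ, (l (z + 1 + n)).1 ≠ G.a ∧ ∀ m < n, (l (z + 1 + m)).1 = G.a :=
    ⟨Nat.find hex, Nat.find_spec hex, fun m hm => by simpa using Nat.find_min hex hm⟩
  obtain ⟨δ', k1, k2, k3⟩ := step_ne hn (hp.step _)
  have hrun : ∀ x, z < x → x < z + 1 + n → (l x).1 = G.a := fun x hx hx' => by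
    have := hmin (x - z - 1).toNat (by omega)
    rwa [Int.toNat_of_nonneg (by omega), show z + 1 + (x - z - 1) = x by ring] at this
  have hpos := run_pos (G := G) hrun hp.red (fun i _ _ => hp.step i) n le_rfl
  refine ⟨z + 1 + n, δ', ⟨k2, k1, k3⟩, by omega, hrun, ?_, ?_, ?_⟩
  · rw [h3, k2, hpos]
  · rintro rfl
    rw [dsrc_flip, h3, hpos] at k2
    have := congrArg Prod.snd k2
    have hn0 : n = 0 := by
      simp only [sgn] at this
      split_ifs at this <;> omega
    subst hn0
    apply hp.red z
    rw [dlet_flip, h2] at k1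
    simpa using k1.symm
  · intro b1 b2 hne w hw
    obtain ⟨ε, e1, e2, e3⟩ := step_ne (by rw [← h2]; exact G.dlet_ne δ) (hw z le_rfl (by omega))
    obtain ⟨ε', f1, f2, f3⟩ := step_ne hn (hw (z + 1 + n) (by omega) le_rfl)
    have hpos' := run_pos (G := G) hrun hp.red
      (fun i _ _ => hw i (by omega) (by omega)) n le_rfl
    have := hS δ δ' ε ε' b1 b2 (by rw [e1, ← h2, b1]) (by rw [f1, ← k1, b2])
      (by rw [h3, k2, hpos]) (by rw [e3, f2, hpos']) hne
      (by rw [h3, k2, hpos, e3, f2, hpos']; simp)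
    have h4 : flipLetter δ = flipLetter ε := hG _ _ (by simp [h2, e1]) (by simpa using this)
    have h5 : δ = ε := by rw [← flipLetter_flipLetter δ, h4, flipLetter_flipLetter]
    rw [← e2, ← h5, h1]

/-- The sequence of edges, other than the edges on the lines, that a reduced closed path takes.
After `P` of them the path is closed; only lines are recorded, and not the positions on them. -/
structure IsTour (G : LineGraph X Λ Ed) (δ : ℕ → Ed × Bool) (P : ℕ) : Prop where
  pos : 0 < P
  per : δ P = δ 0
  adj : ∀ j, (G.dtgt (δ j)).1 = (G.dsrc (δ (j + 1))).1
  red : ∀ j, δ (j + 1) ≠ flipLetter (δ j)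

variable (G) in
/-- The `j`-th and the next edge are labelled `b`, with a non-trivial power of `a` between them. -/
def Good (b : X) (δ : ℕ → Ed × Bool) (j : ℕ) : Prop :=
  (G.dlet (δ j)).1 = b ∧ (G.dlet (δ (j + 1))).1 = b ∧ (G.dtgt (δ j)).2 ≠ (G.dsrc (δ (j + 1))).2

/-- The tour of a reduced closed path that starts with a given edge. Seven good places of a tour
give seven rigid subpaths. -/
theorem exists_tour {b : X} (hG : G.Folded) (hS : G.Sidon b) (hp : IsPeriodicPath G.Step v l N)
    {z₀ : ℤ} {δ₀ : Ed × Bool} (h : G.At v l z₀ δ₀) :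
    ∃ δ P, IsTour G δ P ∧ δ 0 = δ₀ ∧ (∀ j, ∃ z, G.At v l z (δ j)) ∧
      ∀ j : ℕ → ℕ, (∀ k < 6, j k < j (k + 1)) → j 6 < P → (∀ k < 7, G.Good b δ (j k)) →
        ∃ s t, IsRigidFamily G.Step v l N s t := by
  let T := {x : ℤ × (Ed × Bool) // G.At v l x.1 x.2}
  have hnext : ∀ x : T, ∃ y : T, G.Follows b v l x.1.1 x.1.2 y.1.1 y.1.2 := fun x => by
    obtain ⟨z', δ', h1, h2⟩ := exists_follows hG hS hp x.2
    exact ⟨⟨(z', δ'), h1⟩, h2⟩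
  choose nx hnx using hnext
  set f : ℕ → T := fun j => nx^[j] ⟨(z₀, δ₀), h⟩ with hf
  have hf1 : ∀ j, f (j + 1) = nx (f j) := fun j => Function.iterate_succ_apply' _ _ _
  have hF : ∀ j, G.Follows b v l (f j).1.1 (f j).1.2 (f (j + 1)).1.1 (f (j + 1)).1.2 := fun j => by
    rw [hf1]; exact hnx _
  have hmono : StrictMono (fun j => (f j).1.1) := strictMono_nat_of_lt_succ fun j => (hF j).1
  have hge : ∀ j : ℕ, z₀ + j ≤ (f j).1.1 := fun j => by
    induction j with
    | zero => simp [hf]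
    | succ j ih => have := (hF j).1; push_cast; omega
  have hsurj : ∀ y, z₀ ≤ y → (l y).1 ≠ G.a → ∃ j, (f j).1.1 = y := by
    intro y hy hl
    have hex : ∃ j, y < (f j).1.1 := ⟨(y - z₀ + 1).toNat, by
      have := hge (y - z₀ + 1).toNat; omega⟩
    classical
    obtain ⟨j, hj, hmin⟩ : ∃ j, y < (f j).1.1 ∧ ∀ m < j, (f m).1.1 ≤ y :=
      ⟨Nat.find hex, Nat.find_spec hex, fun m hm => by simpa using Nat.find_min hex hm⟩
    cases j with
    | zero => exact absurd hj (by simpa [hf] using hy)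
    | succ j =>
      refine ⟨j, ?_⟩
      by_contra hne
      exact hl ((hF j).2.1 y (lt_of_le_of_ne (hmin j (by omega)) hne) hj)
  obtain ⟨P, hP⟩ := hsurj (z₀ + N) (by have := hp.pos; omega) (by
    rw [hp.lper, ← h.2.1]; exact G.dlet_ne _)
  have h0 : (f 0).1 = (z₀, δ₀) := rfl
  refine ⟨fun j => (f j).1.2, P, ⟨?_, ?_, fun j => (hF j).2.2.1, fun j => (hF j).2.2.2.1⟩, rfl,
    fun j => ⟨_, (f j).2⟩, fun j hj1 hj2 hj3 => ⟨fun k => (f (j k)).1.1, fun k => (f (j k + 1)).1.1,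
      ⟨fun k _ => (hF _).1, fun k hk => hmono.monotone (hj1 k hk), ?_, fun k hk =>
        (hF _).2.2.2.2 (hj3 k hk).1 (hj3 k hk).2.1 (hj3 k hk).2.2⟩⟩⟩
  · rcases Nat.eq_zero_or_pos P with rfl | hpos
    · have := hp.pos; rw [h0] at hP; simp at hP; omega
    · exact hpos
  · have h1 := (f P).2
    have h2 := h
    simp only [At, hP] at h1
    rw [hp.vper, hp.lper] at h1
    exact hG _ _ (h1.2.1.trans h2.2.1.symm) (h1.1.trans h2.1.symm)
  · have h1 : (f (j 6 + 1)).1.1 ≤ (f P).1.1 := hmono.monotone hj2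
    have h2 : (f 0).1.1 ≤ (f (j 0)).1.1 := hmono.monotone (Nat.zero_le _)
    rw [hP] at h1
    rw [h0] at h2
    simp only at h2
    omega

theorem At.reverse {z : ℤ} {δ : Ed × Bool} (h : G.At v l z δ) :
    G.At (fun i => v (-i)) (fun i => flipLetter (l (-i - 1))) (-z - 1) (flipLetter δ) := by
  obtain ⟨h1, h2, h3⟩ := h
  refine ⟨?_, ?_, ?_⟩
  · rw [dsrc_flip, h3]; congr 1; ring
  · rw [dlet_flip, h2]; congr 2; ring
  · rw [dtgt_flip, h1]; congr 1; ring

end LineGraph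

end VanKampen

namespace RipsSegev

open VanKampen

/-! ### The Rips relators as sequences of syllables -/

/-- The indices of the Rips relators. -/
abbrev RelIdx (m n : ℕ) : Type := Fin n ⊕ (Fin 4 × Fin m)

/-- A syllable `(k, l)` stands for the word `a^k l`. -/
abbrev Syl (m : ℕ) : Type := ℕ × (Gen m × Bool)

section Syllables

variable {m n : ℕ}

/-- The word written as a sequence of syllables. -/
def ofSyl (S : List (Syl m)) : Word m := S.flatMap fun s => apow s.1 ++ [s.2]

/-- The syllables of `ripsTail i`. -/
def tailSyl (i : ℕ) : List (Syl m) := (List.range 10).map fun s => (10 * i - 9 + s, (Gen.b, true))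

/-- The syllables of a Rips relator that precede its `ripsTail`. -/
def headSyl (r : Fin n → FreeGroup (Fin m)) : RelIdx m n → List (Syl m)
  | .inl i => (r i).toWord.map fun l => (0, (Gen.x l.1, l.2))
  | .inr (0, j) => [(0, (Gen.x j, false)), (1, (Gen.x j, true))]
  | .inr (1, j) => [(0, (Gen.x j, true)), (1, (Gen.x j, false))]
  | .inr (2, j) => [(0, (Gen.x j, false)), (0, (Gen.b, true)), (0, (Gen.x j, true))]
  | .inr (3, j) => [(0, (Gen.x j, true)), (0, (Gen.b, true)), (0, (Gen.x j, false))]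

/-- The index `i` of the word `ripsTail i` in a Rips relator. -/
def tailIdx : RelIdx m n → ℕ
  | .inl i => i + 1
  | .inr (0, j) => n + (j + 1)
  | .inr (1, j) => m + n + (j + 1)
  | .inr (2, j) => 2 * m + n + (j + 1)
  | .inr (3, j) => 3 * m + n + (j + 1)

/-- The syllables of a Rips relator. -/
def syl (r : Fin n → FreeGroup (Fin m)) (ρ : RelIdx m n) : List (Syl m) :=
  headSyl r ρ ++ tailSyl (tailIdx ρ)

variable (r : Fin n → FreeGroup (Fin m))

theorem ofSyl_append (S T : List (Syl m)) : ofSyl (S ++ T) = ofSyl S ++ ofSyl T :=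
  List.flatMap_append

theorem ofSyl_tailSyl (i : ℕ) : ofSyl (tailSyl (m := m) i) = ripsTail i := by
  rw [ofSyl, tailSyl, List.flatMap_map]; rfl

theorem ripsRelator_eq (ρ : RelIdx m n) : ripsRelator r ρ = ofSyl (syl r ρ) := by
  rw [syl, ofSyl_append, ofSyl_tailSyl]
  rcases ρ with i | ⟨c, j⟩
  · simp only [ripsRelator, headSyl, tailIdx, ofSyl, List.flatMap_map]
    congr 1
    simp [apow]
    rw [← List.map_eq_flatMap]
  · fin_cases c <;> rfl

theorem tailIdx_inj {ρ τ : RelIdx m n} (h : tailIdx ρ = tailIdx τ) : ρ = τ := by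
  rcases ρ with i | ⟨c, j⟩ <;> rcases τ with i' | ⟨c', j'⟩
  · have := i.2; have := i'.2
    simp only [tailIdx] at h
    congr 1; ext; omega
  · have := i.2; have := j'.2
    fin_cases c' <;> simp only [tailIdx] at h <;> omega
  · have := i'.2; have := j.2
    fin_cases c <;> simp only [tailIdx] at h <;> omega
  · have := j.2; have := j'.2
    fin_cases c <;> fin_cases c' <;> simp only [tailIdx] at h <;>
      first | omega | (congr 2; ext; omega)

theorem tailIdx_pos (ρ : RelIdx m n) : 1 ≤ tailIdx ρ := by
  rcases ρ with i | ⟨c, j⟩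
  · simp [tailIdx]
  · fin_cases c <;> simp only [tailIdx] <;> omega

theorem tailIdx_le (ρ : RelIdx m n) : tailIdx ρ ≤ n + 4 * m := by
  rcases ρ with i | ⟨c, j⟩
  · have := i.2; simp only [tailIdx]; omega
  · have := j.2
    fin_cases c <;> simp only [tailIdx] <;> omega

theorem length_tailSyl (i : ℕ) : (tailSyl (m := m) i).length = 10 := by simp [tailSyl]

theorem length_syl (ρ : RelIdx m n) : (syl r ρ).length = (headSyl r ρ).length + 10 := by
  simp [syl, length_tailSyl]

theorem syl_tail (ρ : RelIdx m n) (s : ℕ)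
    (h : (headSyl r ρ).length + s < (syl r ρ).length) :
    (syl r ρ)[(headSyl r ρ).length + s] = (10 * tailIdx ρ - 9 + s, (Gen.b, true)) := by
  simp [syl, tailSyl]

theorem headSyl_b {ρ : RelIdx m n} {x : Syl m} (hx : x ∈ headSyl r ρ) (hb : x.2.1 = Gen.b) :
    x.1 = 0 := by
  rcases ρ with i | ⟨c, j⟩
  · simp only [headSyl, List.mem_map] at hx
    obtain ⟨l, -, rfl⟩ := hx; rfl
  · fin_cases c <;> simp only [headSyl, List.mem_cons, List.not_mem_nil, or_false] at hx <;>
      rcases hx with rfl | rfl | rfl <;> first | rfl | simp at hb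

theorem syl_ne_a {ρ : RelIdx m n} {x : Syl m} (hx : x ∈ syl r ρ) : x.2.1 ≠ Gen.a := by
  rcases List.mem_append.1 hx with h | h
  · rcases ρ with i | ⟨c, j⟩
    · simp only [headSyl, List.mem_map] at h
      obtain ⟨l, -, rfl⟩ := h; simp
    · fin_cases c <;> simp only [headSyl, List.mem_cons, List.not_mem_nil, or_false] at h <;>
        rcases h with rfl | rfl | rfl <;> simp
  · simp only [tailSyl, List.mem_map] at h
    obtain ⟨l, -, rfl⟩ := h; simp

theorem syl_b {ρ : RelIdx m n} {x : Syl m} (hx : x ∈ syl r ρ) (hb : x.2.1 = Gen.b) :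
    x.2.2 = true := by
  rcases List.mem_append.1 hx with h | h
  · rcases ρ with i | ⟨c, j⟩
    · simp only [headSyl, List.mem_map] at h
      obtain ⟨l, -, rfl⟩ := h; simp at hb
    · fin_cases c <;> simp only [headSyl, List.mem_cons, List.not_mem_nil, or_false] at h <;>
        rcases h with rfl | rfl | rfl <;> first | rfl | simp at hb
  · simp only [tailSyl, List.mem_map] at h
    obtain ⟨l, -, rfl⟩ := h; rfl

/-- Consecutive letters of a relator that are not separated by a power of `a` do not cancel. -/
theorem syl_reduced (ρ : RelIdx m n) (s : ℕ) (h : s + 1 < (syl r ρ).length)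
    (h0 : (syl r ρ)[s + 1].1 = 0) : (syl r ρ)[s + 1].2 ≠ flipLetter (syl r ρ)[s].2 := by
  have hlt : s + 1 < (headSyl r ρ).length := by
    by_contra hcon
    obtain ⟨t, ht⟩ := Nat.exists_eq_add_of_le (not_lt.1 hcon)
    have := tailIdx_pos ρ
    simp only [ht] at h0
    rw [syl_tail r ρ t] at h0
    simp only at h0; omega
  have hlt' : s < (headSyl r ρ).length := by omega
  simp only [syl, List.getElem_append_left hlt, List.getElem_append_left hlt'] at h0 ⊢
  rcases ρ with i | ⟨c, j⟩
  · simp only [headSyl, List.getElem_map, flipLetter, ne_eq, Prod.mk.injEq, Gen.x.injEq]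
    have := FreeGroup.isReduced_toWord (x := r i)
    rw [FreeGroup.IsReduced, List.isChain_iff_getElem] at this
    have := this s (by simpa [headSyl] using hlt)
    rintro ⟨h1, h2⟩
    have := this h1.symm
    rw [this] at h2
    simp at h2
  · fin_cases c <;> simp only [headSyl, List.length_cons, List.length_nil] at hlt h0 <;>
      rcases s with _ | _ | s <;> first | omega | (simp [headSyl, flipLetter] at h0 ⊢)

end Syllables

/-! ### The model of the relator graph -/

section Model

variable {m n K : ℕ} (r : Fin n → FreeGroup (Fin m)) (J : ℕ) (σ : Fin 4 → Equiv.Perm (Fin K))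

/-- The lines of the model. -/
inductive Line (m n K : ℕ) : Type
  /-- the line through the vertex `i` of `Θ` -/
  | main (i : Fin K)
  /-- the line of the `s + 2`-nd power of `a` in `c_i` -/
  | seg (i : Fin K) (s : Fin 3)
  /-- the line through the end of the path `b^k` from the vertex `0` -/
  | chain (k : ℕ)
  /-- the line of the power of `a` in the `s`-th syllable of a Rips relator -/
  | rip (ρ : RelIdx m n) (s : ℕ)

/-- The edges of the model outside the lines. -/
inductive Ed {m n : ℕ} (r : Fin n → FreeGroup (Fin m)) (K : ℕ) : Type
  /-- the letter `b` on the edge of `Θ` labelled `y_s` that starts at the vertex `i` -/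
  | y (i : Fin K) (s : Fin 4)
  /-- the letter `b` after the `s`-th power of `a` in `c_i` -/
  | br (i : Fin K) (s : Fin 4)
  /-- the `k`-th letter `b` of the initial powers of `b` of the words `c_i` -/
  | chain (k : Fin K)
  /-- the last letter of the `s`-th syllable of a Rips relator -/
  | rip (ρ : RelIdx m n) (s : Fin (syl r ρ).length)

/-- The exponent `10^(J + 10 i - e)`, where the vertex `i` of `Θ` is `i + 1` for `i : Fin K`. -/
def pw (i : Fin K) (e : Fin 10) : ℤ := 10 ^ (J + 10 * ((i : ℕ) + 1) - e)

/-- Starting vertices of the edges. The position on a line is the exponent of the power of `a` that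
leads there from the point where the line is entered. -/
def edSrc : Ed r K → Line m n K × ℤ
  | .y i 0 => (.main i, 0)
  | .y i 1 => (.main i, pw J i 0)
  | .y i 2 => (.main i, pw J i 2)
  | .y i 3 => (.main i, pw J i 1)
  | .br i 0 => (.chain (i + 1), pw J i 9)
  | .br i 1 => (.seg i 0, pw J i 8)
  | .br i 2 => (.seg i 1, pw J i 7)
  | .br i 3 => (.seg i 2, pw J i 6)
  | .chain k => (.chain k, 0)
  | .rip ρ s => (.rip ρ s, (syl r ρ)[s].1)

/-- Terminal vertices of the edges. The edge `br i 3` enters the line `main i` at a negative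
position, since the last power of `a` in `c_i` leads to the vertex `i` at position `0`. -/
def edTgt : Ed r K → Line m n K × ℤ
  | .y i 0 => (.main (σ 0 i), pw J (σ 0 i) 4)
  | .y i 1 => (.main (σ 1 i), pw J (σ 1 i) 3)
  | .y i 2 => (.main (σ 2 i), pw J (σ 2 i) 0)
  | .y i 3 => (.main (σ 3 i), 0)
  | .br i 0 => (.seg i 0, 0)
  | .br i 1 => (.seg i 1, 0)
  | .br i 2 => (.seg i 2, 0)
  | .br i 3 => (.main i, -pw J i 5)
  | .chain k => (.chain (k + 1), 0)
  | .rip ρ s => (.rip ρ ((s + 1) % (syl r ρ).length), 0)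

/-- Letters on the edges. -/
def edLetter : Ed r K → Gen m × Bool
  | .rip ρ s => (syl r ρ)[s].2
  | _ => (Gen.b, true)

/-- A folded graph to which the relator graph maps. In the image of the latter
the powers of `a` are segments of the lines. -/
def model : LineGraph (Gen m) (Line m n K) (Ed r K) where
  a := Gen.a
  src := edSrc r J
  tgt := edTgt r J σ
  letter := edLetter r
  letter_ne e := by
    cases e with
    | rip ρ s => exact syl_ne_a r (List.getElem_mem _)
    | _ => simp [edLetter]

@[simp] theorem pw_inj {J : ℕ} {i i' : Fin K} {e e' : Fin 10} :
    pw J i e = pw J i' e' ↔ i = i' ∧ e = e' := by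
  refine ⟨fun h => ?_, fun h => by rw [h.1, h.2]⟩
  have h1 := pow_right_injective₀ (a := (10 : ℤ)) (by norm_num) (by norm_num) h
  have := e.2; have := e'.2
  exact ⟨by ext; omega, by ext; omega⟩

theorem pw_pos (i : Fin K) (e : Fin 10) : 0 < pw J i e := by unfold pw; positivity

@[simp] theorem pw_ne_zero (i : Fin K) (e : Fin 10) : pw J i e ≠ 0 := (pw_pos J i e).ne'

@[simp] theorem zero_ne_pw (i : Fin K) (e : Fin 10) : 0 ≠ pw J i e := (pw_pos J i e).ne

@[simp] theorem neg_pw_ne_pw (i i' : Fin K) (e e' : Fin 10) : -pw J i e ≠ pw J i' e' := by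
  have := pw_pos J i e; have := pw_pos J i' e'; omega

@[simp] theorem pw_ne_neg_pw (i i' : Fin K) (e e' : Fin 10) : pw J i e ≠ -pw J i' e' := by
  have := pw_pos J i e; have := pw_pos J i' e'; omega

theorem edSrc_injective : Function.Injective (edSrc r J (K := K)) := by
  rintro (⟨i, s⟩ | ⟨i, s⟩ | k | ⟨ρ, s⟩) (⟨i', s'⟩ | ⟨i', s'⟩ | k' | ⟨ρ', s'⟩) h
  case rip.rip =>
    simp only [edSrc, Prod.mk.injEq, Line.rip.injEq] at h
    obtain ⟨⟨rfl, h⟩, -⟩ := h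
    rw [Fin.ext h]
  all_goals try fin_cases s
  all_goals try fin_cases s'
  all_goals simp [edSrc] at h ⊢
  all_goals first | exact h | (ext; omega)

theorem edTgt_injective : Function.Injective (edTgt r J σ) := by
  rintro (⟨i, s⟩ | ⟨i, s⟩ | k | ⟨ρ, s⟩) (⟨i', s'⟩ | ⟨i', s'⟩ | k' | ⟨ρ', s'⟩) h
  case rip.rip =>
    simp only [edTgt, Prod.mk.injEq, Line.rip.injEq] at h
    obtain ⟨⟨rfl, h⟩, -⟩ := h
    have h1 := s.2
    have h2 := s'.2
    have : (s : ℕ) = s' := by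
      by_cases a1 : (s : ℕ) + 1 < (syl r ρ).length <;> by_cases a2 : (s' : ℕ) + 1 < (syl r ρ).length
      · rw [Nat.mod_eq_of_lt a1, Nat.mod_eq_of_lt a2] at h; omega
      · rw [Nat.mod_eq_of_lt a1, show (s' : ℕ) + 1 = (syl r ρ).length by omega, Nat.mod_self] at h
        omega
      · rw [Nat.mod_eq_of_lt a2, show (s : ℕ) + 1 = (syl r ρ).length by omega, Nat.mod_self] at h
        omega
      · omega
    rw [Fin.ext this]
  all_goals try fin_cases s
  all_goals try fin_cases s'
  all_goals simp [edTgt] at h ⊢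
  all_goals first | exact h | (ext; omega)

theorem edLetter_b {e : Ed r K} (h : (edLetter r e).1 = Gen.b) : edLetter r e = (Gen.b, true) := by
  cases e with
  | rip ρ s => exact Prod.ext h (syl_b r (List.getElem_mem _) h)
  | _ => rfl

theorem edLetter_ne_of_src_eq_tgt {e e' : Ed r K} (h : edSrc r J e = edTgt r J σ e') :
    edLetter r e ≠ flipLetter (edLetter r e') := by
  intro hl
  by_cases hb : (edLetter r e').1 = Gen.b
  · have h1 := edLetter_b r hb
    have h2 : (edLetter r e).1 = Gen.b := by rw [hl]; exact hb
    rw [edLetter_b r h2, h1] at hl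
    simp [flipLetter] at hl
  rcases e' with ⟨i, s⟩ | ⟨i, s⟩ | k | ⟨ρ', s'⟩
  · exact hb rfl
  · exact hb rfl
  · exact hb rfl
  rcases e with ⟨i, s⟩ | ⟨i, s⟩ | k | ⟨ρ, s⟩
  · fin_cases s <;> simp [edSrc, edTgt] at h
  · fin_cases s <;> simp [edSrc, edTgt] at h
  · simp [edSrc, edTgt] at h
  simp only [edSrc, edTgt, Prod.mk.injEq, Line.rip.injEq] at h
  obtain ⟨⟨rfl, h1⟩, h2⟩ := h
  have hs' := s'.2
  by_cases hlt : (s' : ℕ) + 1 < (syl r ρ).length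
  · rw [Nat.mod_eq_of_lt hlt] at h1
    refine syl_reduced r ρ s' hlt ?_ ?_
    · simp only [← h1]; exact_mod_cast h2
    · simp only [← h1]; exact hl
  · apply hb
    have hlen := length_syl r ρ
    have : (s' : ℕ) = (headSyl r ρ).length + 9 := by omega
    have h3 := syl_tail r ρ 9 (by omega)
    simp only [edLetter, Fin.getElem_fin, this, h3]

theorem folded : (model r J σ).Folded := by
  rintro ⟨e, _ | _⟩ ⟨e', _ | _⟩ h1 h2
  · exact congrArg (·, false) (edTgt_injective r J σ h2)
  · exact absurd h1.symm (edLetter_ne_of_src_eq_tgt r J σ h2.symm)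
  · exact absurd h1 (edLetter_ne_of_src_eq_tgt r J σ h2)
  · exact congrArg (·, true) (edSrc_injective r J h2)

end Model

/-! ### Distances on the lines -/

variable {m n K : ℕ} (r : Fin n → FreeGroup (Fin m)) (J : ℕ) (σ : Fin 4 → Equiv.Perm (Fin K))

/-- The places on the lines where edges labelled `b` start or end. -/
inductive BEnd : Line m n K → ℤ → Prop
  | zero (L) : BEnd L 0
  | main (i) (e : Fin 10) (he : e ≤ 4) : BEnd (.main i) (pw J i e)
  | entry (i) : BEnd (.main i) (-pw J i 5)
  | seg₀ (i) : BEnd (.seg i 0) (pw J i 8)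
  | seg₁ (i) : BEnd (.seg i 1) (pw J i 7)
  | seg₂ (i) : BEnd (.seg i 2) (pw J i 6)
  | chain (i : Fin K) : BEnd (.chain (i + 1)) (pw J i 9)
  | rip (ρ) (s : ℕ) (hs : s < 10) :
      BEnd (.rip ρ ((headSyl r ρ).length + s)) ((10 * tailIdx ρ - 9 + s : ℕ) : ℤ)

theorem bEnd_src {e : Ed r K} (h : (edLetter r e).1 = Gen.b) :
    BEnd r J (edSrc r J e).1 (edSrc r J e).2 := by
  rcases e with ⟨i, s⟩ | ⟨i, s⟩ | k | ⟨ρ, s⟩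
  · fin_cases s
    exacts [.zero _, .main _ _ (by decide), .main _ _ (by decide), .main _ _ (by decide)]
  · fin_cases s
    exacts [.chain _, .seg₀ _, .seg₁ _, .seg₂ _]
  · exact .zero _
  · have hs := s.2
    by_cases hlt : (s : ℕ) < (headSyl r ρ).length
    · have : (syl r ρ)[s].1 = 0 := by
        have he : (syl r ρ)[s] = (headSyl r ρ)[(s : ℕ)] := List.getElem_append_left hlt
        refine headSyl_b r (ρ := ρ) ?_ h
        rw [he]
        exact List.getElem_mem _
      simp only [edSrc, this]
      exact .zero _
    · obtain ⟨t, ht⟩ := Nat.exists_eq_add_of_le (not_lt.1 hlt)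
      have h10 : t < 10 := by have := length_syl r ρ; omega
      simp only [edSrc, Fin.getElem_fin, ht, syl_tail r ρ t]
      exact .rip ρ t h10

theorem bEnd_tgt (e : Ed r K) : BEnd r J (edTgt r J σ e).1 (edTgt r J σ e).2 := by
  rcases e with ⟨i, s⟩ | ⟨i, s⟩ | k | ⟨ρ, s⟩
  · fin_cases s
    exacts [.main _ _ (by decide), .main _ _ (by decide), .main _ _ (by decide), .zero _]
  · fin_cases s
    exacts [.zero _, .zero _, .zero _, .entry _]
  · exact .zero _
  · exact .zero _

theorem bEnd_dsrc {δ : Ed r K × Bool} (h : ((model r J σ).dlet δ).1 = Gen.b) :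
    BEnd r J ((model r J σ).dsrc δ).1 ((model r J σ).dsrc δ).2 := by
  rcases δ with ⟨e, _ | _⟩
  · exact bEnd_tgt r J σ e
  · exact bEnd_src r J h

variable {J} in
theorem ten_mul_pw_le {i : Fin K} {e e' : Fin 10} (h : e' < e) : 10 * pw J i e ≤ pw J i e' := by
  unfold pw
  rw [← pow_succ']
  have : (e' : ℕ) < e := h
  have := e.2
  exact pow_le_pow_right₀ (by norm_num) (by omega)

/-- A power of ten with a perturbation of at most a tenth of it determines both. -/
theorem pw_add_inj {i i' : Fin K} {e e' : Fin 10} {c c' : ℤ} (hc : 10 * |c| ≤ pw J i e)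
    (hc' : 10 * |c'| ≤ pw J i' e') (h : pw J i e + c = pw J i' e' + c') :
    (i = i' ∧ e = e') ∧ c = c' := by
  have main : ∀ {i i' : Fin K} {e e' : Fin 10} {c c' : ℤ}, 10 * |c| ≤ pw J i e →
      10 * |c'| ≤ pw J i' e' → pw J i e + c = pw J i' e' + c' →
      ¬ J + 10 * ((i : ℕ) + 1) - e < J + 10 * ((i' : ℕ) + 1) - e' := by
    intro i i' e e' c c' hc hc' h hlt
    have h1 : 10 * pw J i e ≤ pw J i' e' := by
      unfold pw
      rw [← pow_succ']
      exact pow_le_pow_right₀ (by norm_num) hlt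
    have := pw_pos J i e
    have := le_abs_self c
    have := neg_abs_le c'
    omega
  have h1 := main hc hc' h
  have h2 := main hc' hc h.symm
  have := e.2
  have := e'.2
  have h3 : i = i' ∧ e = e' := ⟨by ext; omega, by ext; omega⟩
  obtain ⟨rfl, rfl⟩ := h3
  exact ⟨⟨rfl, rfl⟩, by omega⟩

/-- The lower end of the segment of length `pw J i e` between two ends of edges labelled `b`, one of
which is at position `0`. -/
def gapBase (i : Fin K) (e : Fin 10) : Line m n K × ℤ :=
  match e with
  | 5 => (.main i, -pw J i 5)
  | 6 => (.seg i 2, 0)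
  | 7 => (.seg i 1, 0)
  | 8 => (.seg i 0, 0)
  | 9 => (.chain (i + 1), 0)
  | _ => (.main i, 0)

theorem gapBase_of_le (i : Fin K) {e : Fin 10} (he : e ≤ 4) :
    gapBase (m := m) (n := n) J i e = (.main i, 0) := by
  fin_cases e <;> first | rfl | exact absurd he (by decide)

/-- `u` is the lower end of a segment of length `d` between two ends of edges labelled `b`. In the
first alternative `c = 0` if one of the ends is at position `0`, and otherwise `-c` is the position
of the lower end on the line `main i`. -/
def Gap (u : Line m n K × ℤ) (d : ℤ) : Prop :=
  (∃ i e c, d = pw J i e + c ∧ 10 * |c| ≤ pw J i e ∧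
    u = if c = 0 then gapBase J i e else (.main i, -c)) ∨
  ∃ ρ s, s < 10 ∧ d = ((10 * tailIdx ρ - 9 + s : ℕ) : ℤ) ∧
    u = (.rip ρ ((headSyl r ρ).length + s), 0)

theorem gap_of_bEnd {L : Line m n K} {t t' : ℤ} (h : BEnd r J L t) (h' : BEnd r J L t')
    (hlt : t < t') : Gap r J (L, t) (t' - t) := by
  have single : ∀ (i : Fin K) e, Gap r J (gapBase J i e) (pw J i e) := fun i e =>
    Or.inl ⟨i, e, 0, by simp, by simpa using (pw_pos J i e).le, by simp⟩
  cases h with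
  | zero =>
    rw [sub_zero]
    cases h' with
    | zero => exact absurd hlt (lt_irrefl _)
    | main i e he => have := single i e; rwa [gapBase_of_le J i he] at this
    | entry i => have := pw_pos J i 5; omega
    | seg₀ i => exact single i 8
    | seg₁ i => exact single i 7
    | seg₂ i => exact single i 6
    | chain i => exact single i 9
    | rip ρ s hs => exact Or.inr ⟨ρ, s, hs, rfl, rfl⟩
  | main i e he =>
    have h0 := pw_pos J i e
    cases h' with
    | zero => omega
    | main _ e' he' =>
      have hee : e' < e := by
        by_contra hcon
        rcases eq_or_lt_of_le (not_lt.1 hcon) with rfl | h1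
        · omega
        · have := ten_mul_pw_le (J := J) (i := i) h1
          have := pw_pos J i e'
          omega
      refine Or.inl ⟨i, e', -pw J i e, by ring, ?_, ?_⟩
      · rw [abs_neg, abs_of_pos h0]; exact ten_mul_pw_le hee
      · rw [if_neg (by omega), neg_neg]
    | entry => have := pw_pos J i 5; omega
  | entry i =>
    have h0 := pw_pos J i 5
    cases h' with
    | zero => rw [zero_sub, neg_neg]; exact single i 5
    | main _ e' he' =>
      refine Or.inl ⟨i, e', pw J i 5, by ring, ?_, ?_⟩
      · rw [abs_of_pos h0]; exact ten_mul_pw_le (lt_of_le_of_lt he' (by decide))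
      · rw [if_neg (by omega)]
    | entry => omega
  | seg₀ i =>
    have h0 := pw_pos J i 8
    cases h' <;> omega
  | seg₁ i =>
    have h0 := pw_pos J i 7
    cases h' <;> omega
  | seg₂ i =>
    have h0 := pw_pos J i 6
    cases h' <;> omega
  | chain i =>
    have h0 := pw_pos J i 9
    generalize hk : (i : ℕ) + 1 = k at h'
    cases h' with
    | zero => omega
    | chain i' =>
      have : i = i' := by ext; omega
      subst this; omega
  | rip ρ s hs =>
    generalize hk : (headSyl r ρ).length + s = k at h'
    cases h' with
    | zero => omega
    | rip _ s' hs' =>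
      have : s = s' := by omega
      subst this; omega

/-- The length of a segment determines its position: lengths in Rips relators are smaller than
`10^(J+1)`, and the other ones are dominated by a power of ten at least `10^(J+1)`. -/
theorem gap_inj (hnm : 9 * (n + 4 * m) < 10 ^ J) {u u' : Line m n K × ℤ} {d : ℤ}
    (h : Gap r J u d) (h' : Gap r J u' d) : u = u' := by
  have mixed : ∀ (i : Fin K) (e : Fin 10) (c : ℤ) (ρ : RelIdx m n) (s : ℕ),
      10 * |c| ≤ pw J i e → s < 10 → pw J i e + c ≠ ((10 * tailIdx ρ - 9 + s : ℕ) : ℤ) := by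
    intro i e c ρ s hc hs h
    have h1 := tailIdx_le ρ
    have h2 := tailIdx_pos ρ
    have h3 : ((10 : ℤ) ^ (J + 1)) ≤ pw J i e := by
      unfold pw
      have := e.2
      exact pow_le_pow_right₀ (by norm_num) (by omega)
    have h4 := neg_abs_le c
    have h5 : 9 * ((n : ℤ) + 4 * m) < 10 ^ J := by exact_mod_cast hnm
    rw [pow_succ] at h3
    omega
  rcases h with ⟨i, e, c, rfl, hc, rfl⟩ | ⟨ρ, s, hs, rfl, rfl⟩
  · rcases h' with ⟨i', e', c', h1, hc', rfl⟩ | ⟨ρ, s, hs, h1, rfl⟩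
    · obtain ⟨⟨rfl, rfl⟩, rfl⟩ := pw_add_inj J hc hc' h1
      rfl
    · exact absurd h1 (mixed _ _ _ _ _ hc hs)
  · rcases h' with ⟨i', e', c', h1, hc', rfl⟩ | ⟨ρ', s', hs', h1, rfl⟩
    · exact absurd h1.symm (mixed _ _ _ _ _ hc' hs)
    · have h2 := tailIdx_pos ρ
      have h3 := tailIdx_pos ρ'
      have h4 : tailIdx ρ = tailIdx ρ' := by omega
      have h5 := tailIdx_inj h4
      subst h5
      have : s = s' := by omega
      rw [this]

theorem sidon (hnm : 9 * (n + 4 * m) < 10 ^ J) : (model r J σ).Sidon Gen.b := by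
  intro δ δ' ε ε' hδ hδ' hε hε' h1 h2 h3 h4
  have tgtEnd : ∀ {δ : Ed r K × Bool}, ((model r J σ).dlet δ).1 = Gen.b →
      BEnd r J ((model r J σ).dtgt δ).1 ((model r J σ).dtgt δ).2 := fun {δ} h => by
    have := bEnd_dsrc r J σ (δ := flipLetter δ) (by rw [LineGraph.dlet_flip]; exact h)
    simpa using this
  have b1 := tgtEnd hδ
  have b2 := bEnd_dsrc r J σ hδ'
  have b3 := tgtEnd hε
  have b4 := bEnd_dsrc r J σ hε'
  rw [← h1] at b2
  rw [← h2] at b4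
  rcases lt_or_gt_of_ne h3 with hlt | hlt
  · have g1 := gap_of_bEnd r J b1 b2 hlt
    have g2 := gap_of_bEnd r J b3 b4 (by omega)
    rw [← h4] at g2
    exact gap_inj r J hnm g1 g2
  · have g1 := gap_of_bEnd r J b2 b1 hlt
    have g2 := gap_of_bEnd r J b4 b3 (by omega)
    rw [show ((model r J σ).dtgt ε).2 - ((model r J σ).dsrc ε').2 =
      ((model r J σ).dtgt δ).2 - ((model r J σ).dsrc δ').2 by omega] at g2
    have := gap_inj r J hnm g1 g2
    rw [Prod.mk.injEq] at this
    exact Prod.ext this.1 (by omega)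

/-! ### Reduced cycles of the model -/

section

variable {m n K : ℕ} {r : Fin n → FreeGroup (Fin m)} {J : ℕ} {σ : Fin 4 → Equiv.Perm (Fin K)}
  {δ : ℕ → Ed r K × Bool} {P : ℕ}

theorem rip_succ (h : LineGraph.IsTour (model r J σ) δ P) {j : ℕ} {ρ : RelIdx m n}
    {s : Fin (syl r ρ).length} (hj : δ j = (.rip ρ s, true)) :
    δ (j + 1) =
      (.rip ρ ⟨(s + 1) % (syl r ρ).length, Nat.mod_lt _ (by have := s.2; omega)⟩, true) := by
  have h1 := h.adj j
  have h2 := h.red j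
  rw [hj] at h1 h2
  rcases hd : δ (j + 1) with ⟨⟨i, s'⟩ | ⟨i, s'⟩ | k | ⟨ρ', s'⟩, _ | _⟩ <;> rw [hd] at h1 h2 <;>
    try fin_cases s'
  all_goals simp [LineGraph.dtgt, LineGraph.dsrc, model, edSrc, edTgt] at h1
  · exfalso
    apply h2
    have : edTgt r J σ (.rip ρ s) = edTgt r J σ (.rip ρ' s') := by
      simp only [edTgt, Prod.mk.injEq, Line.rip.injEq, and_true]; exact h1
    rw [← edTgt_injective r J σ this]; rfl
  · obtain ⟨rfl, h1⟩ := h1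
    congr 2
    ext; exact h1.symm

/-- A reduced closed path that takes an edge of a Rips relator in the forward direction keeps
running around the relator. -/
theorem rip_tour (h : LineGraph.IsTour (model r J σ) δ P) {ρ : RelIdx m n}
    {s : Fin (syl r ρ).length} (h0 : δ 0 = (.rip ρ s, true)) (j : ℕ) :
    δ j = (.rip ρ ⟨(s + j) % (syl r ρ).length, Nat.mod_lt _ (by have := s.2; omega)⟩, true) := by
  induction j with
  | zero => rw [h0]; congr 2; ext; simp [Nat.mod_eq_of_lt s.2]
  | succ j ih => rw [rip_succ h ih]; congr 3; simp [← add_assoc]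

theorem chain_succ_true (h : LineGraph.IsTour (model r J σ) δ P) {j : ℕ} {k : Fin K}
    (hj : δ j = (.chain k, true)) :
    (∃ k' : Fin K, (k' : ℕ) = k + 1 ∧ δ (j + 1) = (.chain k', true)) ∨
      ∃ i, δ (j + 1) = (.br i 0, true) := by
  have h1 := h.adj j
  have h2 := h.red j
  rw [hj] at h1 h2
  rcases hd : δ (j + 1) with ⟨⟨i, s'⟩ | ⟨i, s'⟩ | k' | ⟨ρ', s'⟩, _ | _⟩ <;> rw [hd] at h1 h2 <;>
    try fin_cases s'
  all_goals simp [LineGraph.dtgt, LineGraph.dsrc, model, edSrc, edTgt] at h1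
  · exact Or.inr ⟨i, rfl⟩
  · exact absurd (by rw [Fin.ext h1]; rfl) h2
  · exact Or.inl ⟨k', h1.symm, rfl⟩

theorem chain_succ_false (h : LineGraph.IsTour (model r J σ) δ P) {j : ℕ} {k : Fin K}
    (hj : δ j = (.chain k, false)) :
    (∃ k' : Fin K, (k : ℕ) = k' + 1 ∧ δ (j + 1) = (.chain k', false)) ∨
      ∃ i, δ (j + 1) = (.br i 0, true) := by
  have h1 := h.adj j
  have h2 := h.red j
  rw [hj] at h1 h2
  rcases hd : δ (j + 1) with ⟨⟨i, s'⟩ | ⟨i, s'⟩ | k' | ⟨ρ', s'⟩, _ | _⟩ <;> rw [hd] at h1 h2 <;>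
    try fin_cases s'
  all_goals simp [LineGraph.dtgt, LineGraph.dsrc, model, edSrc, edTgt] at h1
  · exact Or.inr ⟨i, rfl⟩
  · exact Or.inl ⟨k', h1, rfl⟩
  · exact absurd (by rw [Fin.ext h1]; rfl) h2

theorem br_succ_true (h : LineGraph.IsTour (model r J σ) δ P) {j : ℕ} {i : Fin K} {s : Fin 4}
    (hs : s ≠ 3) (hj : δ j = (.br i s, true)) : δ (j + 1) = (.br i (s + 1), true) := by
  have h1 := h.adj j
  have h2 := h.red j
  rw [hj] at h1 h2
  rcases hd : δ (j + 1) with ⟨⟨i', s'⟩ | ⟨i', s'⟩ | k' | ⟨ρ', s'⟩, _ | _⟩ <;> rw [hd] at h1 h2 <;>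
    (try fin_cases s') <;> fin_cases s
  all_goals simp [LineGraph.dtgt, LineGraph.dsrc, model, edSrc, edTgt, flipLetter] at h1 h2 hs ⊢
  all_goals first | exact absurd h1.symm h2 | exact h1.symm

theorem br_succ_false (h : LineGraph.IsTour (model r J σ) δ P) {j : ℕ} {i : Fin K} {s : Fin 4}
    (hs : s ≠ 0) (hj : δ j = (.br i s, false)) : δ (j + 1) = (.br i (s - 1), false) := by
  have h1 := h.adj j
  have h2 := h.red j
  rw [hj] at h1 h2
  rcases hd : δ (j + 1) with ⟨⟨i', s'⟩ | ⟨i', s'⟩ | k' | ⟨ρ', s'⟩, _ | _⟩ <;> rw [hd] at h1 h2 <;>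
    (try fin_cases s') <;> fin_cases s
  all_goals simp [LineGraph.dtgt, LineGraph.dsrc, model, edSrc, edTgt, flipLetter] at h1 h2 hs ⊢
  all_goals first | exact absurd h1.symm h2 | exact h1.symm

theorem br_zero_succ_false (h : LineGraph.IsTour (model r J σ) δ P) {j : ℕ} {i : Fin K}
    (hj : δ j = (.br i 0, false)) : ∃ k c, δ (j + 1) = (.chain k, c) := by
  have h1 := h.adj j
  have h2 := h.red j
  rw [hj] at h1 h2
  rcases hd : δ (j + 1) with ⟨⟨i', s'⟩ | ⟨i', s'⟩ | k' | ⟨ρ', s'⟩, _ | _⟩ <;> rw [hd] at h1 h2 <;>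
    (try fin_cases s')
  all_goals simp [LineGraph.dtgt, LineGraph.dsrc, model, edSrc, edTgt, flipLetter] at h1 h2 ⊢
  exact h2 (Fin.ext h1.symm)

/-- A reduced path that runs along the chain leaves it again. -/
theorem exists_leave_chain (h : LineGraph.IsTour (model r J σ) δ P) {j : ℕ} {k : Fin K} {c : Bool}
    (hj : δ j = (.chain k, c)) : ∃ j' > j, (∃ i, δ j' = (.br i 0, true)) ∧
      ∀ x, j ≤ x → x < j' → ∃ k c, δ x = (.chain k, c) := by
  have step : ∀ {j : ℕ} {k k' : Fin K} {c c' : Bool}, δ j = (.chain k, c) →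
      (∃ j' > j + 1, (∃ i, δ j' = (.br i 0, true)) ∧
        ∀ x, j + 1 ≤ x → x < j' → ∃ k c, δ x = (.chain k, c)) →
      ∃ j' > j, (∃ i, δ j' = (.br i 0, true)) ∧
        ∀ x, j ≤ x → x < j' → ∃ k c, δ x = (.chain k, c) := by
    rintro j k k' c c' hj ⟨j', h1, h2, h3⟩
    refine ⟨j', by omega, h2, fun x hx hx' => ?_⟩
    rcases eq_or_lt_of_le hx with rfl | h4
    · exact ⟨k, c, hj⟩
    · exact h3 x h4 hx'
  have leave : ∀ {j : ℕ} {k : Fin K} {c : Bool}, δ j = (.chain k, c) →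
      (∃ i, δ (j + 1) = (.br i 0, true)) →
      ∃ j' > j, (∃ i, δ j' = (.br i 0, true)) ∧
        ∀ x, j ≤ x → x < j' → ∃ k c, δ x = (.chain k, c) := by
    intro j k c hj hi
    exact ⟨j + 1, by omega, hi, fun x hx hx' => ⟨k, c, by rwa [show x = j by omega]⟩⟩
  cases c with
  | true =>
    generalize hd : K - k = d
    induction d generalizing j k with
    | zero => have := k.2; omega
    | succ d ih =>
      rcases chain_succ_true h hj with ⟨k', hk', hj'⟩ | hi
      · exact step (k' := k) (c' := true) hj (ih hj' (by omega))
      · exact leave hj hi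
  | false =>
    generalize hd : (k : ℕ) = d
    induction d generalizing j k with
    | zero =>
      rcases chain_succ_false h hj with ⟨k', hk', hj'⟩ | hi
      · omega
      · exact leave hj hi
    | succ d ih =>
      rcases chain_succ_false h hj with ⟨k', hk', hj'⟩ | hi
      · exact step (k' := k) (c' := true) hj (ih hj' (by omega))
      · exact leave hj hi

theorem y_dtgt (i : Fin K) (s : Fin 4) (c : Bool) :
    ((model r J σ).dtgt (.y i s, c)).1 = .main ((cover σ).dartTgt ((i, s), c)) := by
  fin_cases s <;> cases c <;> rfl

theorem y_dsrc (i : Fin K) (s : Fin 4) (c : Bool) :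
    ((model r J σ).dsrc (.y i s, c)).1 = .main ((cover σ).dartSrc ((i, s), c)) := by
  fin_cases s <;> cases c <;> rfl

/-- The oriented edge of `Θ` labelled `y_s` (for `c = true`) or `y_s⁻¹` ends at position `0` or
`10^(J+10i)` of a line `main i`. Another edge starts there, so that no power of `a` is read between
the two: `y_0` can follow `y_3`, and `y_1` can follow `y_2`, or inversely. -/
def passes (s : Fin 4) (c : Bool) : Prop := (s = 3 ∧ c = true) ∨ (s = 0 ∧ c = false) ∨
  (s = 2 ∧ c = true) ∨ (s = 1 ∧ c = false)

/-- Of two consecutive oriented edges without a power of `a` between them, only the first one ends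
at a point where this is possible. So there are no three such edges in a row. -/
theorem passes_of_eq {i i' : Fin K} {s s' : Fin 4} {c c' : Bool}
    (h : (model r J σ).dtgt (.y i s, c) = (model r J σ).dsrc (.y i' s', c'))
    (hne : ((.y i' s', c') : Ed r K × Bool) ≠ flipLetter (.y i s, c)) :
    passes s c ∧ ¬ passes s' c' := by
  fin_cases s <;> cases c <;> fin_cases s' <;> cases c' <;>
    simp [LineGraph.dtgt, LineGraph.dsrc, model, edSrc, edTgt, flipLetter, passes] at h hne ⊢
  all_goals first | exact absurd h hne | exact absurd h.symm hne

theorem isPath_range' {f : ℕ → (Fin K × Fin 4) × Bool}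
    (hf : ∀ j, (cover σ).dartTgt (f j) = (cover σ).dartSrc (f (j + 1))) (k N : ℕ) :
    (cover σ).IsPath ((cover σ).dartSrc (f k)) ((List.range' k N).map f)
      ((cover σ).dartSrc (f (k + N))) := by
  induction N generalizing k with
  | zero => rfl
  | succ N ih =>
    refine ⟨rfl, ?_⟩
    have := ih (k + 1)
    rw [← hf] at this
    rwa [show k + 1 + N = k + (N + 1) by ring] at this

/-- A tour that uses edges of `Θ` only is a reduced cycle of `Θ`. -/
theorem le_of_girth (hgirth : ∀ v p, (cover σ).IsReducedCycle v p → 19 ≤ p.length)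
    (h : LineGraph.IsTour (model r J σ) δ P) {f : ℕ → (Fin K × Fin 4) × Bool}
    (hf : ∀ j, δ j = (.y (f j).1.1 (f j).1.2, (f j).2)) : 19 ≤ P := by
  have hadj : ∀ j, (cover σ).dartTgt (f j) = (cover σ).dartSrc (f (j + 1)) := fun j => by
    have := h.adj j
    rw [hf, hf, y_dtgt, y_dsrc] at this
    exact Line.main.inj this
  have h0 : f P = f 0 := by
    have := h.per
    rw [hf, hf] at this
    simp only [Prod.mk.injEq, Ed.y.injEq] at this
    exact Prod.ext (Prod.ext this.1.1 this.1.2) this.2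
  have := hgirth ((cover σ).dartSrc (f 0)) ((List.range' 0 P).map f) ⟨?_, ?_, ?_⟩
  · simpa using this
  · intro h1
    have h2 := congrArg List.length h1
    have := h.pos
    simp at h2; omega
  · have := isPath_range' hadj 0 P
    rwa [zero_add, h0] at this
  · rw [FreeGroup.IsReduced, List.isChain_iff_getElem]
    intro i hi
    simp only [List.getElem_map, List.getElem_range', zero_add, one_mul]
    intro h1
    by_contra h2
    apply h.red i
    rw [hf, hf, h1]
    refine Prod.ext rfl ?_
    simp only [flipLetter]
    cases h3 : (f i).2 <;> cases h4 : (f (i + 1)).2 <;> simp_all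

end

section

variable {m n K : ℕ} (r : Fin n → FreeGroup (Fin m)) (J : ℕ) (σ : Fin 4 → Equiv.Perm (Fin K))
  (hnm : 9 * (n + 4 * m) < 10 ^ J)
  {v : ℤ → Line m n K × ℤ} {l : ℤ → Gen m × Bool} {N : ℤ}
  (hp : IsPeriodicPath (model r J σ).Step v l N)
include hnm hp

/-- The ten letters `b` at the end of a Rips relator give nine good places. -/
theorem rigid_of_rip {z : ℤ} {ρ : RelIdx m n} {s : Fin (syl r ρ).length}
    (h : (model r J σ).At v l z (.rip ρ s, true)) :
    ∃ s t, IsRigidFamily (model r J σ).Step v l N s t := by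
  have hlen := length_syl r ρ
  have hs := s.2
  obtain ⟨δ, P, hT, h0, hat, -⟩ := LineGraph.exists_tour (folded r J σ) (sidon r J σ hnm) hp h
  obtain ⟨z', hz'⟩ := hat ((syl r ρ).length - s + (headSyl r ρ).length)
  have e1 : ((s : ℕ) + ((syl r ρ).length - s + (headSyl r ρ).length)) % (syl r ρ).length =
      (headSyl r ρ).length := by
    rw [show (s : ℕ) + ((syl r ρ).length - s + (headSyl r ρ).length) =
      (headSyl r ρ).length + (syl r ρ).length by omega, Nat.add_mod_right,
      Nat.mod_eq_of_lt (by omega)]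
  rw [rip_tour hT h0] at hz'
  simp only [e1] at hz'
  clear hat h0 hT
  obtain ⟨δ, P, hT, h0, -, hfam⟩ := LineGraph.exists_tour (folded r J σ) (sidon r J σ hnm) hp hz'
  have hδ : ∀ j (hj : (headSyl r ρ).length + j < (syl r ρ).length),
      δ j = (.rip ρ ⟨(headSyl r ρ).length + j, hj⟩, true) := fun j hj => by
    rw [rip_tour hT h0]
    simp only [Nat.mod_eq_of_lt hj]
  have hP : 10 ≤ P := by
    by_contra hcon
    have h1 := hT.per
    rw [hδ P (by omega), h0] at h1
    simp only [Prod.mk.injEq, Ed.rip.injEq, heq_eq_eq, Fin.mk.injEq, true_and, and_true] at h1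
    have := hT.pos
    omega
  refine hfam (fun k => k) (fun k _ => by omega) (by omega) (fun k hk => ?_)
  have e1 := hδ k (by omega)
  have e2 := hδ (k + 1) (by omega)
  have t1 := syl_tail r ρ k (by omega)
  have t2 := syl_tail r ρ (k + 1) (by omega)
  refine ⟨?_, ?_, ?_⟩
  · rw [e1]; simp [LineGraph.dlet, model, edLetter, t1]
  · rw [e2]; simp only [LineGraph.dlet, model, edLetter, if_true, Fin.getElem_fin, t2]
  · rw [e1, e2]
    simp only [LineGraph.dtgt, LineGraph.dsrc, model, edSrc, edTgt, if_true, Fin.getElem_fin, t2]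
    omega

/-- A reduced closed path that uses an edge of one of the paths `c_i` runs through the end of such a
path in the forward direction. -/
theorem exists_br {z : ℤ} {δ₀ : Ed r K × Bool}
    (h : (model r J σ).At v l z δ₀) (hδ₀ : (∃ i s, δ₀.1 = .br i s) ∨ ∃ k, δ₀.1 = .chain k) :
    ∃ z i, (model r J σ).At v l z (.br i 3, true) := by
  obtain ⟨δ, P, hT, h0, hat, -⟩ := LineGraph.exists_tour (folded r J σ) (sidon r J σ hnm) hp h
  suffices ∃ j i, δ j = (.br i 3, true) by
    obtain ⟨j, i, hj⟩ := this
    obtain ⟨z, hz⟩ := hat j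
    exact ⟨z, i, hj ▸ hz⟩
  have up : ∀ j i s, δ j = (.br i s, true) → ∃ j i, δ j = (.br i 3, true) := by
    intro j i s hj
    fin_cases s
    · exact ⟨j + 3, i, br_succ_true hT (by decide) (br_succ_true hT (by decide)
        (br_succ_true hT (by decide) hj))⟩
    · exact ⟨j + 2, i, br_succ_true hT (by decide) (br_succ_true hT (by decide) hj)⟩
    · exact ⟨j + 1, i, br_succ_true hT (by decide) hj⟩
    · exact ⟨j, i, hj⟩
  have ch : ∀ j k c, δ j = (.chain k, c) → ∃ j i, δ j = (.br i 3, true) := by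
    intro j k c hj
    obtain ⟨j', -, ⟨i, hi⟩, -⟩ := exists_leave_chain hT hj
    exact up j' i 0 hi
  have down : ∀ j i, δ j = (.br i 0, false) → ∃ j i, δ j = (.br i 3, true) := by
    intro j i hj
    obtain ⟨k, c, hk⟩ := br_zero_succ_false hT hj
    exact ch _ _ _ hk
  obtain ⟨e, c⟩ := δ₀
  rcases hδ₀ with ⟨i, s, rfl⟩ | ⟨k, rfl⟩
  · cases c with
    | true => exact up 0 i s h0
    | false =>
      fin_cases s
      · exact down 0 i h0
      · exact down 1 i (br_succ_false hT (by decide) h0)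
      · exact down 2 i (br_succ_false hT (by decide) (br_succ_false hT (by decide) h0))
      · exact down 3 i (br_succ_false hT (by decide) (br_succ_false hT (by decide)
          (br_succ_false hT (by decide) h0)))
  · exact ch 0 k c h0

/-- A reduced closed path that enters `c_i` from its end goes down to the chain and up again along
some `c_(i')`. The four powers of `a` on the way down and the first three on the way up, between the
chain and the edge `br i' 2`, are good places. -/
theorem rigid_of_br {z : ℤ} {i : Fin K} (h : (model r J σ).At v l z (.br i 3, false)) :
    ∃ s t, IsRigidFamily (model r J σ).Step v l N s t := by
  obtain ⟨δ, P, hT, h0, -, hfam⟩ := LineGraph.exists_tour (folded r J σ) (sidon r J σ hnm) hp h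
  have h1 : δ 1 = (.br i 2, false) := br_succ_false hT (by decide) h0
  have h2 : δ 2 = (.br i 1, false) := br_succ_false hT (by decide) h1
  have h3 : δ 3 = (.br i 0, false) := br_succ_false hT (by decide) h2
  obtain ⟨k, c, h4⟩ := br_zero_succ_false hT h3
  obtain ⟨j, hj, ⟨i', e0⟩, hch⟩ := exists_leave_chain hT h4
  have e1 : δ (j + 1) = (.br i' 1, true) := br_succ_true hT (by decide) e0
  have e2 : δ (j + 2) = (.br i' 2, true) := br_succ_true hT (by decide) e1
  obtain ⟨k', c', e3⟩ := hch (j - 1) (by omega) (by omega)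
  have hP : j + 2 < P := by
    by_contra hcon
    have hper := hT.per
    rw [h0] at hper
    have := hT.pos
    have hcases : P = 1 ∨ P = 2 ∨ P = 3 ∨
        (4 ≤ P ∧ P < j) ∨ P = j ∨ P = j + 1 ∨ P = j + 2 := by omega
    rcases hcases with hP | hP | hP | ⟨hP, hP'⟩ | hP | hP | hP
    · rw [hP, h1] at hper; simp at hper
    · rw [hP, h2] at hper; simp at hper
    · rw [hP, h3] at hper; simp at hper
    · obtain ⟨k, c, hk⟩ := hch P hP hP'
      rw [hk] at hper; simp at hper
    · rw [hP, e0] at hper; simp at hper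
    · rw [hP, e1] at hper; simp at hper
    · rw [hP, e2] at hper; simp at hper
  have hj1 : j - 1 + 1 = j := by omega
  refine hfam (fun k => if k < 4 then k else j - 1 + (k - 4)) (fun k hk => ?_) ?_ (fun k hk => ?_)
  · split_ifs <;> omega
  · simp; omega
  · interval_cases k <;> simp only [LineGraph.Good, Nat.reduceLT, if_true, if_false, Nat.reduceSub,
      Nat.reduceAdd, add_zero, h0, h1, h2, h3, h4, hj1, e3, e0]
    · simp [LineGraph.dlet, LineGraph.dtgt, LineGraph.dsrc, model, edLetter, edSrc, edTgt,
        flipLetter]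
    · simp [LineGraph.dlet, LineGraph.dtgt, LineGraph.dsrc, model, edLetter, edSrc, edTgt,
        flipLetter]
    · simp [LineGraph.dlet, LineGraph.dtgt, LineGraph.dsrc, model, edLetter, edSrc, edTgt,
        flipLetter]
    · cases c <;> simp [LineGraph.dlet, LineGraph.dtgt, LineGraph.dsrc, model, edLetter, edSrc,
        edTgt, flipLetter]
    · cases c' <;> simp [LineGraph.dlet, LineGraph.dtgt, LineGraph.dsrc, model, edLetter, edSrc,
        edTgt, flipLetter]
    · simp [LineGraph.dlet, LineGraph.dtgt, LineGraph.dsrc, model, edLetter, edSrc, edTgt, e1]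
    · rw [show j - 1 + 2 = j + 1 by omega]
      simp [LineGraph.dlet, LineGraph.dtgt, LineGraph.dsrc, model, edLetter, edSrc, edTgt, e1, e2]

theorem rigid_of_y (hgirth : ∀ v p, (cover σ).IsReducedCycle v p → 19 ≤ p.length)
    (hy : ∀ z δ, (model r J σ).At v l z δ → ∃ i s, δ.1 = .y i s) :
    ∃ s t, IsRigidFamily (model r J σ).Step v l N s t := by
  obtain ⟨z, δ₀, h⟩ := LineGraph.exists_at hp
  obtain ⟨δ, P, hT, h0, hat, hfam⟩ := LineGraph.exists_tour (folded r J σ) (sidon r J σ hnm) hp h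
  have hf : ∀ j, ∃ f : (Fin K × Fin 4) × Bool, δ j = (.y f.1.1 f.1.2, f.2) := fun j => by
    obtain ⟨z, hz⟩ := hat j
    obtain ⟨i, s, his⟩ := hy z _ hz
    exact ⟨((i, s), (δ j).2), Prod.ext his rfl⟩
  choose f hf using hf
  have hP := le_of_girth hgirth hT hf
  have hlet : ∀ j, ((model r J σ).dlet (δ j)).1 = Gen.b := fun j => by
    rw [hf]; cases (f j).2 <;> rfl
  have hgood : ∀ k, ∃ x, 2 * k ≤ x ∧ x < 2 * k + 2 ∧ (model r J σ).Good Gen.b δ x := by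
    intro k
    by_contra hcon
    have key : ∀ x, 2 * k ≤ x → x < 2 * k + 2 → passes (f x).1.2 (f x).2 ∧
        ¬ passes (f (x + 1)).1.2 (f (x + 1)).2 := by
      intro x h1 h2
      have h3 : ((model r J σ).dtgt (δ x)).2 = ((model r J σ).dsrc (δ (x + 1))).2 := by
        by_contra h4
        exact hcon ⟨x, h1, h2, hlet _, hlet _, h4⟩
      have h4 := hT.red x
      have h5 : (model r J σ).dtgt (δ x) = (model r J σ).dsrc (δ (x + 1)) := Prod.ext (hT.adj x) h3
      rw [hf, hf] at h4 h5
      exact passes_of_eq h5 h4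
    exact (key (2 * k) le_rfl (by omega)).2 (key (2 * k + 1) (by omega) (by omega)).1
  choose x hx1 hx2 hx3 using hgood
  refine hfam x (fun k _ => ?_) ?_ (fun k _ => hx3 k)
  · have := hx2 k; have := hx1 (k + 1); omega
  · have := hx2 6; omega

end

/-- Where a Rips relator is traversed backwards or a path `c_i` forwards, the inverse path is
considered instead. -/
theorem smallCancellation {m n K : ℕ} (r : Fin n → FreeGroup (Fin m)) (J : ℕ)
    (σ : Fin 4 → Equiv.Perm (Fin K)) (hnm : 9 * (n + 4 * m) < 10 ^ J)
    (hgirth : ∀ v p, (cover σ).IsReducedCycle v p → 19 ≤ p.length) :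
    SmallCancellation (model r J σ).Step := by
  intro v l N hp
  have hsymm := (model r J σ).step_symm
  have hdet := LineGraph.step_det (folded r J σ)
  have hp' := hp.reverse hsymm
  by_cases h1 : ∃ z ρ s c, (model r J σ).At v l z (.rip ρ s, c)
  · obtain ⟨z, ρ, s, _ | _, h⟩ := h1
    · obtain ⟨s, t, hst⟩ := rigid_of_rip r J σ hnm hp' h.reverse
      exact ⟨_, _, hst.of_reverse hsymm hdet hp⟩
    · exact rigid_of_rip r J σ hnm hp h
  by_cases h2 : ∃ z δ, (model r J σ).At v l z δ ∧ ((∃ i s, δ.1 = .br i s) ∨ ∃ k, δ.1 = .chain k)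
  · obtain ⟨z, δ, h, hδ⟩ := h2
    obtain ⟨z', i, h'⟩ := exists_br r J σ hnm hp h hδ
    obtain ⟨s, t, hst⟩ := rigid_of_br r J σ hnm hp' h'.reverse
    exact ⟨_, _, hst.of_reverse hsymm hdet hp⟩
  refine rigid_of_y r J σ hnm hp hgirth fun z δ hδ => ?_
  rcases hd : δ with ⟨⟨i, s'⟩ | ⟨i, s'⟩ | k' | ⟨ρ', s'⟩, c⟩
  · exact ⟨i, s', rfl⟩
  · exact absurd ⟨z, δ, hδ, Or.inl ⟨i, s', by rw [hd]⟩⟩ h2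
  · exact absurd ⟨z, δ, hδ, Or.inr ⟨k', by rw [hd]⟩⟩ h2
  · exact absurd ⟨z, ρ', s', c, hd ▸ hδ⟩ h1

end RipsSegev

namespace LabelledGraph

open VanKampen

/-! ### Paths in labelled graphs and their subdivisions and foldings -/

variable {α V : Type} {Γ Δ : LabelledGraph α} {Step : V → α × Bool → V → Prop}

/-- The labelled oriented edges of a graph. -/
def Dart (Γ : LabelledGraph α) (u : Γ.V) (l : α × Bool) (v : Γ.V) : Prop :=
  ∃ d : Γ.E × Bool, (Γ.lab d.1, d.2) = l ∧ Γ.dartSrc d = u ∧ Γ.dartTgt d = v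

theorem reads_dart_iff {u v : Γ.V} {w : List (α × Bool)} :
    Reads Γ.Dart u w v ↔ ∃ p, Γ.IsPath u p v ∧ p.map (fun d => (Γ.lab d.1, d.2)) = w := by
  induction w generalizing u with
  | nil => exact ⟨fun h => ⟨[], h, rfl⟩, fun ⟨p, h1, h2⟩ => by
      rw [List.map_eq_nil_iff] at h2; subst h2; exact h1⟩
  | cons l w ih =>
    constructor
    · rintro ⟨u', ⟨d, h1, h2, rfl⟩, h3⟩
      obtain ⟨p, hp, hw⟩ := ih.1 h3
      exact ⟨d :: p, ⟨h2, hp⟩, by rw [List.map_cons, h1, hw]⟩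
    · rintro ⟨p, h1, h2⟩
      obtain ⟨d, q, rfl, hd, hq⟩ := List.map_eq_cons_iff.1 h2
      exact ⟨_, ⟨d, hd, h1.1, rfl⟩, ih.2 ⟨q, h1.2, hq⟩⟩

theorem dart_symm (u : Γ.V) (l : α × Bool) (v : Γ.V) (h : Γ.Dart u l v) :
    Γ.Dart v (flipLetter l) u := by
  obtain ⟨⟨e, _ | _⟩, rfl, rfl, rfl⟩ := h
  · exact ⟨(e, true), rfl, rfl, rfl⟩
  · exact ⟨(e, false), rfl, rfl, rfl⟩

theorem dart_edge (e : Γ.E) : Γ.Dart (Γ.src e) (Γ.lab e, true) (Γ.tgt e) :=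
  ⟨(e, true), rfl, rfl, rfl⟩

theorem _root_.VanKampen.Reads.map {V V' : Type} {S : V → α × Bool → V → Prop}
    {S' : V' → α × Bool → V' → Prop} {f : V → V'} (hf : ∀ u l v, S u l v → S' (f u) l (f v))
    {u v : V} {w : List (α × Bool)} (h : Reads S u w v) : Reads S' (f u) w (f v) := by
  induction w generalizing u with
  | nil => exact congrArg f h
  | cons l w ih => obtain ⟨u', h1, h2⟩ := h; exact ⟨f u', hf _ _ _ h1, ih h2⟩

theorem _root_.VanKampen.Reads.of_pos {V : Type} {S : V → α × Bool → V → Prop}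
    {w : List (α × Bool)} {pos : ℕ → V}
    (h : ∀ i (hi : i < w.length), S (pos i) w[i] (pos (i + 1))) :
    Reads S (pos 0) w (pos w.length) := by
  induction w generalizing pos with
  | nil => rfl
  | cons l w ih =>
    exact ⟨pos 1, h 0 (by simp), ih (pos := fun i => pos (i + 1))
      fun i hi => h (i + 1) (by simpa using hi)⟩

/-- The label of a closed path, reduced or not, is a consequence of the labels of the reduced
cycles: removing backtracks changes neither the endpoints nor the label. -/
theorem mk_mem_normalClosure {v : Γ.V} {w : List (α × Bool)} (h : Reads Γ.Dart v w v) :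
    FreeGroup.mk w ∈ Subgroup.normalClosure Γ.cycleLabels := by
  classical
  obtain ⟨p, hp, rfl⟩ := reads_dart_iff.1 h
  have hstep : ∀ (q q' : List (Γ.E × Bool)), FreeGroup.Red.Step q q' → ∀ u, Γ.IsPath u q v →
      Γ.IsPath u q' v := by
    rintro _ _ ⟨⟩ u hu
    rename_i L L' e c
    induction L generalizing u with
    | nil => cases c <;> (obtain ⟨rfl, -, h⟩ := hu; exact h)
    | cons d L ih => exact ⟨hu.1, ih _ hu.2⟩
  have hred : ∀ q', FreeGroup.Red p q' → Γ.IsPath v q' v := by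
    intro q' hq
    induction hq with
    | refl => exact hp
    | tail _ h ih => exact hstep _ _ h _ ih
  have h1 := hred _ FreeGroup.reduce.red
  have h2 : FreeGroup.mk (p.map fun d => (Γ.lab d.1, d.2)) = Γ.pathLabel (FreeGroup.reduce p) := by
    have := congrArg (FreeGroup.map Γ.lab) (FreeGroup.reduce.self (L := p))
    rw [FreeGroup.map.mk, FreeGroup.map.mk] at this
    exact this.symm
  rw [h2]
  by_cases h3 : FreeGroup.reduce p = []
  · rw [h3]; exact one_mem _
  · exact Subgroup.subset_normalClosure ⟨v, _,
      ⟨h3, h1, FreeGroup.IsReduced.of_reduce_eq FreeGroup.reduce.idem⟩, rfl⟩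

theorem dart_hom (hsymm : ∀ u l v, Step u l v → Step v (flipLetter l) u) {ψ : Γ.V → V}
    (hψ : ∀ e, Step (ψ (Γ.src e)) (Γ.lab e, true) (ψ (Γ.tgt e)))
    (u : Γ.V) (l : α × Bool) (v : Γ.V) (h : Γ.Dart u l v) : Step (ψ u) l (ψ v) := by
  obtain ⟨⟨e, _ | _⟩, rfl, rfl, rfl⟩ := h
  · exact hsymm _ _ _ (hψ e)
  · exact hψ e

theorem cycleLabels_subset (hsymm : ∀ u l v, Step u l v → Step v (flipLetter l) u) {ψ : Γ.V → V}
    (hψ : ∀ e, Step (ψ (Γ.src e)) (Γ.lab e, true) (ψ (Γ.tgt e))) :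
    Γ.cycleLabels ⊆ closedLabels Step := by
  rintro _ ⟨v, p, h, rfl⟩
  exact ⟨ψ v, _, Reads.map (dart_hom hsymm hψ) (reads_dart_iff.2 ⟨p, h.2.1, rfl⟩), rfl⟩

/-- A label preserving map to a graph in which no foldings are possible factors through the
foldings. -/
theorem exists_hom_fold (hsymm : ∀ u l v, Step u l v → Step v (flipLetter l) u)
    (hdet : ∀ u l v v', Step u l v → Step u l v' → v = v') {ψ : Γ.V → V}
    (hψ : ∀ e, Step (ψ (Γ.src e)) (Γ.lab e, true) (ψ (Γ.tgt e))) :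
    ∃ ψ' : Γ.fold.V → V, ∀ e,
      Step (ψ' (Γ.fold.src e)) (Γ.fold.lab e, true) (ψ' (Γ.fold.tgt e)) := by
  have key : ∀ u v, Γ.FoldRel u v → ψ u = ψ v := by
    intro u v h
    induction h with
    | refl => rfl
    | symm _ ih => exact ih.symm
    | trans _ _ ih ih' => exact ih.trans ih'
    | @out e f hl _ ih =>
      have h1 := hψ e
      rw [ih, hl] at h1
      exact hdet _ _ _ _ h1 (hψ f)
    | @into e f hl _ ih =>
      have h1 := hsymm _ _ _ (hψ e)
      rw [ih, hl] at h1
      exact hdet _ _ _ _ h1 (hsymm _ _ _ (hψ f))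
  refine ⟨Quotient.lift ψ key, fun e => ?_⟩
  induction e using Quotient.ind
  exact hψ _

/-- If words can be read between the images of the vertices, the subdivided graph maps to `Step`. -/
theorem exists_hom_subdivide {Γ : LabelledGraph (List (α × Bool))}
    (hsymm : ∀ u l v, Step u l v → Step v (flipLetter l) u) {ψ : Γ.V → V}
    (hψ : ∀ e, Reads Step (ψ (Γ.src e)) (Γ.lab e) (ψ (Γ.tgt e))) :
    ∃ ψ' : Γ.subdivide.V → V, ∀ e,
      Step (ψ' (Γ.subdivide.src e)) (Γ.subdivide.lab e, true) (ψ' (Γ.subdivide.tgt e)) := by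
  choose pos h0 h1 hpos using fun e => (hψ e).exists_pos
  let ψ' : Γ.subdivide.V → V := Sum.elim ψ fun x => pos x.1 (x.2 + 1)
  have key : ∀ e k, k ≤ (Γ.lab e).length → ψ' (Γ.subPos e k) = pos e k := by
    intro e k hk
    unfold subPos
    split_ifs with hk0 hk1
    · rw [hk0, h0]; rfl
    · show pos e (k - 1 + 1) = _
      rw [Nat.sub_add_cancel (by omega)]
    · rw [show k = (Γ.lab e).length by omega, h1]; rfl
  refine ⟨ψ', fun ⟨e, k⟩ => ?_⟩
  have h2 := hpos e k k.2
  rw [← key e k k.2.le, ← key e (k + 1) k.2] at h2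
  simp only [subdivide, List.get_eq_getElem]
  generalize hl : (Γ.lab e)[(k : ℕ)] = l at h2
  rcases l with ⟨x, _ | _⟩
  · exact hsymm _ _ _ h2
  · exact h2

theorem reads_subdivide {Γ : LabelledGraph (List (α × Bool))} (e : Γ.E) (he : Γ.lab e ≠ []) :
    Reads Γ.subdivide.Dart (.inl (Γ.src e)) (Γ.lab e) (.inl (Γ.tgt e)) := by
  have h0 : Γ.subPos e 0 = .inl (Γ.src e) := by simp [subPos]
  have h1 : Γ.subPos e (Γ.lab e).length = .inl (Γ.tgt e) := by simp [subPos, he]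
  rw [← h0, ← h1]
  refine Reads.of_pos fun i hi => ?_
  refine ⟨(⟨e, ⟨i, hi⟩⟩, (Γ.lab e)[i].2), rfl, ?_, ?_⟩ <;>
    cases hl : (Γ.lab e)[i].2 <;> simp [dartSrc, dartTgt, subdivide, hl]

theorem dart_fold (u : Γ.V) (l : α × Bool) (v : Γ.V) (h : Γ.Dart u l v) :
    Γ.fold.Dart (Quotient.mk _ u) l (Quotient.mk _ v) :=
  dart_hom (Step := Γ.fold.Dart) (ψ := fun u => (Quotient.mk Γ.foldV u : Γ.fold.V)) dart_symm
    (fun e => dart_edge (Γ := Γ.fold) (Quotient.mk _ e)) u l v h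

theorem dart_inl (u : Γ.V) (l : α × Bool) (v : Γ.V) (h : Γ.Dart u l v) :
    (Γ.disjUnion Δ).Dart (.inl u) l (.inl v) :=
  dart_hom (Step := (Γ.disjUnion Δ).Dart) (ψ := fun u => (.inl u : (Γ.disjUnion Δ).V)) dart_symm
    (fun e => dart_edge (Γ := Γ.disjUnion Δ) (.inl e)) u l v h

end LabelledGraph

namespace RipsSegev

open VanKampen

/-! ### The words of the construction read in the model -/

section

variable {m n K : ℕ} (r : Fin n → FreeGroup (Fin m)) (J : ℕ) (σ : Fin 4 → Equiv.Perm (Fin K))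

theorem reads_apow (L : Line m n K) (t : ℤ) (k : ℕ) :
    Reads (model r J σ).Step (L, t) (apow k) (L, t + k) := by
  induction k generalizing t with
  | zero => show (L, t) = _; simp
  | succ k ih =>
    refine ⟨(L, t + 1), Or.inl ⟨rfl, rfl⟩, ?_⟩
    have := ih (t + 1)
    rwa [add_assoc, add_comm 1 (k : ℤ)] at this

theorem reads_apow_pw (L : Line m n K) {i : Fin K} {e : Fin 10} {x : ℕ} (hx : x = pw J i e) :
    Reads (model r J σ).Step (L, 0) (apow x) (L, pw J i e) := by
  have := reads_apow r J σ L 0 x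
  rwa [zero_add, hx] at this

theorem invRev_apow (k : ℕ) : FreeGroup.invRev (apow (m := m) k) = ainv k := by
  simp [FreeGroup.invRev, apow, ainv]

theorem reads_ainv_pw (L : Line m n K) {i : Fin K} {e : Fin 10} {x : ℕ} (hx : x = pw J i e) :
    Reads (model r J σ).Step (L, pw J i e) (ainv x) (L, 0) := by
  rw [← invRev_apow]
  exact (reads_apow_pw r J σ L hx).invRev (model r J σ).step_symm

theorem reads_edge {e : Ed r K} (h : edLetter r e = (Gen.b, true)) :
    Reads (model r J σ).Step (edSrc r J e) (bpow 1) (edTgt r J σ e) :=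
  ⟨_, Or.inr ⟨(e, true), h, rfl, rfl⟩, rfl⟩

theorem reads_chain (k : ℕ) (hk : k ≤ K) :
    Reads (model r J σ).Step (.chain 0, 0) (bpow k) (.chain k, 0) := by
  induction k with
  | zero => rfl
  | succ k ih =>
    rw [bpow, List.replicate_succ']
    exact (ih (by omega)).append (reads_edge r J σ (e := .chain ⟨k, hk⟩) rfl)

theorem reads_cWord (i : Fin K) :
    Reads (model r J σ).Step (.chain 0, 0) (cWord J (i + 1)) (.main i, 0) := by
  unfold cWord
  generalize h9 : 10 ^ (J + 10 * ((i : ℕ) + 1) - 9) = x9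
  generalize h8 : 10 ^ (J + 10 * ((i : ℕ) + 1) - 8) = x8
  generalize h7 : 10 ^ (J + 10 * ((i : ℕ) + 1) - 7) = x7
  generalize h6 : 10 ^ (J + 10 * ((i : ℕ) + 1) - 6) = x6
  generalize h5 : 10 ^ (J + 10 * ((i : ℕ) + 1) - 5) = x5
  have h := reads_apow r J σ (.main i) (-pw J i 5) x5
  rw [show -pw J i 5 + (x5 : ℤ) = 0 by simp [pw, ← h5]] at h
  exact (((((((((reads_chain r J σ (i + 1) (by omega)).append
    (reads_apow_pw r J σ _ (e := 9) (by simp [pw, ← h9]))).append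
    (reads_edge r J σ (e := .br i 0) rfl)).append
    (reads_apow_pw r J σ _ (e := 8) (by simp [pw, ← h8]))).append
    (reads_edge r J σ (e := .br i 1) rfl)).append
    (reads_apow_pw r J σ _ (e := 7) (by simp [pw, ← h7]))).append
    (reads_edge r J σ (e := .br i 2) rfl)).append
    (reads_apow_pw r J σ _ (e := 6) (by simp [pw, ← h6]))).append
    (reads_edge r J σ (e := .br i 3) rfl)).append h

theorem reads_edgeWord (i : Fin K) (s : Fin 4) :
    Reads (model r J σ).Step (.main i, 0) (edgeWord J s (i + 1) (σ s i + 1))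
      (.main (σ s i), 0) := by
  have h := reads_edge r J σ (e := .y i s) rfl
  match s, h with
  | 0, h =>
    simp only [edSrc, edTgt, edgeWord] at h ⊢
    generalize hy : 10 ^ (J + 10 * ((σ 0 i : ℕ) + 1) - 4) = y
    exact h.append (reads_ainv_pw r J σ _ (by simp [pw, ← hy]))
  | 1, h =>
    simp only [edSrc, edTgt, edgeWord] at h ⊢
    generalize hx : 10 ^ (J + 10 * ((i : ℕ) + 1)) = x
    generalize hy : 10 ^ (J + 10 * ((σ 1 i : ℕ) + 1) - 3) = y
    exact ((reads_apow_pw r J σ _ (by simp [pw, ← hx])).append h).append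
      (reads_ainv_pw r J σ _ (by simp [pw, ← hy]))
  | 2, h =>
    simp only [edSrc, edTgt, edgeWord] at h ⊢
    generalize hx : 10 ^ (J + 10 * ((i : ℕ) + 1) - 2) = x
    generalize hy : 10 ^ (J + 10 * ((σ 2 i : ℕ) + 1)) = y
    exact ((reads_apow_pw r J σ _ (by simp [pw, ← hx])).append h).append
      (reads_ainv_pw r J σ _ (by simp [pw, ← hy]))
  | 3, h =>
    simp only [edSrc, edTgt, edgeWord] at h ⊢
    generalize hx : 10 ^ (J + 10 * ((i : ℕ) + 1) - 1) = x
    exact (reads_apow_pw r J σ _ (by simp [pw, ← hx])).append h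

theorem reads_ripsRelator (ρ : RelIdx m n) :
    Reads (model r J σ).Step (.rip ρ 0, 0) (ripsRelator r ρ) (.rip ρ 0, 0) := by
  have key : ∀ s, s ≤ (syl r ρ).length → Reads (model r J σ).Step (.rip ρ 0, 0)
      (ofSyl ((syl r ρ).take s)) (.rip ρ (s % (syl r ρ).length), 0) := by
    intro s
    induction s with
    | zero => intro _; rw [Nat.zero_mod]; rfl
    | succ s ih =>
      intro hs
      rw [List.take_succ_eq_append_getElem hs, ofSyl_append]
      refine (ih (by omega)).append ?_
      rw [Nat.mod_eq_of_lt hs]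
      have h1 := reads_apow r J σ (.rip ρ s) 0 (syl r ρ)[s].1
      rw [zero_add] at h1
      have h2 : ofSyl [(syl r ρ)[s]] = apow (syl r ρ)[s].1 ++ [(syl r ρ)[s].2] := by simp [ofSyl]
      rw [h2]
      exact h1.append ⟨_, Or.inr ⟨(.rip ρ ⟨s, hs⟩, true), rfl, rfl, rfl⟩, rfl⟩
  have := key _ le_rfl
  rwa [List.take_length, Nat.mod_self, ← ripsRelator_eq] at this

theorem cycleLabels_subset :
    (relatorGraph r J σ).cycleLabels ⊆ closedLabels (model r J σ).Step := by
  have hsymm := (model r J σ).step_symm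
  have hdet := LineGraph.step_det (folded r J σ)
  obtain ⟨ψ, hψ⟩ := LabelledGraph.exists_hom_subdivide (Γ := ripsSegevPattern m J σ) hsymm
    (ψ := fun u => u.elim (.chain 0, 0) fun i => (.main i, 0))
    (by rintro (⟨i, s⟩ | i); exacts [reads_edgeWord r J σ i s, reads_cWord r J σ i])
  obtain ⟨ψ₁, h₁⟩ := LabelledGraph.exists_hom_fold hsymm hdet hψ
  obtain ⟨ψ₂, h₂⟩ := LabelledGraph.exists_hom_subdivide
    (Γ := { V := RelIdx m n, E := RelIdx m n, src := id, tgt := id, lab := ripsRelator r }) hsymm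
    (ψ := fun ρ => (.rip ρ 0, 0)) (reads_ripsRelator r J σ)
  refine LabelledGraph.cycleLabels_subset hsymm (ψ := Sum.elim ψ₁ ψ₂) ?_
  rintro (e | e)
  exacts [h₁ e, h₂ e]

variable {r J σ}

/-- Paths from one vertex with labels equal in `G` have the same endpoint. -/
theorem eq_of_toG_eq (hnm : 9 * (n + 4 * m) < 10 ^ J)
    (hgirth : ∀ v p, (cover σ).IsReducedCycle v p → 19 ≤ p.length) {u v v' : Line m n K × ℤ}
    {w w' : Word m} (h : Reads (model r J σ).Step u w v) (h' : Reads (model r J σ).Step u w' v')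
    (heq : toG r J σ (FreeGroup.mk w) = toG r J σ (FreeGroup.mk w')) : v = v' := by
  have hsymm := (model r J σ).step_symm
  refine eq_of_mem_normalClosure hsymm (LineGraph.step_det (folded r J σ))
    (smallCancellation r J σ hnm hgirth) ((h.invRev hsymm).append h') ?_
  refine Subgroup.normalClosure_mono (cycleLabels_subset r J σ) ?_
  rw [← PresentedGroup.mk_eq_one_iff, ← FreeGroup.mul_mk, ← FreeGroup.inv_mk, map_mul, map_inv]
  exact inv_mul_eq_one.2 heq

theorem mk_apow (k : ℕ) : FreeGroup.mk (apow (m := m) k) = FreeGroup.of Gen.a ^ k := by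
  induction k with
  | zero => rfl
  | succ k ih =>
    rw [pow_succ', ← ih]; rfl

theorem mk_ainv (k : ℕ) : FreeGroup.mk (ainv (m := m) k) = (FreeGroup.of Gen.a ^ k)⁻¹ := by
  rw [← mk_apow, FreeGroup.inv_mk, invRev_apow]

theorem mk_bpow_one : FreeGroup.mk (bpow (m := m) 1) = FreeGroup.of Gen.b := rfl

/-! ### The relations between the elements of `A` -/

variable (r J σ)

theorem reads_relatorGraph (e : (ripsSegevPattern m J σ).E) :
    Reads (relatorGraph r J σ).Dart (.inl (Quotient.mk _ (.inl ((ripsSegevPattern m J σ).src e))))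
      ((ripsSegevPattern m J σ).lab e)
      (.inl (Quotient.mk _ (.inl ((ripsSegevPattern m J σ).tgt e)))) := by
  have he : (ripsSegevPattern m J σ).lab e ≠ [] := by
    rcases e with ⟨i, s⟩ | i
    · fin_cases s <;> simp [edgeWord, bpow]
    · simp [cWord, bpow]
  exact ((LabelledGraph.reads_subdivide e he).map LabelledGraph.dart_fold).map
    LabelledGraph.dart_inl

/-- The image of `c_i` in `G`. -/
def cG (i : Fin K) : RipsSegevGroup r J σ := toG r J σ (FreeGroup.mk (cWord J (i + 1)))

theorem cG_mul_edgeWord (i : Fin K) (s : Fin 4) :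
    cG r J σ i * toG r J σ (FreeGroup.mk (edgeWord J s (i + 1) (σ s i + 1))) =
      cG r J σ (σ s i) := by
  have h := LabelledGraph.mk_mem_normalClosure
    (((reads_relatorGraph r J σ (.inr i)).append (reads_relatorGraph r J σ (.inl (i, s)))).append
    ((reads_relatorGraph r J σ (.inr (σ s i))).invRev LabelledGraph.dart_symm))
  rw [← PresentedGroup.mk_eq_one_iff, ← FreeGroup.mul_mk, ← FreeGroup.mul_mk, ← FreeGroup.inv_mk,
    map_mul, map_mul, map_inv] at h
  exact mul_inv_eq_one.1 h

local notation "α" => toG r J σ (FreeGroup.of Gen.a)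
local notation "β" => toG r J σ (FreeGroup.of Gen.b)

theorem relation_zero (i : Fin K) :
    cG r J σ i * β = cG r J σ (σ 0 i) * α ^ 10 ^ (J + 10 * ((σ 0 i : ℕ) + 1) - 4) := by
  have h := cG_mul_edgeWord r J σ i 0
  simp only [edgeWord, ← FreeGroup.mul_mk, mk_ainv, mk_bpow_one, map_mul, map_inv, map_pow] at h
  rw [← h]; group

theorem relation_one (i : Fin K) :
    cG r J σ i * α ^ 10 ^ (J + 10 * ((i : ℕ) + 1)) * β =
      cG r J σ (σ 1 i) * α ^ 10 ^ (J + 10 * ((σ 1 i : ℕ) + 1) - 3) := by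
  have h := cG_mul_edgeWord r J σ i 1
  simp only [edgeWord, ← FreeGroup.mul_mk, mk_ainv, mk_apow, mk_bpow_one, map_mul, map_inv,
    map_pow] at h
  rw [← h]; simp only [mul_assoc, inv_mul_cancel, mul_one]

theorem relation_two (i : Fin K) :
    cG r J σ i * α ^ 10 ^ (J + 10 * ((i : ℕ) + 1) - 2) * β =
      cG r J σ (σ 2 i) * α ^ 10 ^ (J + 10 * ((σ 2 i : ℕ) + 1)) := by
  have h := cG_mul_edgeWord r J σ i 2
  simp only [edgeWord, ← FreeGroup.mul_mk, mk_ainv, mk_apow, mk_bpow_one, map_mul, map_inv,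
    map_pow] at h
  rw [← h]; simp only [mul_assoc, inv_mul_cancel, mul_one]

theorem relation_three (i : Fin K) :
    cG r J σ i * α ^ 10 ^ (J + 10 * ((i : ℕ) + 1) - 1) * β = cG r J σ (σ 3 i) := by
  have h := cG_mul_edgeWord r J σ i 3
  simp only [edgeWord, ← FreeGroup.mul_mk, mk_apow, mk_bpow_one, map_mul, map_pow] at h
  rw [← h, mul_assoc]

end

/-! ### Injectivity and products without unique representation -/

section

variable {m n K : ℕ} {r : Fin n → FreeGroup (Fin m)} {J : ℕ} {σ : Fin 4 → Equiv.Perm (Fin K)}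

local notation "α" => toG r J σ (FreeGroup.of Gen.a)
local notation "β" => toG r J σ (FreeGroup.of Gen.b)

theorem injOn_setA (hnm : 9 * (n + 4 * m) < 10 ^ J)
    (hgirth : ∀ v p, (cover σ).IsReducedCycle v p → 19 ≤ p.length) :
    Set.InjOn (toG r J σ) (setA m K J) := by
  rintro _ ⟨i, t, -, rfl⟩ _ ⟨i', t', -, rfl⟩ h
  rw [← mk_apow, ← mk_apow, FreeGroup.mul_mk, FreeGroup.mul_mk] at h
  have h1 := eq_of_toG_eq hnm hgirth ((reads_cWord r J σ i).append (reads_apow r J σ _ _ t))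
    ((reads_cWord r J σ i').append (reads_apow r J σ _ _ t')) h
  simp only [zero_add, Prod.mk.injEq, Line.main.injEq, Nat.cast_inj] at h1
  rw [h1.1, h1.2]

/-- The elements of `B` are separated by the paths that they label at the beginning of the chain
of edges along which the powers of `b` are read. -/
theorem ne_of_setB (hK : 1 ≤ K) (hnm : 9 * (n + 4 * m) < 10 ^ J)
    (hgirth : ∀ v p, (cover σ).IsReducedCycle v p → 19 ≤ p.length) :
    α ≠ 1 ∧ β ≠ 1 ∧ α * β ≠ 1 ∧ α ≠ β := by
  have ha : ∀ t : ℤ, Reads (model r J σ).Step (.chain 0, t) [(Gen.a, true)] (.chain 0, t + 1) :=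
    fun t => reads_apow r J σ (.chain 0) t 1
  have hb : Reads (model r J σ).Step (.chain 0, 0) [(Gen.b, true)] (.chain 1, 0) :=
    reads_chain r J σ 1 hK
  have hab : Reads (model r J σ).Step (.chain 0, -1) [(Gen.a, true), (Gen.b, true)] (.chain 1, 0) :=
    (ha (-1)).append hb
  have h1 : ∀ u, Reads (model r J σ).Step u [] u := fun u => rfl
  refine ⟨fun h => ?_, fun h => ?_, fun h => ?_, fun h => ?_⟩
  · have := eq_of_toG_eq hnm hgirth (ha 0) (h1 _) (h.trans (map_one _).symm)
    simp at this
  · have := eq_of_toG_eq hnm hgirth hb (h1 _) (h.trans (map_one _).symm)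
    simp at this
  · have := eq_of_toG_eq hnm hgirth hab (h1 _) (((map_mul _ _ _).trans h).trans (map_one _).symm)
    simp at this
  · have := eq_of_toG_eq hnm hgirth (ha 0) hb h
    simp at this

theorem injOn_setB (hK : 1 ≤ K) (hnm : 9 * (n + 4 * m) < 10 ^ J)
    (hgirth : ∀ v p, (cover σ).IsReducedCycle v p → 19 ≤ p.length) :
    Set.InjOn (toG r J σ) (setB m) := by
  obtain ⟨h1, h2, h3, h4⟩ := ne_of_setB (r := r) hK hnm hgirth
  rintro _ (rfl | rfl | rfl | rfl) _ (rfl | rfl | rfl | rfl) h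
  all_goals first | rfl | skip
  all_goals
    exfalso
    try simp only [map_one, map_mul] at h
    try simp only [left_eq_mul, right_eq_mul, mul_eq_left, mul_eq_right] at h
    first
      | exact h1 h | exact h2 h | exact h3 h | exact h4 h
      | exact h1 h.symm | exact h2 h.symm | exact h3 h.symm | exact h4 h.symm

/-- Every product `c_i a^t h` with `h ∈ B` has a second factorization: if no power of `a` can be
moved between the two factors, one of the four edges of `Θ` labelled `h` at the vertex `i` gives
another one. -/
theorem exists_factorization (hne : α ≠ 1 ∧ β ≠ 1 ∧ α * β ≠ 1 ∧ α ≠ β) (i : Fin K) {t : ℕ}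
    (ht : t < 10 ^ (J + 10 * ((i : ℕ) + 1))) {h : FreeGroup (Gen m)} (hh : h ∈ setB m) :
    ∃ (k : Fin K) (s : ℕ), s < 10 ^ (J + 10 * ((k : ℕ) + 1)) ∧ ∃ h' ∈ setB m,
      cG r J σ i * α ^ t * toG r J σ h = cG r J σ k * α ^ s * toG r J σ h' ∧
      toG r J σ h' ≠ toG r J σ h := by
  obtain ⟨ha, hb, hab, hne⟩ := hne
  have hlt : ∀ (k : Fin K) (e : ℕ), 0 < e → e < 10 →
      10 ^ (J + 10 * ((k : ℕ) + 1) - e) < 10 ^ (J + 10 * ((k : ℕ) + 1)) := fun k e h0 h1 =>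
    Nat.pow_lt_pow_right (by norm_num) (by omega)
  have ht' : t + 1 < 10 ^ (J + 10 * ((i : ℕ) + 1)) ∨ t + 1 = 10 ^ (J + 10 * ((i : ℕ) + 1)) :=
    lt_or_eq_of_le ht
  have m1 : (1 : FreeGroup (Gen m)) ∈ setB m := by simp [setB]
  have ma : FreeGroup.of Gen.a ∈ setB m := by simp [setB]
  have mb : FreeGroup.of Gen.b ∈ setB m := by simp [setB]
  have mab : FreeGroup.of Gen.a * FreeGroup.of Gen.b ∈ setB m := by simp [setB]
  rcases hh with rfl | rfl | rfl | rfl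
  · rcases t with _ | t
    · obtain ⟨k, rfl⟩ := (σ 3).surjective i
      refine ⟨k, _, hlt k 1 (by norm_num) (by norm_num), _, mb, ?_, by simpa using hb⟩
      rw [relation_three, pow_zero, map_one, mul_one, mul_one]
    · refine ⟨i, t, by omega, _, ma, ?_, by simpa using ha⟩
      rw [map_one, mul_one, pow_succ, mul_assoc]
  · rcases ht' with ht' | ht'
    · refine ⟨i, t + 1, ht', _, m1, ?_, by simpa using ha.symm⟩
      rw [map_one, mul_one, pow_succ, mul_assoc]
    · obtain ⟨k, rfl⟩ := (σ 2).surjective i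
      refine ⟨k, _, hlt k 2 (by norm_num) (by norm_num), _, mb, ?_, hne.symm⟩
      rw [relation_two, mul_assoc, ← pow_succ, ht']
  · rcases t with _ | t
    · refine ⟨σ 0 i, _, hlt _ 4 (by norm_num) (by norm_num), _, m1, ?_, by simpa using hb.symm⟩
      rw [← relation_zero, pow_zero, map_one, mul_one, mul_one]
    · refine ⟨i, t, by omega, _, mab, ?_, by simpa using ha⟩
      rw [map_mul, pow_succ]
      simp only [mul_assoc]
  · rcases ht' with ht' | ht'
    · refine ⟨i, t + 1, ht', _, mb, ?_, by simpa using ha⟩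
      rw [map_mul, pow_succ]
      simp only [mul_assoc]
    · refine ⟨σ 1 i, _, hlt _ 3 (by norm_num) (by norm_num), _, m1, ?_, by simpa using hab.symm⟩
      rw [← relation_one, map_one, mul_one, ← ht', map_mul, pow_succ]
      simp only [mul_assoc]

theorem finite_setA (m K J : ℕ) : (setA m K J).Finite := by
  have h : (⋃ i : Fin K, (fun t : ℕ => FreeGroup.mk (cWord (m := m) J (i + 1)) *
      FreeGroup.of Gen.a ^ t) '' Set.Iio (10 ^ (J + 10 * ((i : ℕ) + 1)))).Finite :=
    Set.finite_iUnion fun i => (Set.finite_Iio _).image _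
  refine h.subset ?_
  rintro _ ⟨i, t, ht, rfl⟩
  exact Set.mem_iUnion.2 ⟨i, t, ht, rfl⟩

end

/-- A group with finite non-empty sets `A`, `B` such that no product of elements of their images
is uniquely represented does not have the unique product property. -/
theorem not_uniqueProds {F G : Type} [Group F] [Group G] (f : F →* G) {A B : Set F}
    (hA : A.Finite) (hB : B.Finite) (hA' : A.Nonempty) (hB' : B.Nonempty)
    (h : ∀ a ∈ A, ∀ b ∈ B, ∃ a' ∈ A, ∃ b' ∈ B,
      f a * f b = f a' * f b' ∧ (f a', f b') ≠ (f a, f b)) :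
    ¬ UniqueProds G := by
  classical
  intro hU
  obtain ⟨x, hx, y, hy, hxy⟩ := hU.uniqueMul_of_nonempty (A := (hA.image f).toFinset)
    (B := (hB.image f).toFinset) (by simpa using hA') (by simpa using hB')
  rw [Set.Finite.mem_toFinset] at hx hy
  obtain ⟨a, ha, rfl⟩ := hx
  obtain ⟨b, hb, rfl⟩ := hy
  obtain ⟨a', ha', b', hb', h1, h2⟩ := h a ha b hb
  have := hxy (a := f a') (b := f b') (by simpa using ⟨a', ha', rfl⟩)
    (by simpa using ⟨b', hb', rfl⟩) h1.symm
  exact h2 (Prod.ext this.1 this.2)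

end RipsSegev

/-- For every finite presentation `⟨x₁, …, x_m ∣ r₁, …, r_n⟩`, every `J ≥ 1` with
`9(n + 4m) < 10^J` and every finite connected regular cover `Θ` of the bouquet of 4 cycles, all of
whose non-trivial cycles have length at least 19, the sets `A` and `B` embed in `G`, no element of
the product of their images has a unique representation, and so `G` does not have the unique
product property. -/
theorem theorem3p2 (m n : ℕ) (r : Fin n → FreeGroup (Fin m)) (K J : ℕ) (hK : 1 ≤ K) (hJ : 1 ≤ J)
    (hnm : 9 * (n + 4 * m) < 10 ^ J) (σ : Fin 4 → Equiv.Perm (Fin K))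
    (hconn : (cover σ).Connected) (hreg : IsRegularCover σ)
    (hgirth : ∀ v p, (cover σ).IsReducedCycle v p → 19 ≤ p.length) :
    ¬ UniqueProds (RipsSegevGroup r J σ) ∧
    Set.InjOn (toG r J σ) (setA m K J) ∧
    Set.InjOn (toG r J σ) (setB m) ∧
    ∀ g ∈ setA m K J, ∀ h ∈ setB m, ∃ g' ∈ setA m K J, ∃ h' ∈ setB m,
      toG r J σ g * toG r J σ h = toG r J σ g' * toG r J σ h' ∧
      (toG r J σ g', toG r J σ h') ≠ (toG r J σ g, toG r J σ h) := by
  have hprod : ∀ g ∈ setA m K J, ∀ h ∈ setB m, ∃ g' ∈ setA m K J, ∃ h' ∈ setB m,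
      toG r J σ g * toG r J σ h = toG r J σ g' * toG r J σ h' ∧
      (toG r J σ g', toG r J σ h') ≠ (toG r J σ g, toG r J σ h) := by
    rintro _ ⟨i, t, ht, rfl⟩ h hh
    obtain ⟨k, s, hs, h', hh', h1, h2⟩ :=
      exists_factorization (ne_of_setB (r := r) hK hnm hgirth) i ht hh
    refine ⟨_, ⟨k, s, hs, rfl⟩, h', hh', ?_, fun h3 => h2 (Prod.ext_iff.1 h3).2⟩
    rw [map_mul, map_mul, map_pow, map_pow]
    exact h1
  refine ⟨not_uniqueProds (toG r J σ) (finite_setA m K J) (by simp [setB]) ?_ ⟨1, by simp [setB]⟩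
    hprod, injOn_setA hnm hgirth, injOn_setB hK hnm hgirth, hprod⟩
  exact ⟨_, ⟨0, hK⟩, 0, by positivity, rfl⟩
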